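/- Let $c_0,\dots,c_n\in\mathbb R[\gamma]$ have degree at most $d$, with $c_0\not\equiv 0$, and put $p_\gamma(x)=\sum_{k=0}^n(-1)^k x^{n-k}c_k(\gamma)$. A real polynomial is called real-rooted if it is zero or all its complex roots are real. For $c_0(\gamma)\ne 0$ let $m_j(p_\gamma)$ be the sum of the $j$-th powers of the $n$ complex roots of $p_\gamma$ (with multiplicity), let $\nu$ be the least even integer with $\nu\ge n$ and $\nu\ge 2n-2$, and let $H(\gamma)$ be the $n\times n$ Hankel matrix with entries $H(\gamma)_{k,l}=c_0(\gamma)^\nu m_{k+l-2}(p_\gamma)$; its entries are polynomials in $\gamma$. For a matrix $A$ let $e_k(A)$ be the sum of its $k\times k$ principal minors. The algorithm SimpleRR takes the coefficients of $c_0,\dots,c_n$ as input and proceeds as follows. Let $N=n(d+1)(2n-2+\nu)$ and let $s_1,\dots,s_N$ be the $N$-th roots of unity. For each $i$, evaluate $c_0(s_i),\dots,c_n(s_i)$, compute $H(s_i)$ by the Newton identities for $r_j=c_0^j m_j$ (with cleared denominators), and compute $e_1(H(s_i)),\dots,e_n(H(s_i))$ from the characteristic polynomial of $H(s_i)$, which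 a subroutine computes. For each $k=1,\dots,n$, a second subroutine computes the coefficients of the polynomial $q_k$ of degree less than $N$ with $q_k(s_i)=e_k(H(s_i))$ for all $i$. Output $q_1,\dots,q_n$. Theorem. (1) The output polynomials $q_1,\dots,q_n$ are real polynomials of degree at most $3n^2d$ and satisfy $q_k(\gamma)=e_k(H(\gamma))$ for every real $\gamma$ with $c_0(\gamma)\neq 0$; and $p_\gamma$ is real-rooted for all $\gamma\in\mathbb R$ if and only if $q_1,\dots,q_n$ are all nonnegative on $\mathbb R$. (2) Count arithmetic operations and zero tests in exact arithmetic over $\mathbb C$ (algebraic computation trees). Let $\omega$ be a real number such that $n\times n$ complex matrices can be multiplied in $O(n^\omega)$ operations. Then, with suitable correct subroutines for the characteristic polynomial and for the interpolation, SimpleRR runs in time $\tilde O(dn^{2+\omega}+d^2n^3)$ for $n,d\ge 1$: there are constants $C$ and $\kappa$, independent of $n$, $d$ and the input, such that it uses at most $C\,(dn^{2+\omega}+d^2n^3)\,(\log(nd+2))^\kappa$ operations. -/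

import Mathlib

open Polynomial

/-! ### A machine model: algebraic computation trees with unit costs

A program over a field `K` works on a list of registers, each holding an element of `K`, and refers
to registers by their index. Each instruction either appends one new register or tests whether a
register is zero. The continuation of an instruction only receives the index of the new register or
the truth value of the test, so that a program can use the values only through instructions. -/

/-- The four field operations. -/
inductive ArithOp : Type
  | add
  | sub
  | mul
  | div

/-- The value of a field operation (with `x / 0 = 0`; a program can test for zero). -/
def ArithOp.apply {K : Type} [Field K] : ArithOp → K → K → K
  | .add, x, y => x + y
  | .sub, x, y => x - y
  | .mul, x, y => x * y
  | .div, x, y => x / y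

/-- Programs (computation trees) over `K` that return an element of `α`, typically a family of
register indices. -/
inductive Prog (K : Type) (α : Type) : Type
  | ret (a : α) : Prog K α
  | const (z : K) (k : ℕ → Prog K α) : Prog K α
  | arith (o : ArithOp) (i j : ℕ) (k : ℕ → Prog K α) : Prog K α
  | test (i : ℕ) (k : Bool → Prog K α) : Prog K α

/-- The result of a run: returned object, final registers, number of executed instructions. -/
structure RunResult (K : Type) (α : Type) : Type where
  out : α
  mem : List K
  cost : ℕ

namespace Prog

variable {K : Type} {α β : Type}

/-- Execution. The register with index `i` is entry `i` of the list; each instruction costs `1`. -/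
def run [Field K] [DecidableEq K] : Prog K α → List K → RunResult K α
  | ret a, mem => ⟨a, mem, 0⟩
  | const z k, mem =>
      let r := run (k mem.length) (mem ++ [z])
      ⟨r.out, r.mem, r.cost + 1⟩
  | arith o i j k, mem =>
      let r := run (k mem.length) (mem ++ [o.apply (mem.getD i 0) (mem.getD j 0)])
      ⟨r.out, r.mem, r.cost + 1⟩
  | test i k, mem =>
      let r := run (k (decide (mem.getD i 0 = 0))) mem
      ⟨r.out, r.mem, r.cost + 1⟩

/-- Sequential composition. -/
def bind : Prog K α → (α → Prog K β) → Prog K β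
  | ret a, f => f a
  | const z k, f => const z fun i => bind (k i) f
  | arith o i j k, f => arith o i j fun l => bind (k l) f
  | test i k, f => test i fun b => bind (k b) f

instance : Monad (Prog K) where
  pure := ret
  bind := bind

/-- Load a constant. -/
def lit (z : K) : Prog K ℕ := const z ret

/-- Add two registers. -/
def add (i j : ℕ) : Prog K ℕ := arith .add i j ret

/-- Multiply two registers. -/
def mul (i j : ℕ) : Prog K ℕ := arith .mul i j ret

/-- Execute `f 0, …, f (n - 1)` in this order and collect the results. -/
def forFin : (n : ℕ) → (Fin n → Prog K β) → Prog K (Fin n → β)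
  | 0, _ => pure Fin.elim0
  | n + 1, f => do
      let b ← f 0
      let bs ← forFin n fun i => f i.succ
      pure (Fin.cons b bs)

/-- `Σ x * y` over a list of pairs of registers. -/
def dot [Field K] : List (ℕ × ℕ) → Prog K ℕ
  | [] => lit 0
  | t :: ts => do
      let s ← dot ts
      let w ← mul t.1 t.2
      add s w

/-- Horner's rule: `a₀ + a₁ x + a₂ x² + ⋯`. -/
def horner [Field K] (x : ℕ) : List ℕ → Prog K ℕ
  | [] => lit 0
  | a :: as => do
      let v ← horner x as
      let w ← mul v x
      add w a

/-- The list `x⁰, x¹, …, xᵐ`. -/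
def powers [Field K] (x : ℕ) : ℕ → Prog K (List ℕ)
  | 0 => do
      let o ← lit 1
      pure [o]
  | m + 1 => do
      let l ← powers x m
      let y ← mul (l.getD m 0) x
      pure (l ++ [y])

end Prog

/-- The registers `h i` exist and hold the values `v i`. -/
def Holds {K ι : Type} (mem : List K) (h : ι → ℕ) (v : ι → K) : Prop :=
  ∀ i, mem[h i]? = some (v i)

/-! ### The algorithm -/

namespace SimpleRR

open Prog

/-- The least even integer `ν` with `ν ≥ n` and `ν ≥ 2n - 2`. -/
def nu (n : ℕ) : ℕ := 2 * max ((n + 1) / 2) (n - 1)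

/-- The number of sample points. -/
def numPoints (n d : ℕ) : ℕ := n * (d + 1) * (2 * n - 2 + nu n)

/-- The sample points are the powers of this primitive `N`-th root of unity. -/
noncomputable def rootOfUnity (N : ℕ) : ℂ := Complex.exp (2 * Real.pi * Complex.I / N)

/-- Programs that take (the registers of) an `n × n` matrix and return `n + 1` registers. -/
abbrev CharpolyRoutine (K : Type) : Type :=
  (n : ℕ) → (Fin n → Fin n → ℕ) → Prog K (Fin (n + 1) → ℕ)

/-- Programs that take `N` registers and return `N` registers. -/
abbrev InterpRoutine (K : Type) : Type :=
  (N : ℕ) → (Fin N → ℕ) → Prog K (Fin N → ℕ)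

/-- Newton's identities with cleared denominators. If register `u j` holds `(-1)^j c_{j+1} c_0^j`,
this computes `r_0, …, r_m`, where `r_k = c_0^k m_k` is a polynomial in the `c_j`:
`r_0 = n` and `r_{k+1} = Σ_{j < min n k} u_j r_{k-j} + [k < n] (k + 1) u_k`. -/
def scaledMoments {K : Type} [Field K] (n : ℕ) (u : Fin n → ℕ) : ℕ → Prog K (List ℕ)
  | 0 => do
      let h ← lit (n : K)
      pure [h]
  | k + 1 => do
      let r ← scaledMoments n u k
      let s ← dot (((List.finRange n).filter fun j => j.val < k).map
        fun j => (u j, r.getD (k - j.val) 0))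
      let y ← if h : k < n then do
          let t ← lit ((k : K) + 1)
          let w ← mul t (u ⟨k, h⟩)
          add s w
        else pure s
      pure (r ++ [y])

/-- The Hankel matrix at the sample point `s`, with entries
`c_0(s)^ν m_{a+b} = c_0(s)^(ν-(a+b)) r_{a+b}`, where `a, b` are counted from `0`. -/
def hankelProg {K : Type} [Field K] (n d : ℕ) (c : Fin (n + 1) → Fin (d + 1) → ℕ) (s : K) :
    Prog K (Fin n → Fin n → ℕ) := do
  let x ← lit s
  let cv ← forFin (n + 1) fun k => horner x (List.ofFn (c k))
  let pw ← powers (cv 0) (nu n)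
  let u ← forFin n fun j => do
    let sg ← lit ((-1 : K) ^ j.val)
    let t ← mul sg (cv j.succ)
    mul t (pw.getD j.val 0)
  let r ← scaledMoments n u (2 * n - 2)
  let h ← forFin (2 * n - 1) fun j => mul (pw.getD (nu n - j.val) 0) (r.getD j.val 0)
  pure fun a b => h ⟨a.val + b.val, by omega⟩

/-- One pass of the main loop: the values `e_1(H(s)), …, e_n(H(s))`, read off the characteristic
polynomial `Σ_k (-1)^k z^(n-k) e_k(H(s))`. -/
def sampleProg {K : Type} [Field K] (charpolyR : CharpolyRoutine K) (n d : ℕ)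
    (c : Fin (n + 1) → Fin (d + 1) → ℕ) (s : K) : Prog K (Fin n → ℕ) := do
  let H ← hankelProg n d c s
  let f ← charpolyR n H
  forFin n fun k => do
    let sg ← lit ((-1 : K) ^ (k.val + 1))
    mul sg (f ⟨n - (k.val + 1), by omega⟩)

/-- The main loop over `N` sample points `ζ^0, …, ζ^(N-1)` and the final interpolation. -/
def progWith {K : Type} [Field K] (charpolyR : CharpolyRoutine K) (interpR : InterpRoutine K)
    (N : ℕ) (ζ : K) (n d : ℕ) (c : Fin (n + 1) → Fin (d + 1) → ℕ) :
    Prog K (Fin n → Fin N → ℕ) := do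
  let e ← forFin N fun i => sampleProg charpolyR n d c (ζ ^ i.val)
  forFin n fun k => interpR N fun i => e i k

/-- The algorithm SimpleRR, given the two subroutines that it calls. Register `c k j` holds the
coefficient of `γ^j` in `c_k`; the returned register `(k, j)` is meant to hold the coefficient of
`γ^j` in `q_{k+1}`. -/
noncomputable def prog (charpolyR : CharpolyRoutine ℂ) (interpR : InterpRoutine ℂ) (n d : ℕ)
    (c : Fin (n + 1) → Fin (d + 1) → ℕ) : Prog ℂ (Fin n → Fin (numPoints n d) → ℕ) :=
  progWith charpolyR interpR (numPoints n d) (rootOfUnity (numPoints n d)) n d c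

/-- The routine computes the coefficients of the characteristic polynomial of every complex
square matrix. -/
def ComputesCharpoly (R : CharpolyRoutine ℂ) : Prop :=
  ∀ (n : ℕ) (A : Matrix (Fin n) (Fin n) ℂ) (h : Fin n → Fin n → ℕ) (mem : List ℂ),
    (∀ a, Holds mem (h a) (A a)) →
    Holds ((R n h).run mem).mem ((R n h).run mem).out fun j => A.charpoly.coeff j

/-- The routine computes, for every list of `N` complex values, the coefficients of the polynomial
of degree `< N` that takes these values at the `N`-th roots of unity. -/
def ComputesInterp (R : InterpRoutine ℂ) : Prop :=
  ∀ (N : ℕ) (v : Fin N → ℂ) (h : Fin N → ℕ) (mem : List ℂ), Holds mem h v →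
    ∃ a : Fin N → ℂ, (∀ i : Fin N, ∑ j : Fin N, a j * (rootOfUnity N ^ i.val) ^ j.val = v i) ∧
      Holds ((R N h).run mem).mem ((R N h).run mem).out a

end SimpleRR

/-- `n × n` complex matrices can be multiplied in `O(n^ω)` arithmetic operations. -/
def IsMatMulExponent (ω : ℝ) : Prop :=
  ∃ (mm : (n : ℕ) → (Fin n → Fin n → ℕ) → (Fin n → Fin n → ℕ) → Prog ℂ (Fin n → Fin n → ℕ))
    (C : ℝ), ∀ n : ℕ, 1 ≤ n → ∀ (A B : Matrix (Fin n) (Fin n) ℂ) (hA hB : Fin n → Fin n → ℕ)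
      (mem : List ℂ), (∀ a, Holds mem (hA a) (A a)) → (∀ a, Holds mem (hB a) (B a)) →
      (∀ a, Holds ((mm n hA hB).run mem).mem (((mm n hA hB).run mem).out a) ((A * B) a)) ∧
      (((mm n hA hB).run mem).cost : ℝ) ≤ C * (n : ℝ) ^ ω

/-! ### The mathematical objects -/

/-- A real polynomial is real-rooted if it is zero or all its complex roots are real. -/
def RealRooted (p : ℝ[X]) : Prop := p = 0 ∨ ∀ z : ℂ, aeval z p = 0 → z.im = 0

/-- `p_γ(x) = Σ_{k=0}^n (-1)^k x^(n-k) c_k(γ)`. -/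
noncomputable def family {n : ℕ} (c : Fin (n + 1) → ℝ[X]) (γ : ℝ) : ℝ[X] :=
  ∑ k : Fin (n + 1), C ((-1) ^ k.val * (c k).eval γ) * X ^ (n - k.val)

/-- The `k`-th moment `Σ x_i^k` of the complex roots, with multiplicity. -/
noncomputable def rootMoment (p : ℝ[X]) (k : ℕ) : ℂ := ((p.aroots ℂ).map fun x => x ^ k).sum

/-- `H(γ) = c_0(γ)^ν (m_{a+b}(p_γ))_{a,b}` with `0 ≤ a, b < n`, for `c_0(γ) ≠ 0`. -/
noncomputable def hankel {n : ℕ} (c : Fin (n + 1) → ℝ[X]) (γ : ℝ) : Matrix (Fin n) (Fin n) ℂ :=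
  Matrix.of fun a b =>
    (((c 0).eval γ : ℝ) : ℂ) ^ SimpleRR.nu n * rootMoment (family c γ) (a.val + b.val)

/-- `e_k(A)`, the sum of the `k × k` principal minors. -/
noncomputable def sumPrincipalMinors {n : ℕ} (k : ℕ) (A : Matrix (Fin n) (Fin n) ℂ) : ℂ :=
  ∑ S ∈ (Finset.univ : Finset (Fin n)).powersetCard k,
    (A.submatrix (fun i : S => (i : Fin n)) fun i : S => (i : Fin n)).det

namespace SimpleRR

/-- A valid input: `c_0, …, c_n` have degree at most `d`, `c_0` is not the zero polynomial, and the
registers `h k j` hold the coefficients. -/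
def ValidInput {n : ℕ} (d : ℕ) (c : Fin (n + 1) → ℝ[X]) (h : Fin (n + 1) → Fin (d + 1) → ℕ)
    (mem : List ℂ) : Prop :=
  (∀ k, (c k).natDegree ≤ d) ∧ c 0 ≠ 0 ∧
    ∀ k, Holds mem (h k) fun j => (((c k).coeff j : ℝ) : ℂ)

/-- The result of a run outputs the polynomials `q` (all of degree less than `numPoints n d`). -/
def Outputs {n d : ℕ} (r : RunResult ℂ (Fin n → Fin (numPoints n d) → ℕ)) (q : Fin n → ℝ[X]) :
    Prop :=
  ∀ k, (q k).natDegree < numPoints n d ∧ Holds r.mem (r.out k) fun j => (((q k).coeff j : ℝ) : ℂ)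

end SimpleRR

/-!
For `c_0(γ) ≠ 0` the matrix `H(γ)` is `c_0(γ) ^ ν` times `Vᵀ V`, where `V` is the Vandermonde matrix
of the roots of `p_γ`. As `ν` is even, Hermite's criterion says that `p_γ` is real-rooted if and
only if `H(γ)` is positive semidefinite, which means that `e_1(H(γ)), …, e_n(H(γ))` are nonnegative.
Both real-rootedness and nonnegativity pass to the finitely many other `γ` by continuity.

The characteristic polynomial of an `n × n` matrix `A` takes `O(n ^ ω log ^ 3 n)` operations by
splitting a set of generators of the space over `K[A]` into halves: the first half generates an
invariant subspace, which repeated squaring of `A` finds, and the second half generates the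
quotient. A single generator is a cyclic vector, for which the characteristic polynomial solves a
linear system. All linear algebra goes through the pivot inverse, a generalized inverse that is
computed by block elimination.

A Fourier transform whose radices are the prime factors of `N` takes `O(N)` operations times the sum
of these primes. This sum is `O(n + d)`, as it is for each of the three factors of
`N = n (d + 1) (2n - 2 + ν)`.
-/

/-! ### A program logic with costs -/

theorem foldr_horner_ofFn {R : Type*} [Semiring R] (z : R) {n : ℕ} (a : Fin n → R) :
    (List.ofFn a).foldr (fun a s => s * z + a) 0 = ∑ j, a j * z ^ j.val := by
  induction n with
  | zero => simp
  | succ n ih =>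
    rw [List.ofFn_succ, List.foldr_cons, ih, Fin.sum_univ_succ, Finset.sum_mul]
    simp [pow_succ, mul_assoc, add_comm]

namespace Prog

variable {K : Type} {α β : Type}

/-- Register `i` exists and holds `x`. -/
def HasVal (mem : List K) (i : ℕ) (x : K) : Prop := mem[i]? = some x

theorem HasVal.mono {mem mem' : List K} {i : ℕ} {x : K} (h : HasVal mem i x)
    (hm : mem <+: mem') : HasVal mem' i x := by
  obtain ⟨l, rfl⟩ := hm
  unfold HasVal at *
  rw [List.getElem?_append_left (List.getElem?_eq_some_iff.1 h).1, h]

theorem HasVal.getD_eq {mem : List K} {i : ℕ} {x d : K} (h : HasVal mem i x) :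
    mem.getD i d = x := by
  unfold HasVal at h
  simp [List.getD, h]

theorem hasVal_append_singleton (mem : List K) (x : K) :
    HasVal (mem ++ [x]) mem.length x := by
  simp [HasVal]

/-- The list `l` consists of `k + 1` registers, which hold the values `f 0, …, f k`. -/
structure HoldsUpTo (mem : List K) (l : List ℕ) (f : ℕ → K) (k : ℕ) : Prop where
  length_eq : l.length = k + 1
  hasVal : ∀ j ≤ k, HasVal mem (l.getD j 0) (f j)

theorem HoldsUpTo.singleton {mem : List K} {f : ℕ → K} {i : ℕ} (hi : HasVal mem i (f 0)) :
    HoldsUpTo mem [i] f 0 :=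
  ⟨rfl, fun j hj => by simpa [Nat.le_zero.1 hj] using hi⟩

theorem HoldsUpTo.append {mem m : List K} {l : List ℕ} {f : ℕ → K} {k i : ℕ}
    (h : HoldsUpTo mem l f k) (hm : mem <+: m) (hi : HasVal m i (f (k + 1))) :
    HoldsUpTo m (l ++ [i]) f (k + 1) := by
  have hlen := h.length_eq
  refine ⟨by simp [hlen], fun j hj => ?_⟩
  rcases Nat.lt_or_ge j (k + 1) with hjk | hjk
  · rw [List.getD_append _ _ _ _ (by omega)]
    exact (h.hasVal j (by omega)).mono hm
  · obtain rfl : j = k + 1 := by omega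
    rw [List.getD_append_right _ _ _ _ (by omega), hlen]
    simpa using hi

variable [Field K] [DecidableEq K]

theorem run_bind (p : Prog K α) (f : α → Prog K β) (mem : List K) :
    (p >>= f).run mem =
      let r := p.run mem
      let r' := (f r.out).run r.mem
      ⟨r'.out, r'.mem, r.cost + r'.cost⟩ := by
  change (p.bind f).run mem = _
  induction p generalizing mem with
  | ret a => simp [Prog.bind, run]
  | const z k ih => simp [Prog.bind, run, ih]; omega
  | arith o i j k ih => simp [Prog.bind, run, ih]; omega
  | test i k ih => simp [Prog.bind, run, ih]; omega

theorem isPrefix_mem_run (p : Prog K α) (mem : List K) : mem <+: (p.run mem).mem := by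
  induction p generalizing mem with
  | ret => exact List.prefix_rfl
  | const z _ ih => exact (List.prefix_append mem [z]).trans (ih _ _)
  | arith _ _ _ _ ih => exact (List.prefix_append mem _).trans (ih _ _)
  | test _ _ ih => exact ih _ _

theorem length_mem_run_le (p : Prog K α) (mem : List K) :
    (p.run mem).mem.length ≤ mem.length + (p.run mem).cost := by
  induction p generalizing mem with
  | ret => simp [run]
  | const z k ih =>
    have := ih mem.length (mem ++ [z])
    simp only [List.length_append, List.length_singleton] at this
    simp only [run]; omega
  | arith o i j k ih =>
    have := ih mem.length (mem ++ [o.apply (mem.getD i 0) (mem.getD j 0)])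
    simp only [List.length_append, List.length_singleton] at this
    simp only [run]; omega
  | test i k ih =>
    have := ih (decide (mem.getD i 0 = 0)) mem
    simp only [run]; omega

/-- A Hoare triple with cost: the run of `p` from `mem` ends with postcondition `Q` and, if `t`
holds, costs at most `c`. The flag `t` lets one derivation serve both for the correctness with
subroutines of unknown cost (`t = False`) and for the running time (`t = True`). -/
structure Achieves (t : Prop) (p : Prog K α) (mem : List K) (c : ℝ)
    (Q : α → List K → Prop) : Prop where
  post : Q (p.run mem).out (p.run mem).mem
  cost_le : t → ((p.run mem).cost : ℝ) ≤ c

variable {t : Prop} {mem : List K} {c c' : ℝ}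

theorem Achieves.mono {p : Prog K α} {Q Q' : α → List K → Prop} (h : Achieves t p mem c Q)
    (hc : c ≤ c') (hQ : ∀ a m, mem <+: m → Q a m → Q' a m) : Achieves t p mem c' Q' :=
  ⟨hQ _ _ (isPrefix_mem_run p mem) h.post, fun ht => (h.cost_le ht).trans hc⟩

theorem Achieves.mono_cost {p : Prog K α} {Q : α → List K → Prop} (h : Achieves t p mem c Q)
    (hc : c ≤ c') : Achieves t p mem c' Q :=
  h.mono hc fun _ _ _ h => h

theorem Achieves.bind {p : Prog K α} {f : α → Prog K β} {Q : α → List K → Prop}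
    {R : β → List K → Prop} (h : Achieves t p mem c Q)
    (hf : ∀ a m, mem <+: m → Q a m → Achieves t (f a) m c' R) :
    Achieves t (p >>= f) mem (c + c') R := by
  have hf' := hf _ _ (isPrefix_mem_run p mem) h.post
  refine ⟨by rw [run_bind]; exact hf'.post, fun ht => ?_⟩
  rw [run_bind]
  push_cast
  exact add_le_add (h.cost_le ht) (hf'.cost_le ht)

theorem achieves_pure {a : α} {Q : α → List K → Prop} (h : Q a mem) :
    Achieves t (pure a) mem 0 Q :=
  ⟨h, fun _ => by simp [pure, run]⟩

theorem achieves_lit (z : K) : Achieves t (lit z) mem 1 fun i m => HasVal m i z :=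
  ⟨hasVal_append_singleton _ _, fun _ => by simp [lit, run]⟩

theorem achieves_arith (o : ArithOp) {i j : ℕ} {x y : K} (hi : HasVal mem i x)
    (hj : HasVal mem j y) :
    Achieves t (arith o i j ret) mem 1 fun l m => HasVal m l (o.apply x y) := by
  refine ⟨?_, fun _ => by simp [run]⟩
  simpa only [run, hi.getD_eq, hj.getD_eq] using hasVal_append_singleton mem (o.apply x y)

theorem achieves_add {i j : ℕ} {x y : K} (hi : HasVal mem i x) (hj : HasVal mem j y) :
    Achieves t (add i j) mem 1 fun l m => HasVal m l (x + y) :=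
  achieves_arith .add hi hj

theorem achieves_mul {i j : ℕ} {x y : K} (hi : HasVal mem i x) (hj : HasVal mem j y) :
    Achieves t (mul i j) mem 1 fun l m => HasVal m l (x * y) :=
  achieves_arith .mul hi hj

theorem achieves_test {i : ℕ} {x : K} (hi : HasVal mem i x) :
    Achieves t (test i ret) mem 1 fun b _ => (b = true ↔ x = 0) := by
  refine ⟨?_, fun _ => by simp [run]⟩
  simp only [run, hi.getD_eq, decide_eq_true_eq]

theorem achieves_forFin {n : ℕ} {f : Fin n → Prog K β} {Q : Fin n → β → List K → Prop}
    (hQ : ∀ i b m m', m <+: m' → Q i b m → Q i b m')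
    (hf : ∀ i m, mem <+: m → Achieves t (f i) m c (Q i)) :
    Achieves t (forFin n f) mem (n * c) fun bs m => ∀ i, Q i (bs i) m := by
  induction n generalizing mem with
  | zero => exact (achieves_pure fun i => i.elim0).mono_cost (by simp)
  | succ n ih =>
    refine Achieves.mono_cost (c := c + (n * c + 0)) ?_ (by push_cast; linarith)
    refine (hf 0 mem List.prefix_rfl).bind fun b m hm hb => ?_
    refine (ih (fun i => hQ i.succ) fun i m' hm' => hf i.succ m' (hm.trans hm')).bind
      fun bs m' hm' hbs => ?_
    refine achieves_pure fun i => ?_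
    cases i using Fin.cases with
    | zero => exact hQ 0 b m m' hm' hb
    | succ i => exact hbs i

theorem achieves_forFin_hasVal {n : ℕ} {f : Fin n → Prog K ℕ} {v : Fin n → K}
    (hf : ∀ i m, mem <+: m → Achieves t (f i) m c fun l m' => HasVal m' l (v i)) :
    Achieves t (forFin n f) mem (n * c) fun bs m => ∀ i, HasVal m (bs i) (v i) :=
  achieves_forFin (Q := fun i b m => HasVal m b (v i)) (fun _ _ _ _ hm h => h.mono hm) hf

/-- The loop `forFin` over an arbitrary finite type, in the order of `Fintype.equivFin`. -/
noncomputable def forAll {ι : Type} [Fintype ι] (f : ι → Prog K β) : Prog K (ι → β) := do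
  let b ← forFin (Fintype.card ι) fun i => f ((Fintype.equivFin ι).symm i)
  pure fun i => b (Fintype.equivFin ι i)

theorem achieves_forAll {ι : Type} [Fintype ι] {f : ι → Prog K ℕ} {v : ι → K}
    (hf : ∀ i m, mem <+: m → Achieves t (f i) m c fun l m' => HasVal m' l (v i)) :
    Achieves t (forAll f) mem (Fintype.card ι * c) fun bs m => ∀ i, HasVal m (bs i) (v i) := by
  refine Achieves.mono_cost (c := Fintype.card ι * c + 0) ?_ (by simp)
  refine (achieves_forFin_hasVal (v := fun i => v ((Fintype.equivFin ι).symm i))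
    fun i m hm => hf _ m hm).bind fun b m _ hb => achieves_pure fun i => ?_
  simpa using hb (Fintype.equivFin ι i)

theorem achieves_dot {X : Type} (l : List X) {a b : X → ℕ} {x y : X → K}
    (ha : ∀ i ∈ l, HasVal mem (a i) (x i)) (hb : ∀ i ∈ l, HasVal mem (b i) (y i)) :
    Achieves t (dot (l.map fun i => (a i, b i))) mem (2 * l.length + 1) fun r m =>
      HasVal m r (l.map fun i => x i * y i).sum := by
  induction l with
  | nil => exact (achieves_lit 0).mono_cost (by simp)
  | cons i l ih =>
    simp only [List.mem_cons, forall_eq_or_imp] at ha hb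
    refine Achieves.mono_cost (c := (2 * l.length + 1) + (1 + 1)) ?_
      (by push_cast [List.length_cons]; linarith)
    refine (ih ha.2 hb.2).bind fun s m hm hs => ?_
    refine (achieves_mul (ha.1.mono hm) (hb.1.mono hm)).bind fun w m' hm' hw => ?_
    refine (achieves_add (hs.mono hm') hw).mono le_rfl fun r m'' _ hr => ?_
    simpa [add_comm] using hr

theorem achieves_horner {x : ℕ} {z : K} (hx : HasVal mem x z) {l : List ℕ} {v : List K}
    (h : List.Forall₂ (HasVal mem) l v) :
    Achieves t (horner x l) mem (2 * l.length + 1) fun r m =>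
      HasVal m r (v.foldr (fun a s => s * z + a) 0) := by
  induction h with
  | nil => exact (achieves_lit 0).mono_cost (by simp)
  | @cons a y l v ha _ ih =>
    refine Achieves.mono_cost (c := (2 * l.length + 1) + (1 + 1)) ?_
      (by push_cast [List.length_cons]; linarith)
    refine ih.bind fun s m hm hs => ?_
    refine (achieves_mul hs (hx.mono hm)).bind fun w m' hm' hw => ?_
    exact achieves_add hw ((ha.mono hm).mono hm')

theorem achieves_horner_ofFn {x : ℕ} {z : K} (hx : HasVal mem x z) {n : ℕ} {h : Fin n → ℕ}
    {a : Fin n → K} (ha : ∀ j, HasVal mem (h j) (a j)) :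
    Achieves t (horner x (List.ofFn h)) mem (2 * n + 1) fun r m =>
      HasVal m r (∑ j, a j * z ^ j.val) := by
  have hcoeffs : List.Forall₂ (HasVal mem) (List.ofFn h) (List.ofFn a) :=
    List.forall₂_iff_get.2 ⟨by simp, fun i _ _ => by simpa using ha _⟩
  refine (achieves_horner hx hcoeffs).mono (by simp) fun r m _ hr => ?_
  rwa [foldr_horner_ofFn] at hr

theorem achieves_powers {x : ℕ} {z : K} (hx : HasVal mem x z) (n : ℕ) :
    Achieves t (powers x n) mem (n + 1) fun l m => HoldsUpTo m l (z ^ ·) n := by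
  induction n with
  | zero =>
    refine Achieves.mono_cost (c := 1 + 0) ?_ (by simp)
    exact (achieves_lit 1).bind fun o m _ ho =>
      achieves_pure (.singleton (by simpa using ho))
  | succ n ih =>
    refine Achieves.mono_cost (c := (n + 1) + (1 + 0)) ?_ (by push_cast; linarith)
    refine ih.bind fun l m hm hl => ?_
    refine (achieves_mul (hl.hasVal n le_rfl) (hx.mono hm)).bind fun y m' hm' hy => ?_
    exact achieves_pure (hl.append hm' (by simpa [pow_succ] using hy))

end Prog

namespace Prog

variable {K ι : Type} [Finite ι]

theorem exists_holds (v : ι → K) :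
    ∃ (mem : List K) (h : ι → ℕ), Holds mem h v ∧ ∀ x ∈ mem, x ∈ Set.range v := by
  have := Fintype.ofFinite ι
  refine ⟨List.ofFn (v ∘ (Fintype.equivFin ι).symm), fun i => Fintype.equivFin ι i,
    fun i => by simp, fun x hx => ?_⟩
  obtain ⟨i, rfl⟩ := List.mem_ofFn.1 hx
  exact ⟨_, rfl⟩

variable [Field K] [DecidableEq K]

theorem card_le_cost_of_notMem {α : Type} {p : Prog K α} {mem : List K} {h : ι → ℕ} {v : ι → K}
    (hh : Holds (p.run mem).mem h v) (hv : v.Injective) (hnew : ∀ i, v i ∉ mem) :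
    Nat.card ι ≤ (p.run mem).cost := by
  have := Fintype.ofFinite ι
  obtain ⟨l, hl⟩ := isPrefix_mem_run p mem
  have hmem : ∀ i, v i ∈ l := fun i => by
    have : v i ∈ mem ++ l := hl ▸ List.mem_of_getElem? (hh i)
    exact (List.mem_append.1 this).resolve_left (hnew i)
  have hlen : l.length ≤ (p.run mem).cost := by
    have := length_mem_run_le p mem
    rw [← hl, List.length_append] at this
    omega
  calc Nat.card ι = (Finset.univ.image v).card := by
        rw [Finset.card_image_of_injective _ hv, Finset.card_univ, Nat.card_eq_fintype_card]
    _ ≤ l.toFinset.card :=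
        Finset.card_le_card fun x hx => by
          obtain ⟨i, -, rfl⟩ := Finset.mem_image.1 hx
          exact List.mem_toFinset.2 (hmem i)
    _ ≤ _ := (List.toFinset_card_le l).trans hlen

end Prog

/-! ### Matrix programs -/

/-- The registers `h i j` hold the entries of the matrix `A`. -/
def RegMat {K ι κ : Type} (mem : List K) (h : ι → κ → ℕ) (A : Matrix ι κ K) : Prop :=
  ∀ i j, Prog.HasVal mem (h i j) (A i j)

theorem RegMat.mono {K ι κ : Type} {mem mem' : List K} {h : ι → κ → ℕ} {A : Matrix ι κ K}
    (hA : RegMat mem h A) (hm : mem <+: mem') : RegMat mem' h A :=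
  fun i j => (hA i j).mono hm

theorem RegMat.transpose {K ι κ : Type} {mem : List K} {h : ι → κ → ℕ} {A : Matrix ι κ K}
    (hA : RegMat mem h A) : RegMat mem (fun j i => h i j) A.transpose := fun i j => hA j i

-- Take `A = N • 1` and `B` with distinct entries in `[2, N)`: then the entries of `A * B` are
-- distinct and larger than all entries of `A` and `B`, hence are not in the initial registers.
theorem exists_sq_le_cost_of_regMat_mul (K : Type) [Field K] [CharZero K] [DecidableEq K]
    (n : ℕ) :
    ∃ (A B : Matrix (Fin n) (Fin n) K) (hA hB : Fin n → Fin n → ℕ) (mem : List K),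
      RegMat mem hA A ∧ RegMat mem hB B ∧
      ∀ (α : Type) (p : Prog K α) (h : Fin n → Fin n → ℕ),
        RegMat (p.run mem).mem h (A * B) → n ^ 2 ≤ (p.run mem).cost := by
  let N := n * n + 2
  let b : Fin n × Fin n → ℕ := fun x => 2 + (finProdFinEquiv x).val
  have hb : ∀ x, 2 ≤ b x ∧ b x < N := fun x => by
    have := (finProdFinEquiv x).isLt
    exact ⟨by simp only [b]; omega, by simp only [b, N]; omega⟩
  have hb_inj : b.Injective := fun x y hxy =>
    finProdFinEquiv.injective (Fin.ext (Nat.add_left_cancel hxy))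
  let A : Matrix (Fin n) (Fin n) K := Matrix.diagonal fun _ => (N : K)
  let B : Matrix (Fin n) (Fin n) K := Matrix.of fun i j => (b (i, j) : K)
  have hAB : ∀ x : Fin n × Fin n, (A * B) x.1 x.2 = ((N * b x : ℕ) : K) := fun x => by
    simp [A, B, Matrix.diagonal_mul]
  obtain ⟨mem, h, hh, hmem⟩ := Prog.exists_holds
    (Sum.elim (fun x : Fin n × Fin n => A x.1 x.2) fun x : Fin n × Fin n => B x.1 x.2)
  have hsmall : ∀ y ∈ mem, ∃ k : ℕ, k ≤ N ∧ y = k := fun y hy => by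
    obtain ⟨x | x, rfl⟩ := hmem y hy
    · by_cases hx : x.1 = x.2
      · exact ⟨N, le_rfl, by simp [A, hx]⟩
      · exact ⟨0, N.zero_le, by simp [A, hx]⟩
    · exact ⟨b x, (hb x).2.le, rfl⟩
  refine ⟨A, B, fun i j => h (.inl (i, j)), fun i j => h (.inr (i, j)), mem,
    fun i j => hh (.inl (i, j)), fun i j => hh (.inr (i, j)), fun α p h' hp => ?_⟩
  have hcard := Prog.card_le_cost_of_notMem (h := fun x : Fin n × Fin n => h' x.1 x.2)
    (v := fun x : Fin n × Fin n => (A * B) x.1 x.2) (fun x => hp x.1 x.2)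
    (fun x y hxy => hb_inj <| by
      simp only [hAB, Nat.cast_inj] at hxy
      exact Nat.eq_of_mul_eq_mul_left (by omega) hxy)
    (fun x hx => by
      obtain ⟨k, hk, hkx⟩ := hsmall _ hx
      rw [hAB, Nat.cast_inj] at hkx
      nlinarith [(hb x).1, (hb x).2])
  simpa [sq] using hcard

/-- A matrix multiplication program whose cost is at most `C n ^ ω`; the bounds on `C` and `ω` are
no restriction, see `IsMatMulExponent.nonempty_fastMul`. -/
structure FastMul (K : Type) [Field K] [DecidableEq K] (ω : ℝ) where
  mm : (n : ℕ) → (Fin n → Fin n → ℕ) → (Fin n → Fin n → ℕ) → Prog K (Fin n → Fin n → ℕ)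
  C : ℝ
  one_le : 1 ≤ C
  two_le : 2 ≤ ω
  achieves_mm : ∀ n : ℕ, 1 ≤ n → ∀ (A B : Matrix (Fin n) (Fin n) K) (hA hB : Fin n → Fin n → ℕ)
    (mem : List K), RegMat mem hA A → RegMat mem hB B →
    (mm n hA hB).Achieves True mem (C * (n : ℝ) ^ ω) fun h m => RegMat m h (A * B)

namespace IsMatMulExponent

variable {ω : ℝ}

theorem two_le (h : IsMatMulExponent ω) : 2 ≤ ω := by
  obtain ⟨mm, C, h⟩ := h
  by_contra! hω
  have hle : ∀ n : ℕ, 1 ≤ n → (n : ℝ) ^ (2 - ω) ≤ C := fun n hn => by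
    obtain ⟨A, B, hA, hB, mem, hAm, hBm, hcost⟩ := exists_sq_le_cost_of_regMat_mul ℂ n
    obtain ⟨hprod, hle⟩ := h n hn A B hA hB mem hAm hBm
    have hn0 : (0 : ℝ) < n := by exact_mod_cast hn
    rw [Real.rpow_sub hn0, div_le_iff₀ (Real.rpow_pos_of_pos hn0 _), Real.rpow_two]
    exact le_trans (by exact_mod_cast hcost _ _ _ hprod) hle
  have hlim : Filter.Tendsto (fun n : ℕ => (n : ℝ) ^ (2 - ω)) .atTop .atTop :=
    (tendsto_rpow_atTop (by linarith)).comp tendsto_natCast_atTop_atTop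
  obtain ⟨n, hgt, hn⟩ := ((hlim.eventually_gt_atTop C).and (Filter.eventually_ge_atTop 1)).exists
  exact (hle n hn).not_gt hgt

theorem nonempty_fastMul (h : IsMatMulExponent ω) : Nonempty (FastMul ℂ ω) := by
  have hω := h.two_le
  obtain ⟨mm, C, h⟩ := h
  refine ⟨⟨mm, max C 1, le_max_right _ _, hω, fun n hn A B hA hB mem hAm hBm => ?_⟩⟩
  obtain ⟨hprod, hcost⟩ := h n hn A B hA hB mem hAm hBm
  refine ⟨hprod, fun _ => hcost.trans ?_⟩
  gcongr
  exact le_max_left _ _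

end IsMatMulExponent

/-- The matrix `A` (of registers or of entries) placed at the rows `e` and the columns `f` of a
larger one that is filled up with `z`. -/
noncomputable def padMat {ι κ ι' κ' X : Type*} (e : ι → ι') (f : κ → κ') (z : X)
    (A : Matrix ι κ X) : Matrix ι' κ' X :=
  Matrix.of <| Function.extend e (fun i => Function.extend f (A i) fun _ => z) fun _ _ => z

section padMat

variable {ι κ ι' κ' X : Type*} {e : ι → ι'} {f : κ → κ'} {z : X} {A : Matrix ι κ X}

theorem padMat_apply (he : e.Injective) (hf : f.Injective) (i : ι) (j : κ) :
    padMat e f z A (e i) (f j) = A i j := by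
  rw [padMat, Matrix.of_apply, he.extend_apply, hf.extend_apply]

theorem padMat_of_notMem_left {i : ι'} (hi : i ∉ Set.range e) (j : κ') :
    padMat e f z A i j = z := by
  rw [padMat, Matrix.of_apply, Function.extend_apply' _ _ _ (by simpa using hi)]

theorem padMat_of_notMem_right (he : e.Injective) (i : ι') {j : κ'} (hj : j ∉ Set.range f) :
    padMat e f z A i j = z := by
  by_cases hi : i ∈ Set.range e
  · obtain ⟨i, rfl⟩ := hi
    rw [padMat, Matrix.of_apply, he.extend_apply,
      Function.extend_apply' _ _ _ (by simpa using hj)]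
  · exact padMat_of_notMem_left hi j

theorem padMat_mul_padMat {R l l' : Type*} [NonUnitalNonAssocSemiring R] {g : l → l'}
    [Fintype κ] [Fintype κ'] (he : e.Injective) (hf : f.Injective) (hg : g.Injective)
    (A : Matrix ι κ R) (B : Matrix κ l R) :
    padMat e f 0 A * padMat f g 0 B = padMat e g 0 (A * B) := by
  ext i j
  rw [Matrix.mul_apply]
  by_cases hi : i ∈ Set.range e
  · by_cases hj : j ∈ Set.range g
    · obtain ⟨i, rfl⟩ := hi
      obtain ⟨j, rfl⟩ := hj
      rw [padMat_apply he hg, Matrix.mul_apply]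
      refine (Fintype.sum_of_injective f hf _ _ (fun k hk => ?_) fun k => ?_).symm
      · rw [padMat_of_notMem_left hk, mul_zero]
      · rw [padMat_apply he hf, padMat_apply hf hg]
    · rw [padMat_of_notMem_right he _ hj]
      exact Finset.sum_eq_zero fun k _ => by rw [padMat_of_notMem_right hf _ hj, mul_zero]
  · rw [padMat_of_notMem_left hi]
    exact Finset.sum_eq_zero fun k _ => by rw [padMat_of_notMem_left hi, zero_mul]

variable {R l l' : Type*} [NonUnitalNonAssocSemiring R]

theorem submatrix_padMat (he : e.Injective) (hf : f.Injective) (A : Matrix ι κ X) :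
    (padMat e f z A).submatrix e f = A :=
  Matrix.ext fun _ _ => padMat_apply he hf _ _

theorem mul_submatrix_eq_submatrix_padMat_mul [Fintype κ] [Fintype κ'] (he : e.Injective)
    (hf : f.Injective) (A : Matrix ι κ R) (B : Matrix κ' l' R) (g : l → l') :
    A * B.submatrix f g = (padMat e f 0 A * B).submatrix e g := by
  ext i j
  rw [Matrix.submatrix_apply, Matrix.mul_apply, Matrix.mul_apply]
  refine Fintype.sum_of_injective f hf _ _ (fun k hk => ?_) fun k => ?_
  · rw [padMat_of_notMem_right he _ hk, zero_mul]
  · rw [padMat_apply he hf, Matrix.submatrix_apply]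

theorem submatrix_mul_eq_submatrix_mul_padMat [Fintype ι] [Fintype ι'] (he : e.Injective)
    (hf : f.Injective) (A : Matrix ι κ R) (B : Matrix l' ι' R) (g : l → l') :
    B.submatrix g e * A = (B * padMat e f 0 A).submatrix g f := by
  ext i j
  rw [Matrix.submatrix_apply, Matrix.mul_apply, Matrix.mul_apply]
  refine Fintype.sum_of_injective e he _ _ (fun k hk => ?_) fun k => ?_
  · rw [padMat_of_notMem_left hk, mul_zero]
  · rw [padMat_apply he hf, Matrix.submatrix_apply]

end padMat

theorem RegMat.pad {K ι κ ι' κ' : Type} {e : ι → ι'} {f : κ → κ'} (he : e.Injective)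
    (hf : f.Injective) {mem : List K} {h : ι → κ → ℕ} {A : Matrix ι κ K} (hA : RegMat mem h A)
    {z : ℕ} {x : K} (hz : Prog.HasVal mem z x) :
    RegMat mem (padMat e f z (Matrix.of h)) (padMat e f x A) := by
  intro i j
  by_cases hi : i ∈ Set.range e
  · by_cases hj : j ∈ Set.range f
    · obtain ⟨i, rfl⟩ := hi
      obtain ⟨j, rfl⟩ := hj
      rw [padMat_apply he hf, padMat_apply he hf]
      exact hA i j
    · rwa [padMat_of_notMem_right he _ hj, padMat_of_notMem_right he _ hj]
  · rwa [padMat_of_notMem_left hi, padMat_of_notMem_left hi]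

/-- An enumeration of a type with at most `s` elements by the first elements of `Fin s`. -/
noncomputable def enumFin (ι : Type*) [Fintype ι] {s : ℕ} (h : Fintype.card ι ≤ s) : ι → Fin s :=
  fun i => Fin.castLE h (Fintype.equivFin ι i)

theorem enumFin_injective (ι : Type*) [Fintype ι] {s : ℕ} (h : Fintype.card ι ≤ s) :
    (enumFin ι h).Injective :=
  (Fin.castLE_injective h).comp (Fintype.equivFin ι).injective

open Prog

/-- Entrywise subtraction of matrices of registers. -/
noncomputable def Prog.msub {K ι κ : Type} [Fintype ι] [Fintype κ] (h h' : ι → κ → ℕ) :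
    Prog K (ι → κ → ℕ) := do
  let r ← forAll fun x : ι × κ => arith .sub (h x.1 x.2) (h' x.1 x.2) ret
  pure fun i j => r (i, j)

namespace FastMul

variable {K : Type} [Field K] [DecidableEq K] {ω : ℝ} (F : FastMul K ω)

/-- A bound for the cost of an operation on matrices with at most `s` rows and columns; the
summand `1` in the constant pays for operations of cost `s ^ 2` and for loading constants. -/
noncomputable def cost (s : ℕ) : ℝ := (F.C + 1) * (s : ℝ) ^ ω

theorem C_add_one_nonneg : 0 ≤ F.C + 1 := by linarith [F.one_le]

theorem cost_mono {s s' : ℕ} (h : s ≤ s') : F.cost s ≤ F.cost s' := by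
  have := F.C_add_one_nonneg
  have := F.two_le
  unfold cost
  gcongr

theorem sq_le_cost (s : ℕ) : (s : ℝ) ^ 2 ≤ F.cost s := by
  have hω := F.two_le
  rcases Nat.eq_zero_or_pos s with rfl | hs
  · simp [cost, Real.zero_rpow (by linarith : ω ≠ 0)]
  · have hpow : (s : ℝ) ^ 2 ≤ (s : ℝ) ^ ω := by
      rw [← Real.rpow_two]
      exact Real.rpow_le_rpow_of_exponent_le (by exact_mod_cast hs) hω
    exact hpow.trans (le_mul_of_one_le_left (by positivity) (by linarith [F.one_le]))

theorem cost_nonneg (s : ℕ) : 0 ≤ F.cost s := (sq_nonneg _).trans (F.sq_le_cost s)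

theorem one_le_cost {s : ℕ} (hs : 1 ≤ s) : 1 ≤ F.cost s :=
  (one_le_pow₀ (by exact_mod_cast hs)).trans (F.sq_le_cost s)

theorem cost_add_le (s s' : ℕ) : F.cost s + F.cost s' ≤ F.cost (s + s') := by
  have hω := F.two_le
  have hadd : (s : ℝ) ^ ω + (s' : ℝ) ^ ω ≤ ((s + s' : ℕ) : ℝ) ^ ω := by
    exact_mod_cast NNReal.add_rpow_le_rpow_add (s : NNReal) (s' : NNReal) (by linarith)
  unfold cost
  rw [← mul_add]
  exact mul_le_mul_of_nonneg_left hadd F.C_add_one_nonneg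

theorem four_mul_cost_le (s : ℕ) : 4 * F.cost s ≤ F.cost (2 * s) := by
  have htwo : (4 : ℝ) ≤ 2 ^ ω :=
    calc (4 : ℝ) = 2 ^ (2 : ℝ) := by norm_num
      _ ≤ 2 ^ ω := Real.rpow_le_rpow_of_exponent_le (by norm_num) F.two_le
  calc 4 * F.cost s ≤ 2 ^ ω * F.cost s := mul_le_mul_of_nonneg_right htwo (F.cost_nonneg s)
    _ = F.cost (2 * s) := by
      unfold cost
      push_cast
      rw [Real.mul_rpow (by norm_num) (by positivity)]
      ring

variable {ι κ l : Type} [Fintype ι] [Fintype κ] [Fintype l]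

/-- The size of the square matrices to which the factors of a rectangular product are padded. -/
def padSize (ι κ l : Type) [Fintype ι] [Fintype κ] [Fintype l] : ℕ :=
  max 1 (max (Fintype.card ι) (max (Fintype.card κ) (Fintype.card l)))

theorem card_le_padSize_left : Fintype.card ι ≤ padSize ι κ l := by simp [padSize]

theorem card_le_padSize_mid : Fintype.card κ ≤ padSize ι κ l := by simp [padSize]

theorem card_le_padSize_right : Fintype.card l ≤ padSize ι κ l := by simp [padSize]

/-- Multiplication of rectangular matrices, by padding them with zeros to square ones. -/
noncomputable def mmul (h : ι → κ → ℕ) (h' : κ → l → ℕ) : Prog K (ι → l → ℕ) := do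
  let z ← lit 0
  let r ← F.mm (padSize ι κ l)
    (padMat (enumFin ι card_le_padSize_left) (enumFin κ card_le_padSize_mid) z
      (Matrix.of h))
    (padMat (enumFin κ card_le_padSize_mid) (enumFin l card_le_padSize_right) z
      (Matrix.of h'))
  pure fun i j => r (enumFin ι card_le_padSize_left i) (enumFin l card_le_padSize_right j)

variable {mem : List K} {s : ℕ}

theorem achieves_mmul {h : ι → κ → ℕ} {h' : κ → l → ℕ} {A : Matrix ι κ K} {B : Matrix κ l K}
    (hA : RegMat mem h A) (hB : RegMat mem h' B) (hs : 1 ≤ s) (hι : Fintype.card ι ≤ s)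
    (hκ : Fintype.card κ ≤ s) (hl : Fintype.card l ≤ s) :
    Achieves True (F.mmul h h') mem (F.cost s) fun o m => RegMat m o (A * B) := by
  have hsize : padSize ι κ l ≤ s := by simp [padSize, hs, hι, hκ, hl]
  have hC := F.one_le
  have hω := F.two_le
  let e : ι → Fin (padSize ι κ l) := enumFin ι card_le_padSize_left
  let f : κ → Fin (padSize ι κ l) := enumFin κ card_le_padSize_mid
  let g : l → Fin (padSize ι κ l) := enumFin l card_le_padSize_right
  have he : e.Injective := enumFin_injective _ _
  have hf : f.Injective := enumFin_injective _ _
  have hg : g.Injective := enumFin_injective _ _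
  have hcost : 1 + (F.C * (padSize ι κ l : ℝ) ^ ω + 0) ≤ F.cost s := by
    have hpow : (padSize ι κ l : ℝ) ^ ω ≤ (s : ℝ) ^ ω := by gcongr
    have hpow_one : (1 : ℝ) ≤ (s : ℝ) ^ ω := Real.one_le_rpow (by exact_mod_cast hs) (by linarith)
    unfold cost
    nlinarith
  refine Achieves.mono_cost ?_ hcost
  refine (achieves_lit 0).bind fun z m hm hz => ?_
  refine (F.achieves_mm _ (by simp [padSize]) (padMat e f 0 A) (padMat f g 0 B) _ _ m
    ((hA.mono hm).pad he hf hz) ((hB.mono hm).pad hf hg hz)).bind fun o m' _ ho =>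
      achieves_pure fun i j => ?_
  rw [padMat_mul_padMat he hf hg] at ho
  simpa only [padMat_apply he hg] using ho (e i) (g j)

theorem achieves_msub {h h' : ι → κ → ℕ} {A B : Matrix ι κ K}
    (hA : RegMat mem h A) (hB : RegMat mem h' B) (hι : Fintype.card ι ≤ s)
    (hκ : Fintype.card κ ≤ s) :
    Achieves True (msub h h') mem (F.cost s) fun o m => RegMat m o (A - B) := by
  have hcost : (Fintype.card (ι × κ) : ℝ) * 1 + 0 ≤ F.cost s :=
    calc (Fintype.card (ι × κ) : ℝ) * 1 + 0 = Fintype.card ι * Fintype.card κ := by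
          simp [Fintype.card_prod]
      _ ≤ s ^ 2 := by rw [sq]; gcongr
      _ ≤ F.cost s := F.sq_le_cost s
  refine Achieves.mono_cost ?_ hcost
  refine (achieves_forAll (v := fun x : ι × κ => A x.1 x.2 - B x.1 x.2) fun x m hm =>
    achieves_arith .sub ((hA x.1 x.2).mono hm) ((hB x.1 x.2).mono hm)).bind fun r m _ hr =>
      achieves_pure fun i j => hr (i, j)

end FastMul

/-! ### Pivot inverses -/

section mulApply

variable {R ι κ l : Type*} [Fintype κ] [NonAssocSemiring R]

theorem mul_apply_of_row_eq_zero {A : Matrix ι κ R} {i : ι} (h : ∀ j, A i j = 0)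
    (B : Matrix κ l R) (j : l) : (A * B) i j = 0 := by
  simp [Matrix.mul_apply, h]

theorem mul_apply_of_col_eq_zero {A : Matrix κ l R} {j : l} (h : ∀ i, A i j = 0)
    (B : Matrix ι κ R) (i : ι) : (B * A) i j = 0 := by
  simp [Matrix.mul_apply, h]

variable [DecidableEq κ]

theorem mul_apply_of_row_eq_one {A : Matrix κ κ R} {i : κ}
    (h : ∀ j, A i j = (1 : Matrix κ κ R) i j) (B : Matrix κ l R) (j : l) :
    (A * B) i j = B i j := by
  simp [Matrix.mul_apply, h, Matrix.one_apply]

theorem mul_apply_of_col_eq_one {A : Matrix κ κ R} {j : κ}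
    (h : ∀ i, A i j = (1 : Matrix κ κ R) i j) (B : Matrix ι κ R) (i : ι) :
    (B * A) i j = B i j := by
  simp [Matrix.mul_apply, h, Matrix.one_apply]

end mulApply

/-- `G` is a generalized inverse of `M` obtained from an invertible minor of full rank: the
pivots are the rows `row` and the columns `col`, and `G` is the inverse of the minor of `M` on
`row × col`, extended by zeros. -/
structure IsPivotInverse {R ι κ : Type*} [CommRing R] [Fintype ι] [Fintype κ] [DecidableEq ι]
    [DecidableEq κ] (M : Matrix ι κ R) (G : Matrix κ ι R) (row : ι → Bool) (col : κ → Bool) :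
    Prop where
  mul_mul : M * (G * M) = M
  row_eq : ∀ i, row i = true → ∀ j, (M * G) i j = (1 : Matrix ι ι R) i j
  col_eq : ∀ j, col j = true → ∀ i, (G * M) i j = (1 : Matrix κ κ R) i j
  row_zero : ∀ i, row i = false → ∀ j, G j i = 0
  col_zero : ∀ j, col j = false → ∀ i, G j i = 0

namespace IsPivotInverse

variable {R ι κ κ' : Type*} [CommRing R] [Fintype ι] [Fintype κ]

section fromCols

open Matrix

variable {M₁ : Matrix ι κ R} {M₂ : Matrix ι κ' R} {G : Matrix κ ι R} {H H' : Matrix κ' ι R}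

theorem fromCols_mul_fromRows_eq [Fintype κ'] :
    fromCols M₁ M₂ * fromRows (G - G * M₂ * H') H' = M₁ * G + (M₂ - M₁ * (G * M₂)) * H' := by
  rw [fromCols_mul_fromRows, Matrix.mul_sub, Matrix.sub_mul]
  simp only [Matrix.mul_assoc]
  abel

theorem elim_mul_left (hG : M₁ * (G * M₁) = M₁) : (H - H * M₁ * G) * M₁ = 0 := by
  rw [Matrix.sub_mul, Matrix.mul_assoc, Matrix.mul_assoc, hG, sub_self]

theorem elim_mul_right : (H - H * M₁ * G) * M₂ = H * (M₂ - M₁ * (G * M₂)) := by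
  rw [Matrix.sub_mul, Matrix.mul_sub]
  simp only [Matrix.mul_assoc]

theorem fromRows_mul_fromCols_eq [Fintype κ'] (hG : M₁ * (G * M₁) = M₁) (hH : H' = H - H * M₁ * G) :
    fromRows (G - G * M₂ * H') H' * fromCols M₁ M₂ =
      fromBlocks (G * M₁) (G * M₂ - G * M₂ * (H * (M₂ - M₁ * (G * M₂)))) 0
        (H * (M₂ - M₁ * (G * M₂))) := by
  rw [fromRows_mul_fromCols, Matrix.sub_mul, Matrix.sub_mul, Matrix.mul_assoc _ H',
    Matrix.mul_assoc _ H', hH, elim_mul_left hG, elim_mul_right, Matrix.mul_zero, sub_zero]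

end fromCols

variable [DecidableEq ι] [DecidableEq κ]

theorem transpose {M : Matrix ι κ R} {G : Matrix κ ι R} {row : ι → Bool} {col : κ → Bool}
    (h : IsPivotInverse M G row col) : IsPivotInverse M.transpose G.transpose col row where
  mul_mul := by
    rw [← Matrix.transpose_mul, ← Matrix.transpose_mul, Matrix.mul_assoc, h.mul_mul]
  row_eq i hi j := by
    rw [← Matrix.transpose_mul, Matrix.transpose_apply, h.col_eq i hi]
    simp only [Matrix.one_apply, eq_comm]
  col_eq i hi j := by
    rw [← Matrix.transpose_mul, Matrix.transpose_apply, h.row_eq i hi]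
    simp only [Matrix.one_apply, eq_comm]
  row_zero := h.col_zero
  col_zero := h.row_zero

-- Block elimination: the rows `r₁` of `M₂ - M₁ G M₂` vanish, so that its pivots complement `r₁`.
theorem fromCols_row_eq [Fintype κ'] [DecidableEq κ'] {M₁ : Matrix ι κ R} {M₂ : Matrix ι κ' R}
    {G : Matrix κ ι R} {H : Matrix κ' ι R} {r₁ r₂ : ι → Bool} {c₁ : κ → Bool} {c₂ : κ' → Bool}
    (h₁ : IsPivotInverse M₁ G r₁ c₁) (h₂ : IsPivotInverse (M₂ - M₁ * (G * M₂)) H r₂ c₂) {i : ι}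
    (hi : (r₁ i || r₂ i) = true) (j : ι) :
    (Matrix.fromCols M₁ M₂ * Matrix.fromRows (G - G * M₂ * (H - H * M₁ * G)) (H - H * M₁ * G)) i j =
      (1 : Matrix ι ι R) i j := by
  rw [fromCols_mul_fromRows_eq, Matrix.add_apply]
  by_cases hi₁ : r₁ i = true
  · have hQi : ∀ x, (M₂ - M₁ * (G * M₂)) i x = 0 := fun x => by
      rw [Matrix.sub_apply, ← Matrix.mul_assoc, mul_apply_of_row_eq_one (h₁.row_eq i hi₁), sub_self]
    rw [h₁.row_eq i hi₁, mul_apply_of_row_eq_zero hQi, add_zero]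
  · have hi₂ : r₂ i = true := by simpa [hi₁] using hi
    rw [Matrix.mul_sub, Matrix.mul_assoc H, ← Matrix.mul_assoc _ H, Matrix.sub_apply,
      mul_apply_of_row_eq_one (h₂.row_eq i hi₂), h₂.row_eq i hi₂, add_sub_cancel]

theorem fromCols [Fintype κ'] [DecidableEq κ'] {M₁ : Matrix ι κ R} {M₂ : Matrix ι κ' R}
    {G : Matrix κ ι R} {H : Matrix κ' ι R} {r₁ r₂ : ι → Bool} {c₁ : κ → Bool} {c₂ : κ' → Bool}
    (h₁ : IsPivotInverse M₁ G r₁ c₁) (h₂ : IsPivotInverse (M₂ - M₁ * (G * M₂)) H r₂ c₂) :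
    IsPivotInverse (Matrix.fromCols M₁ M₂)
      (Matrix.fromRows (G - G * M₂ * (H - H * M₁ * G)) (H - H * M₁ * G))
      (fun i => r₁ i || r₂ i) (Sum.elim c₁ c₂) := by
  set Q := M₂ - M₁ * (G * M₂) with hQ
  set H' := H - H * M₁ * G with hH'
  refine ⟨?_, fun i hi j => ?_, fun j hj i => ?_, fun i hi j => ?_, fun j hj i => ?_⟩
  · have hQ₁ : Q * H' * M₁ = 0 := by
      rw [Matrix.mul_assoc, elim_mul_left h₁.mul_mul, Matrix.mul_zero]
    have hQ₂ : Q * H' * M₂ = Q := by rw [Matrix.mul_assoc, elim_mul_right, h₂.mul_mul]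
    rw [← Matrix.mul_assoc, fromCols_mul_fromRows_eq, Matrix.mul_fromCols, Matrix.add_mul,
      Matrix.add_mul, hQ₁, hQ₂, Matrix.mul_assoc, h₁.mul_mul, add_zero, Matrix.mul_assoc,
      add_sub_cancel]
  · exact h₁.fromCols_row_eq h₂ hi j
  · rw [fromRows_mul_fromCols_eq h₁.mul_mul hH']
    rcases j with j | j
    · have hGj := h₁.col_eq j hj
      rcases i with i | i <;> simp [hGj, Matrix.one_apply]
    · have hHj := h₂.col_eq j hj
      rcases i with i | i
      · simp [← hQ, mul_apply_of_col_eq_one hHj]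
      · simp [← hQ, hHj, Matrix.one_apply]
  · rw [Bool.or_eq_false_iff] at hi
    have hH'i : ∀ x, H' x i = 0 := fun x => by
      rw [hH', Matrix.sub_apply, h₂.row_zero i hi.2,
        mul_apply_of_col_eq_zero (h₁.row_zero i hi.1), sub_zero]
    rcases j with j | j
    · rw [Matrix.fromRows_apply_inl, Matrix.sub_apply, h₁.row_zero i hi.1,
        mul_apply_of_col_eq_zero hH'i, sub_zero]
    · rw [Matrix.fromRows_apply_inr, hH'i]
  · rcases j with j | j
    · have hGj := h₁.col_zero j hj
      rw [Matrix.fromRows_apply_inl, Matrix.sub_apply, hGj, Matrix.mul_assoc,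
        mul_apply_of_row_eq_zero hGj, sub_zero]
    · have hHj := h₂.col_zero j hj
      rw [Matrix.fromRows_apply_inr, hH', Matrix.sub_apply, hHj, Matrix.mul_assoc,
        mul_apply_of_row_eq_zero hHj, sub_zero]

theorem of_padMat {ι' κ' : Type*} [Fintype ι'] [Fintype κ'] [DecidableEq ι'] [DecidableEq κ']
    {e : ι → ι'} {f : κ → κ'} (he : e.Injective) (hf : f.Injective) {M : Matrix ι κ R}
    {G : Matrix κ' ι' R} {row : ι' → Bool} {col : κ' → Bool}
    (h : IsPivotInverse (padMat e f 0 M) G row col) :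
    IsPivotInverse M (G.submatrix f e) (fun i => row (e i)) (fun j => col (f j)) where
  mul_mul := by
    rw [submatrix_mul_eq_submatrix_mul_padMat he hf,
      mul_submatrix_eq_submatrix_padMat_mul he hf, h.mul_mul, submatrix_padMat he hf]
  row_eq i hi j := by
    rw [mul_submatrix_eq_submatrix_padMat_mul he hf, Matrix.submatrix_apply, h.row_eq _ hi,
      ← Matrix.submatrix_apply (1 : Matrix ι' ι' R), Matrix.submatrix_one _ he]
  col_eq j hj i := by
    rw [submatrix_mul_eq_submatrix_mul_padMat he hf, Matrix.submatrix_apply, h.col_eq _ hj,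
      ← Matrix.submatrix_apply (1 : Matrix κ' κ' R), Matrix.submatrix_one _ hf]
  row_zero _ hi _ := h.row_zero _ hi _
  col_zero _ hj _ := h.col_zero _ hj _

end IsPivotInverse

/-! ### Pivot inversion -/

/-- The registers of a pivot inverse, together with the pivot rows and columns. -/
structure PivotRegs (ι κ : Type) where
  reg : κ → ι → ℕ
  row : ι → Bool
  col : κ → Bool

/-- The program `p` computes a pivot inverse of any matrix with at most `c` operations. -/
def IsPivotInverter {K ι κ : Type} [Field K] [DecidableEq K] [Fintype ι] [Fintype κ]
    [DecidableEq ι] [DecidableEq κ] (p : (ι → κ → ℕ) → Prog K (PivotRegs ι κ)) (c : ℝ) : Prop :=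
  ∀ (h : ι → κ → ℕ) (M : Matrix ι κ K) (mem : List K), RegMat mem h M →
    Achieves True (p h) mem c fun o m =>
      ∃ G : Matrix κ ι K, RegMat m o.reg G ∧ IsPivotInverse M G o.row o.col

/-- Pivot inversion of the transpose of a matrix. -/
def invTranspose {K ι κ : Type} (p : (κ → ι → ℕ) → Prog K (PivotRegs κ ι)) (h : ι → κ → ℕ) :
    Prog K (PivotRegs ι κ) := do
  let o ← p fun j i => h i j
  pure ⟨fun j i => o.reg i j, o.col, o.row⟩

/-- Pivot inversion of a matrix with two column blocks, as in `IsPivotInverse.fromCols`. -/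
noncomputable def FastMul.invCols {K ι κ κ' : Type} [Field K] [DecidableEq K] {ω : ℝ}
    (F : FastMul K ω) [Fintype ι] [Fintype κ] [Fintype κ']
    (p₁ : (ι → κ → ℕ) → Prog K (PivotRegs ι κ)) (p₂ : (ι → κ' → ℕ) → Prog K (PivotRegs ι κ'))
    (h : ι → κ ⊕ κ' → ℕ) : Prog K (PivotRegs ι (κ ⊕ κ')) := do
  let o₁ ← p₁ fun i j => h i (.inl j)
  let x ← F.mmul o₁.reg fun i j => h i (.inr j)
  let y ← F.mmul (fun i j => h i (.inl j)) x
  let q ← msub (fun i j => h i (.inr j)) y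
  let o₂ ← p₂ q
  let u ← F.mmul o₂.reg fun i j => h i (.inl j)
  let v ← F.mmul u o₁.reg
  let w ← msub o₂.reg v
  let a ← F.mmul x w
  let b ← msub o₁.reg a
  pure ⟨Sum.elim b w, fun i => o₁.row i || o₂.row i, Sum.elim o₁.col o₂.col⟩

namespace IsPivotInverter

variable {K ι κ κ' : Type} [Field K] [DecidableEq K] [Fintype ι] [Fintype κ] [Fintype κ']
  [DecidableEq ι] [DecidableEq κ] [DecidableEq κ'] {c c₁ c₂ : ℝ}

theorem mono {p : (ι → κ → ℕ) → Prog K (PivotRegs ι κ)} (hp : IsPivotInverter p c₁)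
    (hc : c₁ ≤ c₂) : IsPivotInverter p c₂ :=
  fun h M mem hM => (hp h M mem hM).mono_cost hc

theorem invTranspose {p : (κ → ι → ℕ) → Prog K (PivotRegs κ ι)} (hp : IsPivotInverter p c) :
    IsPivotInverter (invTranspose p) c := fun h M mem hM => by
  refine Achieves.mono_cost (c := c + 0) ?_ (by simp)
  refine (hp _ _ _ hM.transpose).bind fun o m _ ⟨G, hG, hinv⟩ => achieves_pure ?_
  exact ⟨G.transpose, hG.transpose, hinv.transpose⟩

theorem invCols {ω : ℝ} (F : FastMul K ω) {s : ℕ}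
    {p₁ : (ι → κ → ℕ) → Prog K (PivotRegs ι κ)} {p₂ : (ι → κ' → ℕ) → Prog K (PivotRegs ι κ')}
    (hp₁ : IsPivotInverter p₁ c₁) (hp₂ : IsPivotInverter p₂ c₂) (hs : 1 ≤ s)
    (hι : Fintype.card ι ≤ s) (hκ : Fintype.card κ ≤ s) (hκ' : Fintype.card κ' ≤ s) :
    IsPivotInverter (F.invCols p₁ p₂) (c₁ + c₂ + 8 * F.cost s) := fun h M mem hM => by
  have hM₁ : RegMat mem (fun i j => h i (.inl j)) M.toCols₁ := fun i j => hM i (.inl j)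
  have hM₂ : RegMat mem (fun i j => h i (.inr j)) M.toCols₂ := fun i j => hM i (.inr j)
  refine Achieves.mono_cost (c := c₁ + (F.cost s + (F.cost s + (F.cost s + (c₂ + (F.cost s +
    (F.cost s + (F.cost s + (F.cost s + (F.cost s + 0)))))))))) ?_ (by linarith)
  refine (hp₁ _ _ _ hM₁).bind fun o₁ m₁ hm₁ ⟨G, hG, hGinv⟩ => ?_
  replace hM₁ := hM₁.mono hm₁
  replace hM₂ := hM₂.mono hm₁
  refine (F.achieves_mmul hG hM₂ hs hκ hι hκ').bind fun x m₂ hm₂ hx => ?_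
  refine (F.achieves_mmul (hM₁.mono hm₂) hx hs hι hκ hκ').bind fun y m₃ hm₃ hy => ?_
  refine (F.achieves_msub (hM₂.mono (hm₂.trans hm₃)) hy hι hκ').bind fun q m₄ hm₄ hq => ?_
  refine (hp₂ _ _ _ hq).bind fun o₂ m₅ hm₅ ⟨H, hH, hHinv⟩ => ?_
  have hx₅ := hx.mono ((hm₃.trans hm₄).trans hm₅)
  have hm₁₅ := hm₂.trans ((hm₃.trans hm₄).trans hm₅)
  refine (F.achieves_mmul hH (hM₁.mono hm₁₅) hs hκ' hι hκ).bind fun u m₆ hm₆ hu => ?_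
  refine (F.achieves_mmul hu (hG.mono (hm₁₅.trans hm₆)) hs hκ' hκ hι).bind fun v m₇ hm₇ hv => ?_
  refine (F.achieves_msub (hH.mono (hm₆.trans hm₇)) hv hκ' hι).bind fun w m₈ hm₈ hw => ?_
  have hm₅₈ := (hm₆.trans hm₇).trans hm₈
  refine (F.achieves_mmul (hx₅.mono hm₅₈) hw hs hκ hκ' hι).bind fun a m₉ hm₉ ha => ?_
  refine (F.achieves_msub (hG.mono ((hm₁₅.trans hm₅₈).trans hm₉)) ha hκ hι).bind
    fun b m hm hb => achieves_pure ⟨_, ?_, M.fromCols_toCols ▸ hGinv.fromCols hHinv⟩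
  rintro (j | j) i
  · exact hb j i
  · exact hw.mono (hm₉.trans hm) j i

end IsPivotInverter

/-- A type with `2 ^ k` elements that is halved definitionally. -/
def BinIdx : ℕ → Type
  | 0 => Unit
  | k + 1 => BinIdx k ⊕ BinIdx k

namespace BinIdx

instance instFintype : (k : ℕ) → Fintype (BinIdx k)
  | 0 => inferInstanceAs (Fintype Unit)
  | k + 1 => by
    have := instFintype k
    exact inferInstanceAs (Fintype (BinIdx k ⊕ BinIdx k))

instance instDecidableEq : (k : ℕ) → DecidableEq (BinIdx k)
  | 0 => inferInstanceAs (DecidableEq Unit)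
  | k + 1 => by
    have := instDecidableEq k
    exact inferInstanceAs (DecidableEq (BinIdx k ⊕ BinIdx k))

instance : Unique (BinIdx 0) := inferInstanceAs (Unique Unit)

theorem card_eq (k : ℕ) : Fintype.card (BinIdx k) = 2 ^ k := by
  induction k with
  | zero => rfl
  | succ k ih =>
    have hsum : Fintype.card (BinIdx (k + 1)) = Fintype.card (BinIdx k ⊕ BinIdx k) := rfl
    rw [hsum, Fintype.card_sum, ih, pow_succ, mul_two]

/-- An embedding of a type with at most `2 ^ k` elements into `BinIdx k`. -/
noncomputable def embed (ι : Type) [Fintype ι] {k : ℕ} (h : Fintype.card ι ≤ 2 ^ k) :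
    ι ↪ BinIdx k :=
  (Function.Embedding.nonempty_of_card_le (h.trans_eq (card_eq k).symm)).some

end BinIdx

-- Division by zero makes the inverse zero if there is no pivot.
theorem isPivotInverse_of_unique {K ι : Type*} [Field K] [Unique ι] [Fintype ι] [DecidableEq ι]
    (M : Matrix ι ι K) {b : Bool} (hb : b = true ↔ M default default = 0) :
    IsPivotInverse M (Matrix.of fun _ _ => 1 / M default default) (fun _ => !b) fun _ => !b := by
  cases b <;> constructor <;> try ext i j
  all_goals simp_all [Matrix.mul_apply, Unique.forall_iff, Unique.eq_default]

namespace FastMul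

variable {K : Type} [Field K] [DecidableEq K] {ω : ℝ} (F : FastMul K ω)

/-- Pivot inversion of a `2 ^ k × 2 ^ k` matrix. -/
noncomputable def invBin : (k : ℕ) → (BinIdx k → BinIdx k → ℕ) →
    Prog K (PivotRegs (BinIdx k) (BinIdx k))
  | 0, h => do
      let b ← test (h () ()) ret
      let o ← lit 1
      let y ← arith .div o (h () ()) ret
      pure ⟨fun _ _ => y, fun _ => !b, fun _ => !b⟩
  | k + 1, h =>
      F.invCols (ι := BinIdx k ⊕ BinIdx k)
        (invTranspose (F.invCols (invTranspose (invBin k)) (invTranspose (invBin k))))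
        (invTranspose (F.invCols (invTranspose (invBin k)) (invTranspose (invBin k)))) h

theorem isPivotInverter_invBin (k : ℕ) :
    IsPivotInverter (F.invBin k) (24 * (k + 1) * F.cost (2 ^ k)) := by
  induction k with
  | zero =>
    intro h M mem hM
    refine Achieves.mono_cost (c := 1 + (1 + (1 + 0))) ?_ ?_
    · refine (achieves_test (hM () ())).bind fun b m₁ hm₁ hb => ?_
      refine (achieves_lit 1).bind fun o m₂ hm₂ ho => ?_
      refine (achieves_arith .div ho ((hM () ()).mono (hm₁.trans hm₂))).bind fun y m _ hy => ?_
      exact achieves_pure ⟨_, fun _ _ => hy, isPivotInverse_of_unique M hb⟩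
    · have := F.one_le_cost (s := 2 ^ 0) (by norm_num)
      norm_num at this ⊢
      linarith
  | succ k ih =>
    have hs : 1 ≤ 2 ^ (k + 1) := Nat.one_le_two_pow
    have hhalf : Fintype.card (BinIdx k) ≤ 2 ^ (k + 1) := by
      rw [BinIdx.card_eq, pow_succ]; omega
    have hfull : Fintype.card (BinIdx k ⊕ BinIdx k) ≤ 2 ^ (k + 1) := (BinIdx.card_eq (k + 1)).le
    have hrows := ih.invTranspose.invCols F ih.invTranspose hs hhalf hhalf hhalf
    refine (hrows.invTranspose.invCols (ι := BinIdx k ⊕ BinIdx k) F hrows.invTranspose hs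
      hfull hhalf hhalf).mono ?_
    have hquarter : 4 * F.cost (2 ^ k) ≤ F.cost (2 ^ (k + 1)) := by
      rw [pow_succ']
      exact F.four_mul_cost_le _
    have := mul_le_mul_of_nonneg_left hquarter (by positivity : (0 : ℝ) ≤ (k : ℝ) + 1)
    push_cast
    linarith

variable {ι κ : Type} [Fintype ι] [Fintype κ]

/-- The logarithm of the size to which a rectangular matrix is padded for its inversion. -/
def logSize (ι κ : Type) [Fintype ι] [Fintype κ] : ℕ :=
  Nat.clog 2 (max (Fintype.card ι) (Fintype.card κ))

theorem card_le_two_pow_logSize_left : Fintype.card ι ≤ 2 ^ logSize ι κ :=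
  (le_max_left _ _).trans (Nat.le_pow_clog (by norm_num) _)

theorem card_le_two_pow_logSize_right : Fintype.card κ ≤ 2 ^ logSize ι κ :=
  (le_max_right _ _).trans (Nat.le_pow_clog (by norm_num) _)

/-- Pivot inversion of a rectangular matrix, by padding it with zeros. -/
noncomputable def inv (h : ι → κ → ℕ) : Prog K (PivotRegs ι κ) := do
  let e : ι ↪ BinIdx (logSize ι κ) := BinIdx.embed ι card_le_two_pow_logSize_left
  let f : κ ↪ BinIdx (logSize ι κ) := BinIdx.embed κ card_le_two_pow_logSize_right
  let z ← lit 0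
  let o ← F.invBin (logSize ι κ) (padMat e f z (Matrix.of h))
  pure ⟨fun j i => o.reg (f j) (e i), fun i => o.row (e i), fun j => o.col (f j)⟩

theorem two_pow_clog_le {s : ℕ} (hs : 1 ≤ s) : 2 ^ Nat.clog 2 s ≤ 2 * s := by
  rcases hs.eq_or_lt' with rfl | hs
  · simp
  · have hlt := Nat.pow_pred_clog_lt_self (b := 2) (by norm_num) hs
    obtain ⟨k, hk⟩ := Nat.exists_eq_succ_of_ne_zero (Nat.clog_pos (b := 2) (by norm_num) hs).ne'
    rw [hk, Nat.pred_succ] at hlt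
    rw [hk, pow_succ]
    omega

theorem isPivotInverter_inv [DecidableEq ι] [DecidableEq κ] {s : ℕ} (hs : 1 ≤ s)
    (hι : Fintype.card ι ≤ s) (hκ : Fintype.card κ ≤ s) :
    IsPivotInverter (F.inv (ι := ι) (κ := κ)) (25 * (Nat.clog 2 s + 1) * F.cost (2 * s)) := by
  intro h M mem hM
  have hlog : logSize ι κ ≤ Nat.clog 2 s := Nat.clog_mono_right 2 (max_le hι hκ)
  have hcost : 24 * ((logSize ι κ : ℝ) + 1) * F.cost (2 ^ logSize ι κ) ≤
      24 * ((Nat.clog 2 s : ℝ) + 1) * F.cost (2 * s) := by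
    have hsize : 2 ^ logSize ι κ ≤ 2 * s :=
      (Nat.pow_le_pow_right (by norm_num) hlog).trans (two_pow_clog_le hs)
    have := F.cost_nonneg (2 ^ logSize ι κ)
    have := F.cost_mono hsize
    gcongr
  have hone : 1 ≤ F.cost (2 * s) := F.one_le_cost (by omega)
  refine Achieves.mono_cost (c := 1 + (24 * (logSize ι κ + 1) * F.cost (2 ^ logSize ι κ) + 0)) ?_
    (by nlinarith [(Nat.clog 2 s).cast_nonneg (α := ℝ)])
  have he := (BinIdx.embed ι (card_le_two_pow_logSize_left (κ := κ))).injective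
  have hf := (BinIdx.embed κ (card_le_two_pow_logSize_right (ι := ι))).injective
  refine (achieves_lit 0).bind fun z m₁ hm₁ hz => ?_
  refine (F.isPivotInverter_invBin _ _ _ _ ((hM.mono hm₁).pad he hf hz)).bind
    fun o m _ ⟨G, hG, hinv⟩ => achieves_pure ⟨_, fun j i => hG _ _, hinv.of_padMat he hf⟩

end FastMul

/-! ### Krylov spaces -/

section Krylov

open Matrix LinearMap

theorem range_mulVecLin_fromCols {R ι κ κ' : Type*} [CommRing R] [Fintype κ] [Fintype κ']
    (P : Matrix ι κ R) (Q : Matrix ι κ' R) :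
    range (fromCols P Q).mulVecLin = range P.mulVecLin ⊔ range Q.mulVecLin := by
  simp only [range_mulVecLin, ← Submodule.span_union]
  congr 1
  ext x
  simp [Sum.exists, funext_iff]

theorem mul_eq_one_of_surjective {R ι κ : Type*} [CommRing R] [Fintype ι] [Fintype κ]
    [DecidableEq κ] {M : Matrix ι κ R} {G : Matrix κ ι R}
    (hM : Function.Surjective M.mulVec) (hG : M * (G * M) = M)
    (hcard : Fintype.card ι = Fintype.card κ) : G * M = 1 := by
  classical
  obtain ⟨N, hMN⟩ := mulVec_surjective_iff_exists_right_inverse.1 hM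
  have hNM : N * M = 1 := (mul_eq_one_comm_of_card_eq _ _ _ hcard).1 hMN
  calc G * M = N * M * (G * M) := by rw [hNM, Matrix.one_mul]
    _ = 1 := by rw [Matrix.mul_assoc, hG, hNM]

variable {R ι κ κ' : Type*} [CommRing R] [Fintype ι] [DecidableEq ι] [Fintype κ] [Fintype κ']

/-- The span of the vectors `A ^ j b` for `j < k` and `b` in the column space of `B`. -/
def krylovSpan (A : Matrix ι ι R) (B : Matrix ι κ R) (k : ℕ) : Submodule R (ι → R) :=
  ⨆ j : Fin k, range (A ^ (j : ℕ) * B).mulVecLin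

/-- The columns of `B` generate the whole space as a module over `R[A]`. -/
def Generates (A : Matrix ι ι R) (B : Matrix ι κ R) : Prop :=
  ∀ N : Submodule R (ι → R), N.map A.mulVecLin ≤ N → range B.mulVecLin ≤ N → N = ⊤

theorem krylovSpan_one (A : Matrix ι ι R) (B : Matrix ι κ R) :
    krylovSpan A B 1 = range B.mulVecLin := by
  rw [krylovSpan, iSup_unique]
  simp

theorem krylovSpan_add (A : Matrix ι ι R) (B : Matrix ι κ R) (k l : ℕ) :
    krylovSpan A B (k + l) = krylovSpan A B k ⊔ (krylovSpan A B l).map (A ^ k).mulVecLin := by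
  simp only [krylovSpan, Submodule.map_iSup, ← range_comp, ← mulVecLin_mul, ← Matrix.mul_assoc,
    ← pow_add]
  rw [← finSumFinEquiv.iSup_comp, iSup_sum]
  simp

theorem krylovSpan_le {A : Matrix ι ι R} {B : Matrix ι κ R} {N : Submodule R (ι → R)}
    (hA : N.map A.mulVecLin ≤ N) (hB : range B.mulVecLin ≤ N) (k : ℕ) :
    krylovSpan A B k ≤ N := by
  refine iSup_le fun ⟨j, _⟩ => ?_
  dsimp only
  induction j with
  | zero => simpa using hB
  | succ j ih =>
    rw [pow_succ', Matrix.mul_assoc, mulVecLin_mul, range_comp]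
    exact (Submodule.map_mono (ih (by omega))).trans hA

theorem range_pow_mul_le_krylovSpan [Nontrivial R] (A : Matrix ι ι R) (B : Matrix ι κ R) {k : ℕ}
    (hk : Fintype.card ι ≤ k) (j : ℕ) : range (A ^ j * B).mulVecLin ≤ krylovSpan A B k := by
  rintro _ ⟨y, rfl⟩
  have hdeg : (X ^ j %ₘ A.charpoly).degree < k :=
    (degree_modByMonic_lt _ A.charpoly_monic).trans_le <| by
      rw [A.charpoly_degree_eq_dim]
      exact_mod_cast hk
  rw [mulVecLin_apply, A.pow_eq_aeval_mod_charpoly, aeval_def, eval₂_eq_sum, Polynomial.sum_def,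
    Matrix.sum_mul, sum_mulVec]
  refine Submodule.sum_mem _ fun i hi => ?_
  have hik : i < k := by exact_mod_cast (le_degree_of_mem_supp i hi).trans_lt hdeg
  rw [← Algebra.smul_def, Matrix.smul_mul, smul_mulVec]
  exact Submodule.smul_mem _ _ <|
    le_iSup (fun i : Fin k => range (A ^ (i : ℕ) * B).mulVecLin) ⟨i, hik⟩ ⟨y, rfl⟩

theorem map_krylovSpan_le [Nontrivial R] (A : Matrix ι ι R) (B : Matrix ι κ R) {k : ℕ}
    (hk : Fintype.card ι ≤ k) : (krylovSpan A B k).map A.mulVecLin ≤ krylovSpan A B k := by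
  nth_rewrite 1 [krylovSpan]
  rw [Submodule.map_iSup]
  refine iSup_le fun j => ?_
  rw [← range_comp, ← mulVecLin_mul, ← Matrix.mul_assoc, ← pow_succ']
  exact range_pow_mul_le_krylovSpan A B hk _

theorem range_le_krylovSpan [Nontrivial R] (A : Matrix ι ι R) (B : Matrix ι κ R) {k : ℕ}
    (hk : Fintype.card ι ≤ k) : range B.mulVecLin ≤ krylovSpan A B k := by
  simpa using range_pow_mul_le_krylovSpan A B hk 0

theorem Generates.krylovSpan_eq_top [Nontrivial R] {A : Matrix ι ι R} {B : Matrix ι κ R}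
    (h : Generates A B) : krylovSpan A B (Fintype.card ι) = ⊤ :=
  h _ (map_krylovSpan_le A B le_rfl) (range_le_krylovSpan A B le_rfl)

theorem krylovSpan_two_mul {A : Matrix ι ι R} {B : Matrix ι κ R} {P : Matrix ι κ' R} {k : ℕ}
    (h : krylovSpan A B k = range P.mulVecLin) :
    krylovSpan A B (2 * k) = range (fromCols P (A ^ k * P)).mulVecLin := by
  rw [two_mul, krylovSpan_add, h, range_mulVecLin_fromCols, mulVecLin_mul, range_comp]

theorem IsPivotInverse.range_mulVecLin [DecidableEq κ] {M : Matrix ι κ R} {G : Matrix κ ι R}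
    {row : ι → Bool} {col : κ → Bool} (h : IsPivotInverse M G row col) :
    range (M * G).mulVecLin = range M.mulVecLin := by
  refine le_antisymm ?_ ?_
  · rw [mulVecLin_mul]
    exact range_comp_le_range _ _
  · nth_rewrite 1 [← h.mul_mul]
    rw [← Matrix.mul_assoc, mulVecLin_mul]
    exact range_comp_le_range _ _

/-- The matrix with the columns `b, A b, …, A ^ (k - 1) b`, for a column vector `b`. -/
def krylovMatrix (A : Matrix ι ι R) (b : Matrix ι Unit R) (k : ℕ) : Matrix ι (Fin k) R :=
  Matrix.of fun i j => (A ^ (j : ℕ) * b) i ()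

theorem pow_mul_krylovMatrix_apply (A : Matrix ι ι R) (b : Matrix ι Unit R) (l : ℕ) {k : ℕ} (i : ι)
    (j : Fin k) : (A ^ l * krylovMatrix A b k) i j = (A ^ (l + j) * b) i () := by
  rw [pow_add, Matrix.mul_assoc, Matrix.mul_apply, Matrix.mul_apply]
  rfl

theorem krylovMatrix_mulVec (A : Matrix ι ι R) (b : Matrix ι Unit R) {k : ℕ} (v : Fin k → R) :
    krylovMatrix A b k *ᵥ v = fun i => ((∑ j, v j • A ^ (j : ℕ)) * b) i () := by
  ext i
  simp [krylovMatrix, mulVec, dotProduct, Matrix.sum_mul, Matrix.sum_apply, mul_comm]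

theorem krylovSpan_le_range_krylovMatrix (A : Matrix ι ι R) (b : Matrix ι Unit R) (k : ℕ) :
    krylovSpan A b k ≤ range (krylovMatrix A b k).mulVecLin := by
  refine iSup_le fun j => ?_
  rintro _ ⟨y, rfl⟩
  refine ⟨Pi.single j (y ()), ?_⟩
  ext i
  rw [mulVecLin_apply, mulVecLin_apply, mulVec_single]
  simp [krylovMatrix, mulVec, dotProduct]

theorem krylovMatrix_mulVec_charpoly_coeff [Nontrivial R] (A : Matrix ι ι R)
    (b : Matrix ι Unit R) :
    krylovMatrix A b (Fintype.card ι) *ᵥ (fun j => A.charpoly.coeff j) =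
      -fun i => (A ^ Fintype.card ι * b) i () := by
  have hCH := A.aeval_self_charpoly
  rw [aeval_eq_sum_range, A.charpoly_natDegree_eq_dim, Finset.sum_range_succ,
    ← A.charpoly_natDegree_eq_dim, A.charpoly_monic.coeff_natDegree, one_smul,
    A.charpoly_natDegree_eq_dim, Finset.sum_range] at hCH
  rw [krylovMatrix_mulVec, eq_neg_of_add_eq_zero_left hCH, Matrix.neg_mul]
  rfl

theorem Generates.charpoly_coeff_eq [Nontrivial R] {A : Matrix ι ι R} {b : Matrix ι Unit R}
    (h : Generates A b) {G : Matrix (Fin (Fintype.card ι)) ι R}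
    (hG : krylovMatrix A b (Fintype.card ι) * (G * krylovMatrix A b (Fintype.card ι)) =
      krylovMatrix A b (Fintype.card ι))
    (j : Fin (Fintype.card ι)) :
    A.charpoly.coeff j = 0 - (G * (A ^ Fintype.card ι * b)) j () := by
  have hsurj : Function.Surjective (krylovMatrix A b (Fintype.card ι)).mulVec :=
    LinearMap.range_eq_top.1 <| top_le_iff.1 <|
      h.krylovSpan_eq_top ▸ krylovSpan_le_range_krylovMatrix A b _
  have hcoeff := congrArg (G *ᵥ ·) (krylovMatrix_mulVec_charpoly_coeff A b)
  simp only [mulVec_mulVec, mul_eq_one_of_surjective hsurj hG (by simp), one_mulVec,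
    mulVec_neg] at hcoeff
  rw [zero_sub]
  exact congrFun hcoeff j

end Krylov

/-! ### Splitting the characteristic polynomial -/

section Splitting

open Matrix
open LinearMap (range range_comp range_comp_le_range)

theorem submatrix_id_mul {R ε ι κ γ : Type*} [Fintype ι] [NonUnitalNonAssocSemiring R]
    (A : Matrix ε ι R) (B : Matrix ι κ R) (f : γ → ε) :
    A.submatrix f id * B = (A * B).submatrix f id :=
  rfl

theorem mul_submatrix_id {R ε ι κ γ : Type*} [Fintype ι] [NonUnitalNonAssocSemiring R]
    (A : Matrix ε ι R) (B : Matrix ι κ R) (g : γ → κ) :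
    A * B.submatrix id g = (A * B).submatrix id g :=
  rfl

theorem submatrix_mul_submatrix_of_eq_zero {R ε ι κ γ : Type*} [Fintype ι] [Fintype γ]
    [NonUnitalNonAssocSemiring R] {f : γ → ι} (hf : f.Injective) (A : Matrix ε ι R)
    {B : Matrix ι κ R} (hB : ∀ i ∉ Set.range f, ∀ j, B i j = 0) :
    A.submatrix id f * B.submatrix f id = A * B := by
  ext i j
  rw [Matrix.mul_apply, Matrix.mul_apply]
  exact Fintype.sum_of_injective f hf _ _ (fun k hk => by rw [hB k hk, mul_zero]) fun _ => rfl

theorem range_mulVecLin_submatrix_le {R ι κ γ : Type*} [Fintype κ] [Fintype γ] [CommSemiring R]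
    (M : Matrix ι κ R) (f : γ → κ) :
    range (M.submatrix id f).mulVecLin ≤ range M.mulVecLin := by
  classical
  have hM : M.submatrix id f = M * (1 : Matrix κ κ R).submatrix id f := by
    rw [mul_submatrix_id, Matrix.mul_one]
  rw [hM, mulVecLin_mul]
  exact range_comp_le_range _ _

theorem mul_eq_zero_of_range_le {R ε ι κ κ' : Type*} [CommRing R] [Fintype ι] [Fintype κ]
    [Fintype κ'] {A : Matrix ε ι R} {M : Matrix ι κ R} {B : Matrix ι κ' R}
    (hM : A * M = 0) (h : range B.mulVecLin ≤ range M.mulVecLin) : A * B = 0 := by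
  classical
  refine ext_of_mulVec_single fun j => ?_
  obtain ⟨y, hy⟩ := h ⟨Pi.single j 1, rfl⟩
  rw [mulVecLin_apply, mulVecLin_apply] at hy
  rw [← mulVec_mulVec, ← hy, mulVec_mulVec, hM, zero_mulVec, zero_mulVec]

variable {R ι κ κ' γ δ : Type*} [CommRing R] [Fintype ι] [DecidableEq ι] [Fintype κ]
  [Fintype κ'] [Fintype γ] [DecidableEq γ] [Fintype δ] [DecidableEq δ]

/-- A basis adapted to an invariant subspace of `A`: the columns of `U` span the subspace, those of
`E` a complement of it, and the rows of `U'` and `T` are the coordinates. -/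
structure IsSplitting (A : Matrix ι ι R) (U : Matrix ι γ R) (U' : Matrix γ ι R)
    (E : Matrix ι δ R) (T : Matrix δ ι R) : Prop where
  inv_mul : U' * U = 1
  inv_mul_compl : U' * E = 0
  proj_mul : T * U = 0
  proj_mul_compl : T * E = 1
  sum_eq : U * U' + E * T = 1
  proj_map : T * (A * U) = 0

namespace IsSplitting

variable {A : Matrix ι ι R} {U : Matrix ι γ R} {U' : Matrix γ ι R} {E : Matrix ι δ R}
  {T : Matrix δ ι R}

theorem fromCols_mul_fromRows_eq_one (h : IsSplitting A U U' E T) :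
    fromCols U E * fromRows U' T = 1 := by
  rw [fromCols_mul_fromRows, h.sum_eq]

theorem card_add_card [Nontrivial R] (h : IsSplitting A U U' E T) :
    Fintype.card γ + Fintype.card δ = Fintype.card ι := by
  have hleft : fromRows U' T * fromCols U E = 1 := by
    rw [fromRows_mul_fromCols, h.inv_mul, h.inv_mul_compl, h.proj_mul, h.proj_mul_compl,
      fromBlocks_one]
  rw [← Fintype.card_sum]
  exact (square_of_invertible _ _ h.fromCols_mul_fromRows_eq_one hleft).symm

theorem charpoly_eq [Nontrivial R] (h : IsSplitting A U U' E T) :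
    A.charpoly = (U' * (A * U)).charpoly * (T * (A * E)).charpoly := by
  have hcomm := charpoly_mul_comm_of_le (A * fromCols U E) (fromRows U' T)
    (by rw [Fintype.card_sum, h.card_add_card])
  rwa [Matrix.mul_assoc, h.fromCols_mul_fromRows_eq_one, Matrix.mul_one, Fintype.card_sum,
    h.card_add_card, Nat.sub_self, pow_zero, one_mul, mul_fromCols, fromRows_mul_fromCols,
    h.proj_map, charpoly_fromBlocks_zero₂₁] at hcomm

theorem mul_inv_mul {ζ : Type*} (h : IsSplitting A U U' E T) {B : Matrix ι ζ R} (hB : T * B = 0) :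
    U * (U' * B) = B := by
  have hsum := congrArg (· * B) h.sum_eq
  simpa only [Matrix.add_mul, Matrix.one_mul, Matrix.mul_assoc, hB, Matrix.mul_zero,
    add_zero] using hsum

theorem proj_map_eq (h : IsSplitting A U U' E T) : T * (A * E) * T = T * A :=
  calc T * (A * E) * T = T * (A * U) * U' + T * (A * E) * T := by
        rw [h.proj_map, Matrix.zero_mul, zero_add]
    _ = T * A * (U * U' + E * T) := by simp only [Matrix.mul_add, Matrix.mul_assoc]
    _ = T * A := by rw [h.sum_eq, Matrix.mul_one]

theorem generates_left (h : IsSplitting A U U' E T) {B : Matrix ι κ R} (hB : T * B = 0) {k : ℕ}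
    (hU : range U.mulVecLin ≤ krylovSpan A B k) : Generates (U' * (A * U)) (U' * B) := by
  intro N hN hBN
  have hle : range U.mulVecLin ≤ N.map U.mulVecLin := by
    refine hU.trans (krylovSpan_le ?_ ?_ k)
    · rw [← Submodule.map_comp, ← mulVecLin_mul, ← h.mul_inv_mul h.proj_map, mulVecLin_mul,
        Submodule.map_comp]
      exact Submodule.map_mono hN
    · rw [← h.mul_inv_mul hB, mulVecLin_mul, range_comp]
      exact Submodule.map_mono hBN
  refine Submodule.eq_top_iff'.2 fun x => ?_
  obtain ⟨y, hy, hxy⟩ := hle ⟨x, rfl⟩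
  have hinj := congrArg (U' *ᵥ ·) hxy
  simp only [mulVecLin_apply, mulVec_mulVec, h.inv_mul, one_mulVec] at hinj
  exact hinj ▸ hy

theorem generates_right (h : IsSplitting A U U' E T) {B : Matrix ι (κ ⊕ κ') R}
    (hB : T * B.toCols₁ = 0) (hgen : Generates A B) :
    Generates (T * (A * E)) (T * B.toCols₂) := by
  intro N hN hBN
  have htop : N.comap T.mulVecLin = ⊤ := by
    refine hgen _ ?_ ?_
    · rw [Submodule.map_le_iff_le_comap, ← Submodule.comap_comp, ← mulVecLin_mul,
        ← h.proj_map_eq, mulVecLin_mul, Submodule.comap_comp]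
      exact Submodule.comap_mono (Submodule.map_le_iff_le_comap.1 hN)
    · rw [← Submodule.map_le_iff_le_comap, ← range_comp, ← mulVecLin_mul, ← fromCols_toCols B,
        mul_fromCols, hB, range_mulVecLin_fromCols]
      simpa using hBN
  refine Submodule.eq_top_iff'.2 fun x => ?_
  have hx : E *ᵥ x ∈ N.comap T.mulVecLin := htop ▸ Submodule.mem_top
  rwa [Submodule.mem_comap, mulVecLin_apply, mulVec_mulVec, h.proj_mul_compl, one_mulVec] at hx

end IsSplitting


namespace IsPivotInverse

variable [DecidableEq κ] {A : Matrix ι ι R} {M : Matrix ι κ R} {G : Matrix κ ι R}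
  {row : ι → Bool} {col : κ → Bool}

theorem one_sub_mul_self (h : IsPivotInverse M G row col) : (1 - M * G) * M = 0 := by
  rw [Matrix.sub_mul, Matrix.one_mul, Matrix.mul_assoc, h.mul_mul, sub_self]

-- The pivot columns of `M` span its column space, and the non-pivot unit vectors a complement.
theorem isSplitting (h : IsPivotInverse M G row col)
    (hA : range (A * M).mulVecLin ≤ range M.mulVecLin) :
    IsSplitting A (M.submatrix id (Subtype.val : {j // col j = true} → κ))
      (G.submatrix (Subtype.val : {j // col j = true} → κ) id)
      ((1 : Matrix ι ι R).submatrix id (Subtype.val : {i // row i = false} → ι))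
      ((1 - M * G).submatrix (Subtype.val : {i // row i = false} → ι) id) where
  inv_mul := by
    rw [submatrix_id_mul, mul_submatrix_id]
    ext i j
    rw [submatrix_apply, submatrix_apply, id, id, h.col_eq j j.2, one_apply, one_apply]
    simp only [Subtype.ext_iff]
  inv_mul_compl := by
    rw [submatrix_id_mul, mul_submatrix_id, Matrix.mul_one]
    ext i j
    exact h.row_zero j j.2 i
  proj_mul := by
    rw [submatrix_id_mul, mul_submatrix_id, h.one_sub_mul_self]
    rfl
  proj_mul_compl := by
    rw [submatrix_id_mul, mul_submatrix_id, Matrix.mul_one]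
    ext i j
    rw [submatrix_apply, submatrix_apply, id, id, Matrix.sub_apply,
      mul_apply_of_col_eq_zero (h.row_zero j j.2), sub_zero, one_apply, one_apply]
    simp only [Subtype.ext_iff]
  sum_eq := by
    rw [submatrix_mul_submatrix_of_eq_zero Subtype.val_injective _ fun j hj => h.col_zero j
        (by simpa using hj),
      submatrix_mul_submatrix_of_eq_zero Subtype.val_injective _ fun i hi j => by
        rw [Matrix.sub_apply, h.row_eq i (by simpa using hi), sub_self],
      Matrix.one_mul, add_sub_cancel]
  proj_map := by
    rw [submatrix_id_mul, mul_submatrix_id, mul_submatrix_id,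
      mul_eq_zero_of_range_le h.one_sub_mul_self hA]
    rfl

end IsPivotInverse

end Splitting

/-! ### Programs for Krylov spaces -/

section KrylovPrograms

variable {K : Type} [Field K]

/-- The registers `f j` hold the coefficients of `p`; all but finitely many of them may be the same
register, holding `0`. -/
def RegPoly (mem : List K) (f : ℕ → ℕ) (p : K[X]) : Prop := ∀ j, HasVal mem (f j) (p.coeff j)

theorem RegPoly.mono {mem mem' : List K} {f : ℕ → ℕ} {p : K[X]} (h : RegPoly mem f p)
    (hm : mem <+: mem') : RegPoly mem' f p := fun j => (h j).mono hm

/-- Multiplication of polynomials whose product has degree at most `n`. -/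
noncomputable def polyMul (n : ℕ) (f g : ℕ → ℕ) : Prog K (ℕ → ℕ) := do
  let z ← lit 0
  let r ← forFin (n + 1) fun k => dot ((List.range (k.val + 1)).map fun i => (f i, g (k.val - i)))
  pure fun j => if h : j < n + 1 then r ⟨j, h⟩ else z

/-- The monic polynomial of degree `n` whose other coefficients are the negatives of given ones. -/
noncomputable def monicOfNeg (n : ℕ) (v : Fin n → ℕ) : Prog K (ℕ → ℕ) := do
  let z ← lit 0
  let e ← lit 1
  let u ← forFin n fun j => arith .sub z (v j) ret
  pure fun j => if h : j < n then u ⟨j, h⟩ else if j = n then e else z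

variable [DecidableEq K] {mem : List K} {n : ℕ}

theorem coeff_mul_eq_sum_map_range {R : Type*} [Semiring R] (p q : R[X]) (k : ℕ) :
    (p * q).coeff k = ((List.range (k + 1)).map fun i => p.coeff i * q.coeff (k - i)).sum := by
  rw [coeff_mul, Finset.Nat.sum_antidiagonal_eq_sum_range_succ_mk, ← List.sum_toFinset _
    List.nodup_range, List.toFinset_range]

theorem achieves_polyMul {f g : ℕ → ℕ} {p q : K[X]} (hp : RegPoly mem f p)
    (hq : RegPoly mem g q) (hn : (p * q).natDegree ≤ n) :
    Achieves True (polyMul n f g) mem (4 * ((n : ℝ) + 1) ^ 2) fun r m => RegPoly m r (p * q) := by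
  refine Achieves.mono_cost (c := 1 + ((n + 1 : ℕ) * (2 * (n + 1 : ℕ) + 1) + 0)) ?_
    (by push_cast; nlinarith [n.cast_nonneg (α := ℝ)])
  refine (achieves_lit 0).bind fun z m₁ hm₁ hz => ?_
  refine (achieves_forFin_hasVal (v := fun k => (p * q).coeff k) fun k m hm => ?_).bind
    fun r m hm hr => achieves_pure fun j => ?_
  · have hk : ((k + 1 : ℕ) : ℝ) ≤ (n + 1 : ℕ) := by exact_mod_cast k.isLt
    have hmem := hm₁.trans hm
    simp only [coeff_mul_eq_sum_map_range]
    exact (achieves_dot _ (fun i _ => (hp i).mono hmem) fun i _ => (hq _).mono hmem).mono_cost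
      (by rw [List.length_range]; linarith)
  · split_ifs with h
    · exact hr ⟨j, h⟩
    · rw [coeff_eq_zero_of_natDegree_lt (by omega)]
      exact hz.mono hm

theorem achieves_monicOfNeg {v : Fin n → ℕ} {w : Fin n → K} {p : K[X]} (hp : p.Monic)
    (hn : p.natDegree = n) (hv : ∀ j, HasVal mem (v j) (w j))
    (hw : ∀ j : Fin n, p.coeff j = 0 - w j) :
    Achieves True (monicOfNeg n v) mem (n + 2) fun f m => RegPoly m f p := by
  refine Achieves.mono_cost (c := 1 + (1 + (n * 1 + 0))) ?_ (by linarith)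
  refine (achieves_lit 0).bind fun z m₁ hm₁ hz => ?_
  refine (achieves_lit 1).bind fun e m₂ hm₂ he => ?_
  refine (achieves_forFin_hasVal (v := fun j => 0 - w j) fun j m hm =>
    achieves_arith .sub (hz.mono (hm₂.trans hm))
      ((hv j).mono ((hm₁.trans hm₂).trans hm))).bind fun u m hm hu => ?_
  refine achieves_pure fun j => ?_
  split_ifs with hlt heq
  · exact hw ⟨j, hlt⟩ ▸ hu ⟨j, hlt⟩
  · rw [heq, ← hn, hp.coeff_natDegree]
    exact he.mono hm
  · rw [coeff_eq_zero_of_natDegree_lt (by omega)]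
    exact (hz.mono hm₂).mono hm

namespace FastMul

open LinearMap (range)

variable {ω : ℝ} (F : FastMul K ω) {ι κ : Type} [Fintype ι] [Fintype κ]

/-- A square matrix with the column space of a given one, from a pivot inverse of the latter. -/
noncomputable def squareCols (h : ι → κ → ℕ) : Prog K (ι → ι → ℕ) := do
  let o ← F.inv h
  F.mmul h o.reg

/-- A matrix with column space `krylovSpan A B (2 ^ L)`, and the power `A ^ 2 ^ L`. -/
noncomputable def krylov (hA : ι → ι → ℕ) (hB : ι → κ → ℕ) :
    ℕ → Prog K ((ι → ι → ℕ) × (ι → ι → ℕ))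
  | 0 => do
      let p ← F.squareCols hB
      pure (p, hA)
  | L + 1 => do
      let r ← krylov hA hB L
      let w ← F.mmul r.2 r.1
      let p ← F.squareCols fun i => Sum.elim (r.1 i) (w i)
      let a ← F.mmul r.2 r.2
      pure (p, a)

/-- The matrix `krylovMatrix A b (2 ^ L)`, and the power `A ^ 2 ^ L`. -/
noncomputable def krylovCols (hA : ι → ι → ℕ) (hb : ι → Unit → ℕ) :
    (L : ℕ) → Prog K ((ι → Fin (2 ^ L) → ℕ) × (ι → ι → ℕ))
  | 0 => pure (fun i _ => hb i (), hA)
  | L + 1 => do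
      let r ← krylovCols hA hb L
      let w ← F.mmul r.2 r.1
      let a ← F.mmul r.2 r.2
      pure (fun i j => if h : j.val < 2 ^ L then r.1 i ⟨j, h⟩ else w i ⟨j.val - 2 ^ L, by omega⟩, a)

variable {s : ℕ}

theorem achieves_squareCols {h : ι → κ → ℕ} {M : Matrix ι κ K} (hM : RegMat mem h M) (hs : 1 ≤ s)
    (hι : Fintype.card ι ≤ s) (hκ : Fintype.card κ ≤ s) :
    Achieves True (F.squareCols h) mem (26 * (Nat.clog 2 s + 1) * F.cost (2 * s)) fun r m =>
      ∃ P : Matrix ι ι K, RegMat m r P ∧ range M.mulVecLin = range P.mulVecLin := by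
  classical
  have hcost : F.cost s ≤ F.cost (2 * s) := F.cost_mono (by omega)
  have hprod := mul_nonneg (Nat.cast_nonneg (Nat.clog 2 s)) (F.cost_nonneg (2 * s))
  refine Achieves.mono_cost (c := 25 * (Nat.clog 2 s + 1) * F.cost (2 * s) + F.cost s) ?_
    (by linarith)
  refine (F.isPivotInverter_inv hs hι hκ _ _ _ hM).bind fun o m hm ⟨G, hG, hinv⟩ => ?_
  exact (F.achieves_mmul (hM.mono hm) hG hs hι hκ hι).mono le_rfl fun p m' _ hp =>
    ⟨M * G, hp, hinv.range_mulVecLin.symm⟩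

variable [DecidableEq ι]

theorem achieves_krylov {hA : ι → ι → ℕ} {hB : ι → κ → ℕ} {A : Matrix ι ι K} {B : Matrix ι κ K}
    (hAm : RegMat mem hA A) (hBm : RegMat mem hB B) (hs : 1 ≤ s)
    (hι : Fintype.card ι + Fintype.card ι ≤ s) (hκ : Fintype.card κ ≤ s) (L : ℕ) :
    Achieves True (F.krylov hA hB L) mem ((L + 1) * (28 * (Nat.clog 2 s + 1) * F.cost (2 * s)))
      fun r m =>
        (∃ P : Matrix ι ι K, RegMat m r.1 P ∧ krylovSpan A B (2 ^ L) = range P.mulVecLin) ∧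
        RegMat m r.2 (A ^ 2 ^ L) := by
  have hcost : F.cost s ≤ F.cost (2 * s) := F.cost_mono (by omega)
  have hnonneg := F.cost_nonneg (2 * s)
  have hprod := mul_nonneg (Nat.cast_nonneg (Nat.clog 2 s)) hnonneg
  have hι' : Fintype.card ι ≤ s := by omega
  induction L with
  | zero =>
    refine Achieves.mono_cost (c := 26 * (Nat.clog 2 s + 1) * F.cost (2 * s) + 0) ?_
      (by push_cast; linarith)
    refine (F.achieves_squareCols hBm hs hι' hκ).bind fun p m hm ⟨P, hP, hrange⟩ => ?_
    refine achieves_pure ⟨⟨P, hP, ?_⟩, ?_⟩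
    · rw [pow_zero, krylovSpan_one, hrange]
    · rw [pow_zero, pow_one]
      exact hAm.mono hm
  | succ L ih =>
    refine Achieves.mono_cost (c := (L + 1) * (28 * (Nat.clog 2 s + 1) * F.cost (2 * s)) +
      (F.cost s + (26 * (Nat.clog 2 s + 1) * F.cost (2 * s) + (F.cost s + 0)))) ?_
      (by push_cast; linarith)
    refine ih.bind fun r m₁ _ ⟨⟨P, hP, hspan⟩, hpow⟩ => ?_
    refine (F.achieves_mmul hpow hP hs hι' hι' hι').bind fun w m₂ hm₂ hw => ?_
    have hcols : RegMat m₂ (fun i => Sum.elim (r.1 i) (w i))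
        (Matrix.fromCols P (A ^ 2 ^ L * P)) := by
      rintro i (j | j)
      · exact (hP i j).mono hm₂
      · exact hw i j
    refine (F.achieves_squareCols hcols hs hι' (by rwa [Fintype.card_sum])).bind
      fun p m₃ hm₃ ⟨P', hP', hrange⟩ => ?_
    have hpow' := hpow.mono (hm₂.trans hm₃)
    refine (F.achieves_mmul hpow' hpow' hs hι' hι' hι').bind fun a m hm ha => ?_
    refine achieves_pure ⟨⟨P', hP'.mono hm, ?_⟩, ?_⟩
    · rw [pow_succ', krylovSpan_two_mul hspan, hrange]
    · rwa [pow_succ, pow_mul, pow_two]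

theorem achieves_krylovCols {hA : ι → ι → ℕ} {hb : ι → Unit → ℕ} {A : Matrix ι ι K}
    {b : Matrix ι Unit K} (hAm : RegMat mem hA A) (hbm : RegMat mem hb b) (hs : 1 ≤ s)
    (hι : Fintype.card ι ≤ s) {L : ℕ} (hL : 2 ^ L ≤ s) :
    Achieves True (F.krylovCols hA hb L) mem (L * (2 * F.cost s)) fun r m =>
      RegMat m r.1 (krylovMatrix A b (2 ^ L)) ∧ RegMat m r.2 (A ^ 2 ^ L) := by
  induction L with
  | zero =>
    refine Achieves.mono_cost (c := 0) (achieves_pure ⟨fun i j => ?_, ?_⟩) (by simp)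
    · have hcol : krylovMatrix A b (2 ^ 0) i j = b i () := by simp [krylovMatrix]
      exact hcol ▸ hbm i ()
    · rwa [pow_zero 2, pow_one]
  | succ L ih =>
    rw [pow_succ] at hL
    refine Achieves.mono_cost (c := L * (2 * F.cost s) + (F.cost s + (F.cost s + 0))) ?_
      (by push_cast; linarith)
    refine (ih (by omega)).bind fun r m₁ _ ⟨hcols, hpow⟩ => ?_
    refine (F.achieves_mmul hpow hcols hs hι hι (by simp; omega)).bind fun w m₂ hm₂ hw => ?_
    refine (F.achieves_mmul (hpow.mono hm₂) (hpow.mono hm₂) hs hι hι hι).bind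
      fun a m hm ha => achieves_pure ⟨fun i j => ?_, ?_⟩
    · dsimp only
      split_ifs with h
      · exact ((hcols i ⟨j, h⟩).mono hm₂).mono hm
      · have hadd : 2 ^ L + (j.val - 2 ^ L) = j.val := Nat.add_sub_cancel' (not_lt.1 h)
        have hw' := (hw i ⟨j.val - 2 ^ L, by omega⟩).mono hm
        rw [pow_mul_krylovMatrix_apply, hadd] at hw'
        exact hw'
    · have hsq : A ^ 2 ^ (L + 1) = A ^ 2 ^ L * A ^ 2 ^ L := by rw [pow_succ, pow_mul, pow_two]
      exact hsq ▸ ha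

/-- The characteristic polynomial of a matrix with a cyclic vector `b`, by solving
`A ^ n * b = ∑ j < n, x j • A ^ j * b`. -/
noncomputable def charpolyCyclic (hA : ι → ι → ℕ) (hb : ι → Unit → ℕ) : Prog K (ℕ → ℕ) := do
  have hlt : Fintype.card ι < 2 ^ Nat.clog 2 (Fintype.card ι + 1) :=
    Nat.lt_of_succ_le (Nat.le_pow_clog (by norm_num) _)
  let r ← F.krylovCols hA hb (Nat.clog 2 (Fintype.card ι + 1))
  let o ← F.inv fun i (j : Fin (Fintype.card ι)) => r.1 i (j.castLE hlt.le)
  let v ← F.mmul o.reg fun i (_ : Unit) => r.1 i ⟨Fintype.card ι, hlt⟩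
  monicOfNeg (Fintype.card ι) fun j => v j ()

theorem achieves_charpolyCyclic {hA : ι → ι → ℕ} {hb : ι → Unit → ℕ} {A : Matrix ι ι K}
    {b : Matrix ι Unit K} (hAm : RegMat mem hA A) (hbm : RegMat mem hb b)
    (hgen : Generates A b) (hs : Fintype.card ι + 1 ≤ s) :
    Achieves True (F.charpolyCyclic hA hb) mem (31 * (Nat.clog 2 s + 1) * F.cost (2 * s))
      fun f m => RegPoly m f A.charpoly := by
  set n := Fintype.card ι
  have hlog : Nat.clog 2 (n + 1) ≤ Nat.clog 2 s := Nat.clog_mono_right 2 hs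
  have hpow : 2 ^ Nat.clog 2 (n + 1) ≤ 2 * s :=
    (Nat.pow_le_pow_right (by norm_num) hlog).trans (two_pow_clog_le (by omega))
  have hcost : Nat.clog 2 (n + 1) * (2 * F.cost (2 * s)) +
      (25 * (Nat.clog 2 s + 1) * F.cost (2 * s) + (F.cost s + (n + 2))) ≤
        31 * (Nat.clog 2 s + 1) * F.cost (2 * s) := by
    have hmono : F.cost s ≤ F.cost (2 * s) := F.cost_mono (by omega)
    have hn : (n : ℝ) + 1 ≤ s := by exact_mod_cast hs
    have hlinear : (n : ℝ) + 2 ≤ 2 * F.cost s := by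
      nlinarith [F.sq_le_cost s, n.cast_nonneg (α := ℝ)]
    have hlog' : (Nat.clog 2 (n + 1) : ℝ) ≤ Nat.clog 2 s := by exact_mod_cast hlog
    have := mul_le_mul_of_nonneg_right hlog' (F.cost_nonneg (2 * s))
    have := mul_nonneg (Nat.cast_nonneg (Nat.clog 2 s)) (F.cost_nonneg (2 * s))
    linarith
  refine Achieves.mono_cost ?_ hcost
  refine (F.achieves_krylovCols hAm hbm (by omega) (by omega) hpow).bind
    fun r m₁ _ ⟨hcols, _⟩ => ?_
  refine (F.isPivotInverter_inv (by omega) (by omega) (by simp; omega) _ (krylovMatrix A b n) _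
    fun i _ => hcols i _).bind fun o m₂ hm₂ ⟨G, hG, hinv⟩ => ?_
  refine (F.achieves_mmul (B := A ^ n * b) hG (fun i _ => (hcols i _).mono hm₂) (by omega)
    (by simp; omega) (by omega) (by simp; omega)).bind fun v m₃ _ hv => ?_
  exact achieves_monicOfNeg A.charpoly_monic A.charpoly_natDegree_eq_dim (fun j => hv j ())
    (hgen.charpoly_coeff_eq hinv.mul_mul)

end FastMul

end KrylovPrograms

/-! ### The characteristic polynomial -/

section Decomposition

open Matrix
open LinearMap (range)

variable {R ι κ κ' γ δ : Type*} [CommRing R] [Fintype ι] [DecidableEq ι] [Fintype κ] [Fintype κ']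
  [Fintype γ] [DecidableEq γ] [Fintype δ] [DecidableEq δ]

/-- The matrix `A`, whose space has the generators `B`, decomposes into `A₁` on an invariant
subspace with generators `B₁` and `A₂` on the quotient with generators `B₂`; the subspace and the
quotient only enter through the characteristic polynomials and the dimensions. -/
structure IsDecomposition (A : Matrix ι ι R) (A₁ : Matrix γ γ R) (B₁ : Matrix γ κ R)
    (A₂ : Matrix δ δ R) (B₂ : Matrix δ κ' R) : Prop where
  generates_left : Generates A₁ B₁
  generates_right : Generates A₂ B₂
  charpoly_eq : A.charpoly = A₁.charpoly * A₂.charpoly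
  card_eq : Fintype.card γ + Fintype.card δ = Fintype.card ι

theorem IsPivotInverse.isDecomposition [Nontrivial R] {A M G : Matrix ι ι R}
    {B : Matrix ι (κ ⊕ κ') R} {row col : ι → Bool} (h : IsPivotInverse M G row col) {k : ℕ}
    (hk : Fintype.card ι ≤ k) (hM : krylovSpan A B.toCols₁ k = range M.mulVecLin)
    (hgen : Generates A B) :
    IsDecomposition A
      ((G * (A * M)).submatrix (Subtype.val : {j // col j = true} → ι) Subtype.val)
      ((G * B.toCols₁).submatrix (Subtype.val : {j // col j = true} → ι) id)
      ((A - M * G * A).submatrix (Subtype.val : {i // row i = false} → ι) Subtype.val)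
      ((B.toCols₂ - M * G * B.toCols₂).submatrix (Subtype.val : {i // row i = false} → ι) id) := by
  have hA : range (A * M).mulVecLin ≤ range M.mulVecLin := by
    rw [mulVecLin_mul, LinearMap.range_comp, ← hM]
    exact map_krylovSpan_le A _ hk
  have hB : (1 - M * G).submatrix (Subtype.val : {i // row i = false} → ι) id * B.toCols₁ = 0 := by
    rw [submatrix_id_mul,
      mul_eq_zero_of_range_le h.one_sub_mul_self (hM ▸ range_le_krylovSpan A _ hk)]
    rfl
  have hsplit := h.isSplitting hA
  have hleft := hsplit.generates_left hB ((range_mulVecLin_submatrix_le M _).trans hM.ge)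
  have hright := hsplit.generates_right hB hgen
  have hcharpoly := hsplit.charpoly_eq
  simp only [submatrix_id_mul, mul_submatrix_id, submatrix_submatrix, Function.id_comp,
    Function.comp_id, Matrix.mul_one, Matrix.sub_mul, Matrix.one_mul] at hleft hright hcharpoly
  exact ⟨hleft, hright, hcharpoly, hsplit.card_add_card⟩

end Decomposition

section CharpolyPrograms

variable {K : Type} [Field K]

/-- The registers of the two parts of an `IsDecomposition`. They are indexed by the full index set;
the subspace lives on the indices marked by `col`, the quotient on those not marked by `row`. -/
structure DecompositionRegs (ι κ κ' : Type) where
  row : ι → Bool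
  col : ι → Bool
  restr : ι → ι → ℕ
  restrGen : ι → κ → ℕ
  quot : ι → ι → ℕ
  quotGen : ι → κ' → ℕ

namespace FastMul

variable [DecidableEq K] {ω : ℝ} (F : FastMul K ω) {ι κ κ' : Type} [Fintype ι] [Fintype κ]
  [Fintype κ']

/-- The decomposition of `A` by the subspace that the columns of `B` generate. -/
noncomputable def decompose (hA : ι → ι → ℕ) (hB : ι → κ → ℕ) (hB' : ι → κ' → ℕ) :
    Prog K (DecompositionRegs ι κ κ') := do
  let r ← F.krylov hA hB (Nat.clog 2 (Fintype.card ι))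
  let o ← F.inv r.1
  let u ← F.mmul hA r.1
  let restr ← F.mmul o.reg u
  let restrGen ← F.mmul o.reg hB
  let p ← F.mmul r.1 o.reg
  let x ← F.mmul p hA
  let quot ← msub hA x
  let y ← F.mmul p hB'
  let quotGen ← msub hB' y
  pure ⟨o.row, o.col, restr, restrGen, quot, quotGen⟩

/-- The characteristic polynomial of a matrix `A` from `2 ^ k` generators of the space over
`K[A]`, by decomposing it with respect to the first half of the generators. -/
noncomputable def charpolyGen : (k : ℕ) → (ι : Type) → [Fintype ι] → (ι → ι → ℕ) →
    (ι → BinIdx k → ℕ) → Prog K (ℕ → ℕ)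
  | 0, _, _, hA, hB => F.charpolyCyclic hA hB
  | k + 1, ι, _, hA, hB => do
      let o ← F.decompose hA (fun i j => hB i (.inl j)) fun i j => hB i (.inr j)
      let f ← charpolyGen k {j // o.col j = true} (fun i j => o.restr i j)
        fun i j => o.restrGen i j
      let g ← charpolyGen k {i // o.row i = false} (fun i j => o.quot i j)
        fun i j => o.quotGen i j
      polyMul (Fintype.card ι) f g

variable [DecidableEq ι] {mem : List K} {s : ℕ}

theorem decompose_cost_le {l : ℕ} (hl : l ≤ s) :
    (Nat.clog 2 l + 1) * (28 * ((Nat.clog 2 (2 * s) : ℝ) + 1) * F.cost (2 * (2 * s))) +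
      (25 * ((Nat.clog 2 (2 * s) : ℝ) + 1) * F.cost (2 * (2 * s)) + 8 * F.cost s) ≤
      61 * ((Nat.clog 2 (2 * s) : ℝ) + 1) ^ 2 * F.cost (4 * s) := by
  set Λ : ℝ := Nat.clog 2 (2 * s) + 1
  have hΛ : 1 ≤ Λ := le_add_of_nonneg_left (Nat.cast_nonneg _)
  have hclog : (Nat.clog 2 l : ℝ) + 1 ≤ Λ := by
    have : Nat.clog 2 l ≤ Nat.clog 2 (2 * s) := Nat.clog_mono_right 2 (by omega)
    exact add_le_add_left (by exact_mod_cast this) 1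
  have hmono : F.cost s ≤ F.cost (4 * s) := F.cost_mono (by omega)
  have hc := F.cost_nonneg (4 * s)
  have hΛc : F.cost (4 * s) ≤ Λ * F.cost (4 * s) := le_mul_of_one_le_left hc hΛ
  have hΛc' : Λ * F.cost (4 * s) ≤ Λ * (Λ * F.cost (4 * s)) :=
    le_mul_of_one_le_left (hc.trans hΛc) hΛ
  have hkrylov := mul_le_mul_of_nonneg_right hclog (hc.trans hΛc)
  rw [show 2 * (2 * s) = 4 * s by ring]
  linarith

theorem achieves_decompose {hA : ι → ι → ℕ} {hB : ι → κ → ℕ} {hB' : ι → κ' → ℕ}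
    {A : Matrix ι ι K} {B : Matrix ι (κ ⊕ κ') K} (hAm : RegMat mem hA A)
    (hBm : RegMat mem hB B.toCols₁) (hBm' : RegMat mem hB' B.toCols₂) (hgen : Generates A B)
    (hs : 1 ≤ s) (hι : Fintype.card ι ≤ s) (hκ : Fintype.card κ ≤ s) (hκ' : Fintype.card κ' ≤ s) :
    Achieves True (F.decompose hA hB hB') mem
      (61 * (Nat.clog 2 (2 * s) + 1) ^ 2 * F.cost (4 * s)) fun o m =>
        ∃ (A₁ : Matrix {j // o.col j = true} {j // o.col j = true} K)
          (B₁ : Matrix {j // o.col j = true} κ K)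
          (A₂ : Matrix {i // o.row i = false} {i // o.row i = false} K)
          (B₂ : Matrix {i // o.row i = false} κ' K),
          IsDecomposition A A₁ B₁ A₂ B₂ ∧
          RegMat m (fun (i j : {j // o.col j = true}) => o.restr i j) A₁ ∧
          RegMat m (fun (i : {j // o.col j = true}) j => o.restrGen i j) B₁ ∧
          RegMat m (fun (i j : {i // o.row i = false}) => o.quot i j) A₂ ∧
          RegMat m (fun (i : {i // o.row i = false}) j => o.quotGen i j) B₂ := by
  have hcost := F.decompose_cost_le hι
  rw [show 8 * F.cost s = F.cost s + (F.cost s + (F.cost s + (F.cost s + (F.cost s + (F.cost s +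
    (F.cost s + (F.cost s + 0))))))) by ring] at hcost
  refine Achieves.mono_cost ?_ hcost
  refine (F.achieves_krylov hAm hBm (by omega) (by omega) (by omega) _).bind
    fun r m₁ hm₁ ⟨⟨M, hM, hspan⟩, _⟩ => ?_
  refine (F.isPivotInverter_inv (by omega) (by omega) (by omega) _ _ _ hM).bind
    fun o m₂ hm₂ ⟨G, hG, hinv⟩ => ?_
  have hA₂ := hAm.mono (hm₁.trans hm₂)
  have hM₂ := hM.mono hm₂
  refine (F.achieves_mmul hA₂ hM₂ hs hι hι hι).bind fun u m₃ hm₃ hu => ?_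
  refine (F.achieves_mmul (hG.mono hm₃) hu hs hι hι hι).bind fun restr m₄ hm₄ hrestr => ?_
  have h₂₄ := hm₃.trans hm₄
  refine (F.achieves_mmul (hG.mono h₂₄) (hBm.mono ((hm₁.trans hm₂).trans h₂₄)) hs hι hι hκ).bind
    fun restrGen m₅ hm₅ hrestrGen => ?_
  have h₂₅ := h₂₄.trans hm₅
  refine (F.achieves_mmul (hM₂.mono h₂₅) (hG.mono h₂₅) hs hι hι hι).bind fun p m₆ hm₆ hp => ?_
  have hA₆ := hA₂.mono (h₂₅.trans hm₆)
  have hB₆ := hBm'.mono ((hm₁.trans hm₂).trans (h₂₅.trans hm₆))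
  refine (F.achieves_mmul hp hA₆ hs hι hι hι).bind fun x m₇ hm₇ hx => ?_
  refine (F.achieves_msub (hA₆.mono hm₇) hx hι hι).bind fun quot m₈ hm₈ hquot => ?_
  have h₆₈ := hm₇.trans hm₈
  refine (F.achieves_mmul (hp.mono h₆₈) (hB₆.mono h₆₈) hs hι hι hκ').bind fun y m₉ hm₉ hy => ?_
  refine (F.achieves_msub (hB₆.mono (h₆₈.trans hm₉)) hy hι hκ').bind
    fun quotGen m hm hquotGen => ?_
  have h₈ := hm₉.trans hm
  exact achieves_pure ⟨_, _, _, _,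
    hinv.isDecomposition (Nat.le_pow_clog (by norm_num) _) hspan hgen,
    fun i j => hrestr.mono ((hm₅.trans hm₆).trans (h₆₈.trans h₈)) i j,
    fun i j => hrestrGen.mono (hm₆.trans (h₆₈.trans h₈)) i j,
    fun i j => hquot.mono h₈ i j, fun i j => hquotGen i j⟩

theorem charpolyGen_cost_le {n n₁ n₂ : ℕ} (k : ℕ) (hn : n₁ + n₂ = n) {a : ℝ} (ha : 0 ≤ a) :
    a * F.cost (4 * (n₁ + 2 ^ k)) + (a * F.cost (4 * (n₂ + 2 ^ k)) + 4 * ((n : ℝ) + 1) ^ 2) ≤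
      a * F.cost (4 * (n + 2 ^ (k + 1))) + 4 * F.cost (4 * (n + 2 ^ (k + 1))) := by
  have : 2 ^ (k + 1) = 2 ^ k + 2 ^ k := by rw [pow_succ, mul_two]
  have hsum : F.cost (4 * (n₁ + 2 ^ k)) + F.cost (4 * (n₂ + 2 ^ k)) ≤
      F.cost (4 * (n + 2 ^ (k + 1))) :=
    (F.cost_add_le _ _).trans_eq (congrArg F.cost (by omega))
  have hsq : ((n : ℝ) + 1) ^ 2 ≤ F.cost (4 * (n + 2 ^ (k + 1))) := by
    refine le_trans ?_ (F.sq_le_cost _)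
    have : n + 1 ≤ 4 * (n + 2 ^ (k + 1)) := by have := Nat.one_le_two_pow (n := k); omega
    gcongr
    exact_mod_cast this
  linarith [mul_le_mul_of_nonneg_left hsum ha]

theorem achieves_charpolyGen (k : ℕ) {ι : Type} [Fintype ι] [DecidableEq ι] {hA : ι → ι → ℕ}
    {hB : ι → BinIdx k → ℕ} {A : Matrix ι ι K} {B : Matrix ι (BinIdx k) K} {mem : List K}
    (hAm : RegMat mem hA A) (hBm : RegMat mem hB B) (hgen : Generates A B)
    (hs : 2 * (Fintype.card ι + 2 ^ k) ≤ s) :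
    Achieves True (F.charpolyGen k ι hA hB) mem
      (65 * (Nat.clog 2 s + 1) ^ 2 * (k + 1) * F.cost (4 * (Fintype.card ι + 2 ^ k)))
      fun f m => RegPoly m f A.charpoly := by
  set Λ : ℝ := Nat.clog 2 s + 1
  have hΛ : 1 ≤ Λ := le_add_of_nonneg_left (Nat.cast_nonneg _)
  have hclog : ∀ s' ≤ s, (Nat.clog 2 s' : ℝ) + 1 ≤ Λ := fun s' hs' =>
    add_le_add_left (by exact_mod_cast Nat.clog_mono_right 2 hs') 1
  induction k generalizing ι mem with
  | zero =>
    refine (F.achieves_charpolyCyclic hAm hBm hgen le_rfl).mono_cost ?_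
    have hΛ2 : 31 * Λ ≤ 65 * Λ ^ 2 := by nlinarith
    have hc := F.cost_nonneg (2 * (Fintype.card ι + 1))
    rw [Nat.cast_zero, zero_add, mul_one]
    exact mul_le_mul ((mul_le_mul_of_nonneg_left (hclog _ (by omega)) (by norm_num)).trans hΛ2)
      (F.cost_mono (by omega)) hc (by positivity)
  | succ k ih =>
    set n := Fintype.card ι
    have : 2 ^ (k + 1) = 2 * 2 ^ k := pow_succ' 2 k
    have hpos : 1 ≤ 2 ^ k := Nat.one_le_two_pow
    have hhalf : Fintype.card (BinIdx k) ≤ n + 2 ^ (k + 1) := by rw [BinIdx.card_eq]; omega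
    set c := F.cost (4 * (n + 2 ^ (k + 1)))
    have hc : 0 ≤ c := F.cost_nonneg _
    refine Achieves.mono_cost (c := 61 * Λ ^ 2 * c + (65 * Λ ^ 2 * (k + 1) * c + 4 * c)) ?_ ?_
    · refine Achieves.bind ((F.achieves_decompose (B := B) hAm (fun i j => hBm i (.inl j))
        (fun i j => hBm i (.inr j)) hgen (by omega) (Nat.le_add_right _ _) hhalf hhalf).mono_cost
          (by gcongr; exact hclog _ hs))
        fun o m₁ _ ⟨A₁, B₁, A₂, B₂, hdec, hA₁, hB₁, hA₂, hB₂⟩ => ?_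
      have hcard := hdec.card_eq
      refine Achieves.mono_cost ?_ (F.charpolyGen_cost_le k hcard (by positivity))
      refine (ih hA₁ hB₁ hdec.generates_left (by omega)).bind fun f m₂ hm₂ hf => ?_
      refine (ih (hA₂.mono hm₂) (hB₂.mono hm₂) hdec.generates_right (by omega)).bind
        fun g m₃ hm₃ hg => ?_
      rw [hdec.charpoly_eq]
      refine achieves_polyMul (hf.mono hm₃) hg ?_
      rw [← hdec.charpoly_eq, A.charpoly_natDegree_eq_dim]
    · have hΛc : c ≤ Λ ^ 2 * c := le_mul_of_one_le_left hc (one_le_pow₀ hΛ)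
      push_cast
      linarith

end FastMul

end CharpolyPrograms

section CharpolyRoutine

theorem clog_two_le_two_mul_log {s : ℕ} (hs : 1 ≤ s) :
    (Nat.clog 2 s : ℝ) ≤ 2 * Real.log (2 * s) := by
  have hpow : (2 : ℝ) ^ Nat.clog 2 s ≤ 2 * s := by exact_mod_cast FastMul.two_pow_clog_le hs
  have hlog := Real.log_le_log (by positivity) hpow
  rw [Real.log_pow] at hlog
  nlinarith [Real.log_two_gt_d9, Nat.cast_nonneg (α := ℝ) (Nat.clog 2 s)]

theorem one_le_log_add_two {x : ℝ} (hx : 1 ≤ x) : 1 ≤ Real.log (x + 2) := by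
  rw [Real.le_log_iff_exp_le (by linarith)]
  linarith [Real.exp_one_lt_d9]

theorem log_twelve_mul_le {x : ℝ} (hx : 1 ≤ x) : Real.log (12 * x) ≤ 4 * Real.log (x + 2) := by
  rw [← Real.log_rpow (by linarith)]
  refine Real.log_le_log (by linarith) ?_
  norm_cast
  nlinarith [sq_nonneg ((x + 2) ^ 2 - 9)]

theorem clog_two_add_one_le {m n : ℕ} (hn : 1 ≤ n) (hm : m ≤ 6 * n) :
    (Nat.clog 2 m : ℝ) + 1 ≤ 9 * Real.log ((n : ℝ) + 2) := by
  have hmono : (Nat.clog 2 m : ℝ) ≤ Nat.clog 2 (6 * n) := by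
    exact_mod_cast Nat.clog_mono_right 2 hm
  have hclog := clog_two_le_two_mul_log (s := 6 * n) (by omega)
  have hn' : (1 : ℝ) ≤ n := by exact_mod_cast hn
  rw [Nat.cast_mul, ← mul_assoc, Nat.cast_ofNat, show (2 * 6 : ℝ) = 12 by norm_num] at hclog
  linarith [log_twelve_mul_le hn', one_le_log_add_two hn']

theorem generates_of_injective {K ι κ : Type*} [Field K] [Fintype ι] [Fintype κ]
    [DecidableEq κ] (A : Matrix ι ι K) {e : ι → κ} (he : e.Injective) :
    Generates A (Matrix.of fun i x => if e i = x then (1 : K) else 0) := by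
  intro N _ hB
  refine Submodule.eq_top_iff'.2 fun x => ?_
  convert hB ⟨Function.extend e x 0, rfl⟩ using 1
  ext i
  simp [Matrix.mulVec, dotProduct, he.extend_apply]

namespace FastMul

variable {ω : ℝ} (F : FastMul ℂ ω)

/-- The characteristic polynomial, with the unit vectors as generators. -/
noncomputable def charpolyRoutine : SimpleRR.CharpolyRoutine ℂ := fun n h => do
  let z ← lit 0
  let e ← lit 1
  let f ← F.charpolyGen (Nat.clog 2 n) (Fin n) h fun i x =>
    if BinIdx.embed (Fin n) ((Fintype.card_fin n).trans_le (Nat.le_pow_clog (by norm_num) n)) i = x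
    then e else z
  pure fun j => f j

theorem achieves_charpolyRoutine {n : ℕ} {h : Fin n → Fin n → ℕ} {A : Matrix (Fin n) (Fin n) ℂ}
    {mem : List ℂ} (hA : RegMat mem h A) :
    Achieves True (F.charpolyRoutine n h) mem
      (2 + 65 * ((Nat.clog 2 (2 * (n + 2 ^ Nat.clog 2 n)) : ℝ) + 1) ^ 2 * (Nat.clog 2 n + 1) *
        F.cost (4 * (n + 2 ^ Nat.clog 2 n)))
      fun f m => ∀ j, HasVal m (f j) (A.charpoly.coeff j) := by
  refine Achieves.mono_cost (c := 1 + (1 + (65 *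
    ((Nat.clog 2 (2 * (n + 2 ^ Nat.clog 2 n)) : ℝ) + 1) ^ 2 * (Nat.clog 2 n + 1) *
        F.cost (4 * (Fintype.card (Fin n) + 2 ^ Nat.clog 2 n)) + 0))) ?_
    (by rw [Fintype.card_fin]; linarith)
  refine (achieves_lit 0).bind fun z m₁ hm₁ hz => ?_
  refine (achieves_lit 1).bind fun e m₂ hm₂ he => ?_
  refine (F.achieves_charpolyGen _ (hA.mono (hm₁.trans hm₂)) (fun i x => ?_)
    (generates_of_injective A (BinIdx.embed (Fin n)
      ((Fintype.card_fin n).trans_le (Nat.le_pow_clog (by norm_num) n))).injective)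
    (by rw [Fintype.card_fin])).bind fun f m _ hf => achieves_pure fun j => hf j
  rw [Matrix.of_apply]
  split_ifs
  · exact he
  · exact hz.mono hm₂

theorem computesCharpoly_charpolyRoutine : SimpleRR.ComputesCharpoly F.charpolyRoutine :=
  fun _ _ _ _ hA => (F.achieves_charpolyRoutine hA).post

theorem exists_charpolyRoutine_cost_le : ∃ C : ℝ, 0 ≤ C ∧ ∀ n : ℕ, 1 ≤ n →
    2 + 65 * ((Nat.clog 2 (2 * (n + 2 ^ Nat.clog 2 n)) : ℝ) + 1) ^ 2 * (Nat.clog 2 n + 1) *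
        F.cost (4 * (n + 2 ^ Nat.clog 2 n)) ≤ C * (n : ℝ) ^ ω * Real.log ((n : ℝ) + 2) ^ 3 := by
  have hC := F.one_le
  have hω := F.two_le
  refine ⟨2 + 65 * 9 ^ 3 * ((F.C + 1) * 12 ^ ω), by positivity, fun n hn => ?_⟩
  have hn' : (1 : ℝ) ≤ n := by exact_mod_cast hn
  set l := Real.log ((n : ℝ) + 2)
  have hpow := two_pow_clog_le hn
  have hcost : F.cost (4 * (n + 2 ^ Nat.clog 2 n)) ≤ (F.C + 1) * 12 ^ ω * (n : ℝ) ^ ω := by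
    refine (F.cost_mono (s' := 12 * n) (by omega)).trans_eq ?_
    rw [cost, Nat.cast_mul, Nat.cast_ofNat, Real.mul_rpow (by norm_num) (by positivity), mul_assoc]
  have hl : 1 ≤ l := one_le_log_add_two hn'
  have : 0 ≤ l := by linarith
  have hone : 1 ≤ (n : ℝ) ^ ω * l ^ 3 := one_le_mul_of_one_le_of_one_le
    (Real.one_le_rpow hn' (by linarith)) (one_le_pow₀ hl)
  have hlog : (Nat.clog 2 (2 * (n + 2 ^ Nat.clog 2 n)) : ℝ) + 1 ≤ 9 * l :=
    clog_two_add_one_le hn (by omega)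
  have hlog' : (Nat.clog 2 n : ℝ) + 1 ≤ 9 * l := clog_two_add_one_le hn (by omega)
  have hnonneg := F.cost_nonneg (4 * (n + 2 ^ Nat.clog 2 n))
  calc _ ≤ 2 * ((n : ℝ) ^ ω * l ^ 3) +
        65 * (9 * l) ^ 2 * (9 * l) * ((F.C + 1) * 12 ^ ω * (n : ℝ) ^ ω) := by
        gcongr
        linarith
    _ = _ := by ring

end FastMul

end CharpolyRoutine

/-! ### Interpolation at roots of unity -/

section Interpolation

variable {K : Type} [Field K]

/-- One layer of the mixed radix Fourier transform: it combines the transforms `f r` of length `m`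
at the powers of `w ^ p` into one transform of length `p * m` at the powers of `w`. -/
def dftLayer (p m : ℕ) (w : K) (f : Fin p → ℕ → ℕ) : Prog K (ℕ → ℕ) := do
  let y ← forFin (p * m) fun j => do
    let c ← forFin p fun r => lit (w ^ (r.val * j.val))
    dot ((List.finRange p).map fun r => (c r, f r (j.val % m)))
  pure fun j => if h : j < p * m then y ⟨j, h⟩ else 0

/-- The discrete Fourier transform of length `l.prod` at the powers of `w`, in mixed radix `l`.
Inputs and outputs are indexed by `ℕ`; only the indices below `l.prod` are meaningful. -/
def dft : (l : List ℕ) → K → (ℕ → ℕ) → Prog K (ℕ → ℕ)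
  | [], _, v => pure v
  | p :: l, w, v => do
      let f ← forFin p fun r => dft l (w ^ p) fun i => v (p * i + r.val)
      dftLayer p l.prod w f

theorem sum_range_mul_eq {M : Type*} [AddCommMonoid M] {p m : ℕ} (f : ℕ → M) :
    ∑ i ∈ Finset.range (p * m), f i = ∑ r : Fin p, ∑ i ∈ Finset.range m, f (p * i + r.val) := by
  rw [mul_comm, Finset.sum_range, ← finProdFinEquiv.sum_comp, Fintype.sum_prod_type_right]
  refine Finset.sum_congr rfl fun r _ => ?_
  rw [Finset.sum_range]
  refine Finset.sum_congr rfl fun i _ => ?_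
  simp [add_comm]

theorem sum_range_mul_mul_pow_eq {R : Type*} [CommSemiring R] {p m : ℕ} {w : R}
    (hw : w ^ (p * m) = 1) (x : ℕ → R) (j : ℕ) :
    ∑ i ∈ Finset.range (p * m), x i * w ^ (i * j) =
      ∑ r : Fin p, w ^ (r.val * j) *
        ∑ i ∈ Finset.range m, x (p * i + r.val) * (w ^ p) ^ (i * (j % m)) := by
  rw [sum_range_mul_eq]
  refine Finset.sum_congr rfl fun r _ => ?_
  rw [Finset.mul_sum]
  refine Finset.sum_congr rfl fun i _ => ?_
  have hmod : (w ^ p) ^ (i * (j % m)) = (w ^ p) ^ (i * j) := by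
    conv_rhs => rw [← Nat.mod_add_div j m, mul_add, pow_add, mul_left_comm, pow_mul (w ^ p) m,
      ← pow_mul w p m, hw, one_pow, mul_one]
  rw [hmod, ← pow_mul, add_mul, pow_add, mul_assoc p i j]
  ring

section Programs

variable [DecidableEq K] {mem : List K}

theorem achieves_dftLayer {p m : ℕ} {w : K} (hw : w ^ (p * m) = 1) {f : Fin p → ℕ → ℕ} {x : ℕ → K}
    (hf : ∀ r, ∀ j < m, HasVal mem (f r j)
      (∑ i ∈ Finset.range m, x (p * i + r.val) * (w ^ p) ^ (i * j))) :
    Achieves True (dftLayer p m w f) mem ((p * m : ℕ) * (3 * p + 1)) fun y M =>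
      ∀ j < p * m, HasVal M (y j) (∑ i ∈ Finset.range (p * m), x i * w ^ (i * j)) := by
  refine Achieves.mono_cost (c := (p * m : ℕ) * (p * 1 + (2 * p + 1)) + 0) ?_ (by linarith)
  refine (achieves_forFin_hasVal (v := fun j : Fin (p * m) =>
    ∑ i ∈ Finset.range (p * m), x i * w ^ (i * j.val)) fun j m₁ hm₁ => ?_).bind
      fun y M _ hy => achieves_pure fun j hj => ?_
  · refine (achieves_forFin_hasVal (v := fun r : Fin p => w ^ (r.val * j.val))
      fun r m _ => achieves_lit _).bind fun c m₂ hm₂ hc => ?_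
    have hj : j.val % m < m :=
      Nat.mod_lt _ (Nat.pos_of_mul_pos_left (Nat.zero_lt_of_lt j.isLt))
    refine (achieves_dot (List.finRange p) (fun r _ => hc r)
      (fun r _ => (hf r _ hj).mono (hm₁.trans hm₂))).mono (by simp) fun o _ _ ho => ?_
    rw [sum_range_mul_mul_pow_eq hw]
    rwa [← List.ofFn_eq_map, List.sum_ofFn] at ho
  · rw [dif_pos hj]
    exact hy ⟨j, hj⟩

theorem achieves_dft (l : List ℕ) (hl : ∀ p ∈ l, 1 ≤ p) {w : K} (hw : w ^ l.prod = 1)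
    {v : ℕ → ℕ} {x : ℕ → K} (hv : ∀ i < l.prod, HasVal mem (v i) (x i)) :
    Achieves True (dft l w v) mem (4 * l.prod * l.sum) fun y m =>
      ∀ j < l.prod, HasVal m (y j) (∑ i ∈ Finset.range l.prod, x i * w ^ (i * j)) := by
  induction l generalizing w v x mem with
  | nil =>
    refine Achieves.mono_cost (c := 0) (achieves_pure fun j hj => ?_) (by simp)
    obtain rfl : j = 0 := by simpa using hj
    simpa using hv 0 (by simp)
  | cons p l ih =>
    rw [List.prod_cons] at hw hv ⊢
    refine Achieves.mono_cost
      (c := p * (4 * l.prod * l.sum) + (p * l.prod : ℕ) * (3 * p + 1)) ?_ ?_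
    · refine (achieves_forFin (Q := fun (r : Fin p) (y : ℕ → ℕ) m => ∀ j < l.prod, HasVal m (y j)
        (∑ i ∈ Finset.range l.prod, x (p * i + r.val) * (w ^ p) ^ (i * j)))
        (fun r y m m' hm h j hj => (h j hj).mono hm) fun r m hm => ?_).bind
          fun f m _ hf => achieves_dftLayer hw hf
      refine ih (fun q hq => hl q (List.mem_cons_of_mem _ hq)) (by rw [← pow_mul, hw])
        fun i hi => (hv _ ?_).mono hm
      calc p * i + r.val < p * (i + 1) := by rw [mul_add_one]; have := r.isLt; omega
        _ ≤ p * l.prod := Nat.mul_le_mul_left _ hi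
    · have hp : (1 : ℝ) ≤ p := by exact_mod_cast hl p List.mem_cons_self
      have hprod : (0 : ℝ) ≤ (p : ℝ) * l.prod := by positivity
      rw [List.sum_cons, Nat.cast_mul, Nat.cast_add]
      nlinarith

end Programs

theorem interp_eq {N : ℕ} [NeZero (N : K)] {ζ : K} (hζ : IsPrimitiveRoot ζ N) (v : Fin N → K)
    (k : Fin N) :
    ∑ j : Fin N, (1 / (N : K) * ∑ i : Fin N, v i * ζ⁻¹ ^ (i.val * j.val)) *
      (ζ ^ k.val) ^ j.val = v k := by
  have hζ₀ : ζ ≠ 0 := hζ.ne_zero (NeZero.of_neZero_natCast K).out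
  have horth : ∀ i : Fin N, ∑ j : Fin N, (ζ⁻¹ ^ i.val * ζ ^ k.val) ^ j.val =
      if i = k then (N : K) else 0 := by
    intro i
    split_ifs with h
    · rw [h, ← mul_pow, inv_mul_cancel₀ hζ₀]
      simp
    · have hne : ζ⁻¹ ^ i.val * ζ ^ k.val ≠ 1 := by
        rw [inv_pow, ne_eq, inv_mul_eq_one₀ (pow_ne_zero _ hζ₀)]
        exact fun heq => h (Fin.ext (hζ.pow_inj i.isLt k.isLt heq))
      have hpow : (ζ⁻¹ ^ i.val * ζ ^ k.val) ^ N = 1 := by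
        rw [mul_pow, pow_right_comm, pow_right_comm ζ, inv_pow, hζ.pow_eq_one]
        simp
      have hgeom := mul_geom_sum (ζ⁻¹ ^ i.val * ζ ^ k.val) N
      rw [hpow, sub_self, Finset.sum_range] at hgeom
      exact (mul_eq_zero.1 hgeom).resolve_left (sub_ne_zero.2 hne)
  have hN := NeZero.ne (N : K)
  calc _ = 1 / (N : K) * ∑ i : Fin N, v i * ∑ j : Fin N, (ζ⁻¹ ^ i.val * ζ ^ k.val) ^ j.val := by
        simp only [Finset.mul_sum, Finset.sum_mul]
        rw [Finset.sum_comm]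
        refine Finset.sum_congr rfl fun i _ => Finset.sum_congr rfl fun j _ => ?_
        rw [mul_pow, ← pow_mul ζ⁻¹]
        ring
    _ = v k := by
        simp only [horth]
        simp [field]

/-- Interpolation at the `N`-th roots of unity, by an inverse Fourier transform in the mixed radix
given by the prime factors of `N`. -/
noncomputable def interpRoutine : SimpleRR.InterpRoutine ℂ := fun N h => do
  let y ← dft N.primeFactorsList (SimpleRR.rootOfUnity N)⁻¹
    fun i => if hi : i < N then h ⟨i, hi⟩ else 0
  let c ← lit (1 / (N : ℂ))
  forFin N fun j => mul c (y j)

theorem isPrimitiveRoot_rootOfUnity {N : ℕ} (hN : N ≠ 0) :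
    IsPrimitiveRoot (SimpleRR.rootOfUnity N) N := Complex.isPrimitiveRoot_exp N hN

theorem achieves_interpRoutine {N : ℕ} (hN : N ≠ 0) {h : Fin N → ℕ} {v : Fin N → ℂ}
    {mem : List ℂ} (hv : ∀ i, HasVal mem (h i) (v i)) :
    Achieves True (interpRoutine N h) mem (4 * N * N.primeFactorsList.sum + (1 + N)) fun a m =>
      ∀ j, HasVal m (a j)
        (1 / (N : ℂ) * ∑ i : Fin N, v i * (SimpleRR.rootOfUnity N)⁻¹ ^ (i.val * j.val)) := by
  have hprod := Nat.prod_primeFactorsList hN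
  refine Achieves.mono_cost (c := 4 * (N.primeFactorsList.prod : ℕ) * N.primeFactorsList.sum +
    (1 + N * 1)) ?_ (by rw [hprod]; linarith)
  refine (achieves_dft N.primeFactorsList (x := fun i => if hi : i < N then v ⟨i, hi⟩ else 0)
    (fun p hp => (Nat.prime_of_mem_primeFactorsList hp).one_le) ?_ fun i hi => ?_).bind
    fun y m₁ _ hy => ?_
  · rw [hprod, inv_pow, (isPrimitiveRoot_rootOfUnity hN).pow_eq_one, inv_one]
  · rw [hprod] at hi
    rw [dif_pos hi, dif_pos hi]
    exact hv _
  refine (achieves_lit (1 / (N : ℂ))).bind fun c m₂ hm₂ hc => ?_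
  refine achieves_forFin_hasVal fun j m hm => ?_
  refine (achieves_mul (hc.mono hm) ((hy j (by rw [hprod]; exact j.isLt)).mono
    (hm₂.trans hm))).mono le_rfl fun r m' _ hr => ?_
  rw [hprod, Finset.sum_range] at hr
  simpa using hr

theorem computesInterp_interpRoutine : SimpleRR.ComputesInterp interpRoutine := by
  intro N v h mem hv
  rcases eq_or_ne N 0 with rfl | hN
  · exact ⟨fun i => i.elim0, fun i => i.elim0, fun i => i.elim0⟩
  · have := NeZero.mk hN
    exact ⟨_, interp_eq (isPrimitiveRoot_rootOfUnity hN) v, (achieves_interpRoutine hN hv).post⟩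

theorem sum_le_prod_of_two_le (l : List ℕ) (hl : ∀ p ∈ l, 2 ≤ p) : l.sum ≤ l.prod := by
  induction l with
  | nil => simp
  | cons p l ih =>
    have hp := hl p List.mem_cons_self
    have ih := ih fun q hq => hl q (List.mem_cons_of_mem _ hq)
    rcases l with _ | ⟨q, l⟩
    · simp
    · have hq := hl q (by simp)
      have hprod : 2 ≤ (q :: l).prod := le_trans (by rw [List.sum_cons]; omega) ih
      rw [List.sum_cons, List.prod_cons]
      nlinarith

theorem sum_primeFactorsList_le {n : ℕ} (hn : n ≠ 0) : n.primeFactorsList.sum ≤ n := by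
  conv_rhs => rw [← Nat.prod_primeFactorsList hn]
  exact sum_le_prod_of_two_le _ fun p hp => (Nat.prime_of_mem_primeFactorsList hp).two_le

theorem sum_primeFactorsList_mul {a b : ℕ} (ha : a ≠ 0) (hb : b ≠ 0) :
    (a * b).primeFactorsList.sum = a.primeFactorsList.sum + b.primeFactorsList.sum := by
  rw [(Nat.perm_primeFactorsList_mul ha hb).sum_eq, List.sum_append]

end Interpolation

/-! ### The Hankel matrix of scaled moments -/

section ScaledMoment

variable {R S : Type*} [CommRing R] [CommRing S] {n : ℕ}

/-- The scaled moments `r_k = c_0^k m_k`, by the recursion of `SimpleRR.scaledMoments` with the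
values `u` of its registers. -/
def scaledMoment (n : ℕ) (u : Fin n → R) : ℕ → R
  | 0 => n
  | k + 1 => (∑ j : Fin n, if j.val < k then u j * scaledMoment n u (k - j.val) else 0) +
      if h : k < n then ((k : R) + 1) * u ⟨k, h⟩ else 0
  decreasing_by omega

theorem scaledMoment_zero (u : Fin n → R) : scaledMoment n u 0 = n := by
  rw [scaledMoment]

theorem scaledMoment_succ (u : Fin n → R) (k : ℕ) : scaledMoment n u (k + 1) =
    (∑ j : Fin n, if j.val < k then u j * scaledMoment n u (k - j.val) else 0) +
      if h : k < n then ((k : R) + 1) * u ⟨k, h⟩ else 0 := by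
  rw [scaledMoment]

theorem map_scaledMoment (f : R →+* S) (u : Fin n → R) (k : ℕ) :
    f (scaledMoment n u k) = scaledMoment n (fun j => f (u j)) k := by
  induction k using Nat.strong_induction_on with
  | _ k ih =>
    rcases k with _ | k
    · rw [scaledMoment_zero, scaledMoment_zero, map_natCast]
    · rw [scaledMoment_succ, scaledMoment_succ, map_add, map_sum]
      congr 1
      · refine Finset.sum_congr rfl fun j _ => ?_
        split_ifs
        · rw [map_mul, ih _ (by omega)]
        · rw [map_zero]
      · split_ifs
        · simp
        · rw [map_zero]

/-- The coefficient of `r_{k-j}` in Newton's identity for `r_{k+1}`, with the denominators cleared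
by powers of `c_0`. -/
def newtonCoeff (c : Fin (n + 1) → R) (j : Fin n) : R := (-1) ^ j.val * c j.succ * c 0 ^ j.val

/-- The Hankel matrix `H` as a polynomial expression in `c_0, …, c_n`. -/
def hankelMat (c : Fin (n + 1) → R) : Matrix (Fin n) (Fin n) R :=
  Matrix.of fun a b =>
    c 0 ^ (SimpleRR.nu n - (a.val + b.val)) * scaledMoment n (newtonCoeff c) (a.val + b.val)

theorem map_newtonCoeff (f : R →+* S) (c : Fin (n + 1) → R) (j : Fin n) :
    f (newtonCoeff c j) = newtonCoeff (fun k => f (c k)) j := by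
  simp [newtonCoeff]

theorem hankelMat_map (f : R →+* S) (c : Fin (n + 1) → R) :
    (hankelMat c).map f = hankelMat fun k => f (c k) := by
  ext a b
  simp [hankelMat, map_scaledMoment, map_newtonCoeff]

variable {ι : Type*} [Fintype ι] [DecidableEq ι]

/-- The sum `e_k(A)` of the principal minors of size `k`; over `ℂ` it agrees definitionally with
`sumPrincipalMinors`. -/
def minorSum (k : ℕ) (A : Matrix ι ι R) : R :=
  ∑ s ∈ (Finset.univ : Finset ι).powersetCard k,
    (A.submatrix (Subtype.val : s → ι) (Subtype.val : s → ι)).det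

theorem map_minorSum (f : R →+* S) (k : ℕ) (A : Matrix ι ι R) :
    f (minorSum k A) = minorSum k (A.map f) := by
  rw [minorSum, minorSum, map_sum]
  refine Finset.sum_congr rfl fun s _ => ?_
  rw [RingHom.map_det]
  rfl

theorem charpoly_coeff_eq_minorSum (A : Matrix ι ι R) {k : ℕ} (hk : k ≤ Fintype.card ι) :
    A.charpoly.coeff (Fintype.card ι - k) = (-1) ^ k * minorSum k A :=
  A.charpoly_coeff_eq_sum_minors k hk

theorem minorSum_eq_charpoly_coeff (A : Matrix ι ι R) {k : ℕ} (hk : k ≤ Fintype.card ι) :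
    minorSum k A = (-1) ^ k * A.charpoly.coeff (Fintype.card ι - k) := by
  rw [charpoly_coeff_eq_minorSum A hk, ← mul_assoc, ← pow_add, Even.neg_one_pow ⟨_, rfl⟩, one_mul]

end ScaledMoment

namespace SimpleRR

theorem le_nu (n : ℕ) : n ≤ nu n := by
  have := le_max_left ((n + 1) / 2) (n - 1)
  simp only [nu]
  omega

theorem two_mul_sub_le_nu (n : ℕ) : 2 * n - 2 ≤ nu n := by
  have := le_max_right ((n + 1) / 2) (n - 1)
  simp only [nu]
  omega

theorem nu_le (n : ℕ) : nu n ≤ 2 * n := by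
  have : max ((n + 1) / 2) (n - 1) ≤ n := max_le (by omega) (by omega)
  simp only [nu]
  omega

end SimpleRR

section NatDegree

variable {R : Type*} [CommRing R] {n d : ℕ}

theorem natDegree_scaledMoment_le {u : Fin n → R[X]}
    (hu : ∀ j, (u j).natDegree ≤ d * (j.val + 1)) (k : ℕ) :
    (scaledMoment n u k).natDegree ≤ d * k := by
  induction k using Nat.strong_induction_on with
  | _ k ih =>
    rcases k with _ | k
    · simp [scaledMoment_zero]
    · rw [scaledMoment_succ]
      refine natDegree_add_le_of_degree_le (natDegree_sum_le_of_forall_le _ _ fun j _ => ?_) ?_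
      · split_ifs with h
        · refine (natDegree_mul_le_of_le (hu j) (ih _ (by omega))).trans ?_
          rw [← mul_add]
          exact Nat.mul_le_mul_left _ (by omega)
        · simp
      · split_ifs with h
        · have hcast : ((k : R[X]) + 1).natDegree = 0 := by exact_mod_cast natDegree_natCast (k + 1)
          simpa using natDegree_mul_le_of_le hcast.le (hu ⟨k, h⟩)
        · simp

theorem natDegree_newtonCoeff_le {c : Fin (n + 1) → R[X]} (hc : ∀ k, (c k).natDegree ≤ d)
    (j : Fin n) : (newtonCoeff c j).natDegree ≤ d * (j.val + 1) := by
  have hsign : ((-1 : R[X]) ^ j.val).natDegree = 0 := by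
    rcases neg_one_pow_eq_or R[X] j.val with h | h <;> simp [h]
  calc _ ≤ 0 + d + j.val * d := natDegree_mul_le_of_le (natDegree_mul_le_of_le hsign.le (hc _))
        (natDegree_pow_le_of_le _ (hc 0))
    _ = d * (j.val + 1) := by ring

theorem natDegree_hankelMat_le {c : Fin (n + 1) → R[X]} (hc : ∀ k, (c k).natDegree ≤ d)
    (a b : Fin n) : (hankelMat c a b).natDegree ≤ d * SimpleRR.nu n := by
  have hν := SimpleRR.two_mul_sub_le_nu n
  refine (natDegree_mul_le_of_le (natDegree_pow_le_of_le _ (hc 0))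
    (natDegree_scaledMoment_le (natDegree_newtonCoeff_le hc) _)).trans ?_
  rw [mul_comm, ← mul_add]
  exact Nat.mul_le_mul_left _ (by omega)

theorem natDegree_det_le {ι : Type*} [Fintype ι] [DecidableEq ι] {A : Matrix ι ι R[X]} {e : ℕ}
    (hA : ∀ i j, (A i j).natDegree ≤ e) : A.det.natDegree ≤ Fintype.card ι * e := by
  rw [Matrix.det_apply]
  refine natDegree_sum_le_of_forall_le _ _ fun σ _ => ?_
  refine (natDegree_smul_le _ _).trans ((natDegree_prod_le _ _).trans ?_)
  exact Finset.sum_le_card_nsmul _ _ e fun i _ => hA _ _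

theorem natDegree_minorSum_le {ι : Type*} [Fintype ι] [DecidableEq ι] {A : Matrix ι ι R[X]} {e : ℕ}
    (hA : ∀ i j, (A i j).natDegree ≤ e) (k : ℕ) : (minorSum k A).natDegree ≤ k * e := by
  refine natDegree_sum_le_of_forall_le _ _ fun s hs => ?_
  refine (natDegree_det_le fun i j => hA _ _).trans_eq ?_
  rw [Fintype.card_coe, (Finset.mem_powersetCard.1 hs).2]

theorem natDegree_minorSum_hankelMat_le {c : Fin (n + 1) → R[X]} (hc : ∀ k, (c k).natDegree ≤ d)
    {k : ℕ} (hk : k ≤ n) : (minorSum k (hankelMat c)).natDegree ≤ n * (d * SimpleRR.nu n) :=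
  (natDegree_minorSum_le (natDegree_hankelMat_le hc) k).trans (Nat.mul_le_mul_right _ hk)

theorem natDegree_minorSum_hankelMat_lt_numPoints {c : Fin (n + 1) → R[X]}
    (hc : ∀ k, (c k).natDegree ≤ d) (hn : n ≠ 0) {k : ℕ} (hk : k ≤ n) :
    (minorSum k (hankelMat c)).natDegree < SimpleRR.numPoints n d := by
  refine (natDegree_minorSum_hankelMat_le hc hk).trans_lt ?_
  have hν := SimpleRR.le_nu n
  rw [SimpleRR.numPoints, mul_assoc]
  refine Nat.mul_lt_mul_of_pos_left ?_ (Nat.pos_of_ne_zero hn)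
  calc d * SimpleRR.nu n < (d + 1) * SimpleRR.nu n :=
        Nat.mul_lt_mul_of_pos_right (Nat.lt_succ_self d) (by omega)
    _ ≤ _ := Nat.mul_le_mul_left _ (by omega)

end NatDegree

/-! ### Correctness and cost of the main loop -/

section Loop

variable {K : Type} [Field K] [DecidableEq K] {t : Prop} {mem : List K} {n d : ℕ}

theorem sum_map_filter_eq_sum_map_ite {X M : Type*} [AddMonoid M] (l : List X) (p : X → Prop)
    [DecidablePred p] (f : X → M) :
    ((l.filter fun x => p x).map f).sum = (l.map fun x => if p x then f x else 0).sum := by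
  induction l with
  | nil => simp
  | cons a l ih => by_cases h : p a <;> simp [h, ih]

theorem achieves_dot_scaledMoment {u : Fin n → ℕ} {x : Fin n → K}
    (hu : ∀ j, HasVal mem (u j) (x j)) {r : List ℕ} {k : ℕ}
    (hr : HoldsUpTo mem r (scaledMoment n x) k) :
    Achieves t (dot (((List.finRange n).filter fun j => j.val < k).map
      fun j => (u j, r.getD (k - j.val) 0))) mem (2 * n + 1) fun s m =>
        HasVal m s (∑ j : Fin n, if j.val < k then x j * scaledMoment n x (k - j.val) else 0) := by
  refine (achieves_dot _ (x := x) (y := fun j => scaledMoment n x (k - j.val))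
    (fun j _ => hu j) fun j _ => hr.hasVal _ (by omega)).mono ?_ fun s m _ hs => ?_
  · have hlen : ((List.finRange n).filter fun j => j.val < k).length ≤ n :=
      (List.length_filter_le _ _).trans_eq (List.length_finRange ..)
    gcongr
  · rwa [sum_map_filter_eq_sum_map_ite, ← List.ofFn_eq_map, List.sum_ofFn] at hs

theorem achieves_scaledMoments {u : Fin n → ℕ} {x : Fin n → K}
    (hu : ∀ j, HasVal mem (u j) (x j)) (k : ℕ) :
    Achieves t (SimpleRR.scaledMoments n u k) mem (1 + k * (2 * n + 4)) fun r m =>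
      HoldsUpTo m r (scaledMoment n x) k := by
  induction k with
  | zero =>
    refine Achieves.mono_cost (c := 1 + 0) ?_ (by simp)
    exact (achieves_lit _).bind fun h m _ hh =>
      achieves_pure (.singleton (by rwa [scaledMoment_zero]))
  | succ k ih =>
    refine Achieves.mono_cost (c := (1 + k * (2 * n + 4)) + ((2 * n + 1) + (3 + 0))) ?_
      (by push_cast; linarith)
    refine ih.bind fun r m₁ hm₁ hr => ?_
    refine (achieves_dot_scaledMoment (fun j => (hu j).mono hm₁) hr).bind fun s m₂ hm₂ hs => ?_
    have happend : ∀ y m₃, m₂ <+: m₃ → HasVal m₃ y (scaledMoment n x (k + 1)) →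
        Achieves t (pure (r ++ [y])) m₃ 0 fun r m => HoldsUpTo m r (scaledMoment n x) (k + 1) :=
      fun y m₃ hm₃ hy => achieves_pure (hr.append (hm₂.trans hm₃) hy)
    rw [scaledMoment_succ] at happend
    dsimp only
    split_ifs with h
    · rw [dif_pos h] at happend
      refine Achieves.mono_cost (c := 1 + (1 + (1 + 0))) ?_ (by norm_num)
      refine (achieves_lit _).bind fun a m hm ha => ?_
      refine (achieves_mul ha ((hu ⟨k, h⟩).mono ((hm₁.trans hm₂).trans hm))).bind
        fun w m' hm' hw => ?_
      exact (achieves_add (hs.mono (hm.trans hm')) hw).bind fun y m'' hm'' hy =>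
        happend y m'' ((hm.trans hm').trans hm'') hy
    · rw [dif_neg h, add_zero] at happend
      refine Achieves.mono_cost (c := 0 + 0) ?_ (by norm_num)
      exact (achieves_pure hs).bind fun y m hm hy => happend y m hm hy

/-- A bound for the cost of the Hankel matrix at one sample point. -/
def hankelCost (n d : ℕ) : ℝ :=
  1 + ((n + 1 : ℕ) * (2 * (d + 1 : ℕ) + 1) + ((SimpleRR.nu n + 1) + (n * 3 +
    ((1 + (2 * n - 2 : ℕ) * (2 * n + 4)) + ((2 * n - 1 : ℕ) * 1 + 0)))))

theorem achieves_hankelProg {h : Fin (n + 1) → Fin (d + 1) → ℕ}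
    {a : Fin (n + 1) → Fin (d + 1) → K} (ha : ∀ k j, HasVal mem (h k j) (a k j)) (s : K) :
    Achieves t (SimpleRR.hankelProg n d h s) mem (hankelCost n d) fun H m =>
      RegMat m H (hankelMat fun k => ∑ j, a k j * s ^ j.val) := by
  set c : Fin (n + 1) → K := fun k => ∑ j, a k j * s ^ j.val
  have hν := SimpleRR.le_nu n
  refine (achieves_lit s).bind fun x m₁ hm₁ hx => ?_
  refine (achieves_forFin_hasVal (v := c) fun k m hm => achieves_horner_ofFn (hx.mono hm)
    fun j => (ha k j).mono (hm₁.trans hm)).bind fun cv m₂ _ hcv => ?_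
  refine (achieves_powers (hcv 0) (SimpleRR.nu n)).bind fun pw m₃ hm₃ hpw => ?_
  refine (achieves_forFin_hasVal (v := newtonCoeff c) fun j m hm => ?_).bind
    fun u m₄ hm₄ hu => ?_
  · refine Achieves.mono_cost (c := 1 + (1 + 1)) ?_ (by norm_num)
    refine (achieves_lit _).bind fun sg m' hm' hsg => ?_
    refine (achieves_mul hsg ((hcv j.succ).mono ((hm₃.trans hm).trans hm'))).bind
      fun w m'' hm'' hw => ?_
    exact achieves_mul hw ((hpw.hasVal j.val (by omega)).mono ((hm.trans hm').trans hm''))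
  refine (achieves_scaledMoments hu (2 * n - 2)).bind fun r m₅ hm₅ hr => ?_
  refine (achieves_forFin_hasVal (v := fun j : Fin (2 * n - 1) =>
    c 0 ^ (SimpleRR.nu n - j.val) * scaledMoment n (newtonCoeff c) j.val) fun j m hm => ?_).bind
      fun h m _ hh => achieves_pure fun i j => hh _
  exact achieves_mul ((hpw.hasVal _ (by omega)).mono ((hm₄.trans hm₅).trans hm))
    ((hr.hasVal j.val (by omega)).mono hm)

variable {charpolyR : SimpleRR.CharpolyRoutine K} {interpR : SimpleRR.InterpRoutine K} {T T' : ℝ}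

theorem achieves_sampleProg
    (hR : ∀ (A : Matrix (Fin n) (Fin n) K) (h : Fin n → Fin n → ℕ) (mem : List K),
      RegMat mem h A → Achieves t (charpolyR n h) mem T fun f m =>
        ∀ j, HasVal m (f j) (A.charpoly.coeff j))
    {h : Fin (n + 1) → Fin (d + 1) → ℕ} {a : Fin (n + 1) → Fin (d + 1) → K}
    (ha : ∀ k j, HasVal mem (h k j) (a k j)) (s : K) :
    Achieves t (SimpleRR.sampleProg charpolyR n d h s) mem (hankelCost n d + (T + n * 2))
      fun e m => ∀ k : Fin n, HasVal m (e k)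
        (minorSum (k.val + 1) (hankelMat fun k => ∑ j, a k j * s ^ j.val)) := by
  refine (achieves_hankelProg ha s).bind fun H m₁ _ hH => ?_
  refine (hR _ _ _ hH).bind fun f m₂ _ hf => ?_
  refine achieves_forFin_hasVal fun k m hm => ?_
  refine Achieves.mono_cost (c := 1 + 1) ?_ (by norm_num)
  refine (achieves_lit _).bind fun sg m' hm' hsg => ?_
  rw [minorSum_eq_charpoly_coeff _ (by simp), Fintype.card_fin]
  exact achieves_mul hsg ((hf _).mono (hm.trans hm'))

theorem achieves_progWith {N : ℕ} {ζ : K}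
    (hR : ∀ (A : Matrix (Fin n) (Fin n) K) (h : Fin n → Fin n → ℕ) (mem : List K),
      RegMat mem h A → Achieves t (charpolyR n h) mem T fun f m =>
        ∀ j, HasVal m (f j) (A.charpoly.coeff j))
    (hI : ∀ (v : Fin N → K) (h : Fin N → ℕ) (mem : List K), (∀ i, HasVal mem (h i) (v i)) →
      Achieves t (interpR N h) mem T' fun f m => ∃ b : Fin N → K,
        (∀ i : Fin N, ∑ j : Fin N, b j * (ζ ^ i.val) ^ j.val = v i) ∧ ∀ j, HasVal m (f j) (b j))
    {h : Fin (n + 1) → Fin (d + 1) → ℕ} {a : Fin (n + 1) → Fin (d + 1) → K}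
    (ha : ∀ k j, HasVal mem (h k j) (a k j)) :
    Achieves t (SimpleRR.progWith charpolyR interpR N ζ n d h) mem
      (N * (hankelCost n d + (T + n * 2)) + n * T')
      fun f m => ∀ k : Fin n, ∃ b : Fin N → K, (∀ i : Fin N, ∑ j : Fin N, b j *
        (ζ ^ i.val) ^ j.val = minorSum (k.val + 1)
          (hankelMat fun k => ∑ j, a k j * (ζ ^ i.val) ^ j.val)) ∧ ∀ j, HasVal m (f k j) (b j) := by
  refine (achieves_forFin (Q := fun (i : Fin N) (e : Fin n → ℕ) m => ∀ k : Fin n, HasVal m (e k)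
    (minorSum (k.val + 1) (hankelMat fun k => ∑ j, a k j * (ζ ^ i.val) ^ j.val)))
    (fun i e m m' hm h k => (h k).mono hm) fun i m hm => achieves_sampleProg hR
      (fun k j => (ha k j).mono hm) _).bind fun e m₁ _ he => ?_
  refine achieves_forFin (fun k f m m' hm ⟨b, hb, hf⟩ => ⟨b, hb, fun j => (hf j).mono hm⟩)
    fun k m hm => hI _ _ _ fun i => (he i k).mono hm

end Loop

/-! ### Hermite's criterion for real-rootedness -/

section AltPoly

variable {R S : Type*} [CommRing R] [CommRing S] {n : ℕ}

/-- `∑ (-1)^k v_k x^(n-k)`, the shape of the members of `family`. -/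
noncomputable def altPoly (v : Fin (n + 1) → R) : R[X] :=
  ∑ k : Fin (n + 1), C ((-1) ^ k.val * v k) * X ^ (n - k.val)

theorem map_altPoly (f : R →+* S) (v : Fin (n + 1) → R) :
    (altPoly v).map f = altPoly fun k => f (v k) := by
  simp [altPoly, Polynomial.map_sum]

theorem coeff_altPoly (v : Fin (n + 1) → R) (k : Fin (n + 1)) :
    (altPoly v).coeff (n - k.val) = (-1) ^ k.val * v k := by
  rw [altPoly, finsetSum_coeff, Finset.sum_eq_single k]
  · rw [coeff_C_mul_X_pow, if_pos rfl]
  · intro j _ hj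
    rw [coeff_C_mul_X_pow, if_neg]
    exact fun h => hj (Fin.ext (by omega))
  · simp

theorem natDegree_altPoly {v : Fin (n + 1) → R} (hv : v 0 ≠ 0) : (altPoly v).natDegree = n := by
  refine le_antisymm (natDegree_sum_le_of_forall_le _ _ fun _ _ =>
    (natDegree_C_mul_X_pow_le _ _).trans (Nat.sub_le _ _)) (le_natDegree_of_ne_zero ?_)
  simpa using (coeff_altPoly v 0).trans_ne (by simpa using hv)

theorem leadingCoeff_altPoly {v : Fin (n + 1) → R} (hv : v 0 ≠ 0) :
    (altPoly v).leadingCoeff = v 0 := by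
  simpa [leadingCoeff, natDegree_altPoly hv] using coeff_altPoly v 0

theorem exists_roots_altPoly_eq_map {K : Type*} [Field K] [IsAlgClosed K] {v : Fin (n + 1) → K}
    (hv : v 0 ≠ 0) : ∃ x : Fin n → K, (altPoly v).roots = Finset.univ.val.map x := by
  have hcard : (altPoly v).roots.card = n := by
    rw [← (IsAlgClosed.splits _).natDegree_eq_card_roots, natDegree_altPoly hv]
  generalize (altPoly v).roots = s at hcard
  subst hcard
  induction s using Quotient.inductionOn with
  | _ l => exact ⟨l.get, (congrArg _ (List.map_get_finRange l)).symm⟩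

theorem altPoly_eq_mul_prod {K : Type*} [Field K] [IsAlgClosed K] {v : Fin (n + 1) → K}
    (hv : v 0 ≠ 0) {x : Fin n → K} (hx : (altPoly v).roots = Finset.univ.val.map x) :
    altPoly v = C (v 0) * ∏ i, (X - C (x i)) := by
  conv_lhs => rw [(IsAlgClosed.splits (altPoly v)).eq_prod_roots, leadingCoeff_altPoly hv, hx]
  rw [Multiset.map_map]
  rfl

theorem eq_mul_aeval_esymm {v : Fin (n + 1) → R} {x : Fin n → R}
    (hx : altPoly v = C (v 0) * ∏ i, (X - C (x i))) (k : Fin (n + 1)) :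
    v k = v 0 * MvPolynomial.aeval x (MvPolynomial.esymm (Fin n) R k.val) := by
  have hcard : Multiset.card (Finset.univ.val.map x) = n := by simp
  have hcoeff : (∏ i, (X - C (x i))).coeff (n - k.val) =
      (-1) ^ k.val * MvPolynomial.aeval x (MvPolynomial.esymm (Fin n) R k.val) := by
    have h := Multiset.prod_X_sub_C_coeff (Finset.univ.val.map x) (k := n - k.val) (by simp)
    rw [hcard, Nat.sub_sub_self (by omega), Multiset.map_map] at h
    rw [MvPolynomial.aeval_esymm_eq_multiset_esymm]
    exact h
  have h := coeff_altPoly v k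
  rw [hx, coeff_C_mul, hcoeff, mul_left_comm] at h
  exact ((isUnit_one.neg.pow _).mul_left_cancel h).symm

end AltPoly

section Newton

variable {R : Type*} [CommRing R] {n : ℕ}

theorem sum_pow_succ_eq (x : Fin n → R) (k : ℕ) :
    ∑ i, x i ^ (k + 1) = (∑ j ∈ Finset.range k, (-1) ^ j *
      MvPolynomial.aeval x (MvPolynomial.esymm (Fin n) R (j + 1)) * ∑ i, x i ^ (k - j)) +
      (-1) ^ k * (k + 1) * MvPolynomial.aeval x (MvPolynomial.esymm (Fin n) R (k + 1)) := by
  have hpsum : ∀ j, MvPolynomial.aeval x (MvPolynomial.psum (Fin n) R j) = ∑ i, x i ^ j := by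
    simp [MvPolynomial.psum]
  have hnewton := congrArg (MvPolynomial.aeval x)
    (MvPolynomial.psum_eq_mul_esymm_sub_sum (Fin n) R (k + 1) (Nat.succ_pos k))
  rw [Finset.sum_filter, Finset.Nat.sum_antidiagonal_eq_sum_range_succ_mk,
    Finset.sum_range_succ, Finset.sum_range_succ'] at hnewton
  simp only [map_sub, map_mul, map_sum, hpsum, map_pow, map_neg, map_one, map_natCast,
    Set.mem_Ioo, lt_self_iff_false, and_false, if_false, false_and, add_zero] at hnewton
  have hsum : ∑ j ∈ Finset.range k, (MvPolynomial.aeval x)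
      (if 0 < j + 1 ∧ j + 1 < k + 1 then (-1) ^ (j + 1) * MvPolynomial.esymm (Fin n) R (j + 1) *
        MvPolynomial.psum (Fin n) R (k + 1 - (j + 1)) else 0) =
      -∑ j ∈ Finset.range k, (-1) ^ j *
        MvPolynomial.aeval x (MvPolynomial.esymm (Fin n) R (j + 1)) * ∑ i, x i ^ (k - j) := by
    rw [← Finset.sum_neg_distrib]
    refine Finset.sum_congr rfl fun j hj => ?_
    rw [if_pos ⟨by omega, by have := Finset.mem_range.1 hj; omega⟩, Nat.add_sub_add_right]
    simp only [map_mul, map_pow, map_neg, map_one, hpsum]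
    ring
  rw [hnewton, hsum]
  push_cast
  ring

theorem aeval_esymm_eq_zero (x : Fin n → R) {k : ℕ} (hk : n < k) :
    MvPolynomial.aeval x (MvPolynomial.esymm (Fin n) R k) = 0 := by
  rw [MvPolynomial.esymm, Finset.powersetCard_eq_empty.2 (by simpa using hk)]
  simp

theorem sum_range_eq_sum_fin_ite {M : Type*} [AddCommMonoid M] {f : ℕ → M}
    (hf : ∀ j, n ≤ j → f j = 0) (k : ℕ) :
    ∑ j ∈ Finset.range k, f j = ∑ j : Fin n, if j.val < k then f j else 0 := by
  rw [Fin.sum_univ_eq_sum_range (fun j => if j < k then f j else 0), ← Finset.sum_filter]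
  refine (Finset.sum_subset (fun j hj => ?_) fun j hj hj' => hf j ?_).symm
  · exact Finset.mem_range.2 (Finset.mem_filter.1 hj).2
  · by_contra! hlt
    exact hj' (Finset.mem_filter.2 ⟨Finset.mem_range.2 hlt, Finset.mem_range.1 hj⟩)

theorem scaledMoment_aeval_esymm (x : Fin n → R) (k : ℕ) :
    scaledMoment n (fun j => (-1) ^ j.val *
      MvPolynomial.aeval x (MvPolynomial.esymm (Fin n) R (j.val + 1))) k = ∑ i, x i ^ k := by
  induction k using Nat.strong_induction_on with
  | _ k ih =>
    rcases k with _ | k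
    · simp [scaledMoment_zero]
    · rw [scaledMoment_succ, sum_pow_succ_eq, sum_range_eq_sum_fin_ite (f := fun j => (-1) ^ j *
        MvPolynomial.aeval x (MvPolynomial.esymm (Fin n) R (j + 1)) * ∑ i, x i ^ (k - j))
        fun j hj => by rw [aeval_esymm_eq_zero x (Nat.lt_succ_of_le hj), mul_zero, zero_mul]]
      congr 1
      · refine Finset.sum_congr rfl fun j _ => ?_
        split_ifs
        · rw [ih _ (by omega)]
        · rfl
      · split_ifs with h
        · ring
        · rw [aeval_esymm_eq_zero x (by omega), mul_zero]

theorem scaledMoment_pow_mul (r : R) (u : Fin n → R) (k : ℕ) :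
    scaledMoment n (fun j => r ^ (j.val + 1) * u j) k = r ^ k * scaledMoment n u k := by
  induction k using Nat.strong_induction_on with
  | _ k ih =>
    rcases k with _ | k
    · simp [scaledMoment_zero]
    · rw [scaledMoment_succ, scaledMoment_succ, mul_add, Finset.mul_sum]
      congr 1
      · refine Finset.sum_congr rfl fun j _ => ?_
        split_ifs
        · rw [ih _ (by omega), mul_mul_mul_comm, ← pow_add]
          congr 2
          omega
        · rw [mul_zero]
      · split_ifs
        · ring
        · rw [mul_zero]

variable {v : Fin (n + 1) → R} {x : Fin n → R}

theorem scaledMoment_newtonCoeff (hx : altPoly v = C (v 0) * ∏ i, (X - C (x i))) (k : ℕ) :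
    scaledMoment n (newtonCoeff v) k = v 0 ^ k * ∑ i, x i ^ k := by
  rw [← scaledMoment_aeval_esymm, ← scaledMoment_pow_mul]
  congr 1
  ext j
  rw [newtonCoeff, eq_mul_aeval_esymm hx j.succ, Fin.val_succ]
  ring

theorem hankelMat_eq_smul_vandermonde (hx : altPoly v = C (v 0) * ∏ i, (X - C (x i))) :
    hankelMat v =
      v 0 ^ SimpleRR.nu n • ((Matrix.vandermonde x).transpose * Matrix.vandermonde x) := by
  ext a b
  have hν := SimpleRR.two_mul_sub_le_nu n
  rw [hankelMat, Matrix.of_apply, scaledMoment_newtonCoeff hx, ← mul_assoc, ← pow_add,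
    Nat.sub_add_cancel (by omega), Matrix.smul_apply, Matrix.vandermonde_transpose_mul_vandermonde,
    smul_eq_mul]

theorem dotProduct_hankelMat_mulVec (hx : altPoly v = C (v 0) * ∏ i, (X - C (x i)))
    (y : Fin n → R) :
    y ⬝ᵥ (hankelMat v).mulVec y =
      v 0 ^ SimpleRR.nu n * ∑ i, (∑ a : Fin n, y a * x i ^ a.val) ^ 2 := by
  rw [hankelMat_eq_smul_vandermonde hx, Matrix.smul_mulVec, dotProduct_smul, smul_eq_mul,
    ← Matrix.mulVec_mulVec, Matrix.dotProduct_mulVec, Matrix.vecMul_transpose]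
  simp only [dotProduct, Matrix.mulVec, Matrix.vandermonde_apply, ← sq, mul_comm]

end Newton

section Hermite

variable {n : ℕ} {v : Fin (n + 1) → ℝ} {x : Fin n → ℂ}

theorem exists_altPoly_ofReal_eq_mul_prod (hv : v 0 ≠ 0) : ∃ x : Fin n → ℂ,
    altPoly (fun k => (v k : ℂ)) = C (v 0 : ℂ) * ∏ i, (X - C (x i)) := by
  have hv' : (v 0 : ℂ) ≠ 0 := by exact_mod_cast hv
  obtain ⟨x, hx⟩ := exists_roots_altPoly_eq_map (v := fun k => (v k : ℂ)) hv'
  exact ⟨x, altPoly_eq_mul_prod hv' hx⟩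

theorem aeval_altPoly (hx : altPoly (fun k => (v k : ℂ)) = C (v 0 : ℂ) * ∏ i, (X - C (x i)))
    (z : ℂ) : aeval z (altPoly v) = (v 0 : ℂ) * ∏ i, (z - x i) := by
  rw [← eval_map_algebraMap, map_altPoly, Complex.coe_algebraMap, hx]
  simp [eval_prod]

theorem aeval_altPoly_eq_zero_iff (hv : v 0 ≠ 0)
    (hx : altPoly (fun k => (v k : ℂ)) = C (v 0 : ℂ) * ∏ i, (X - C (x i))) {z : ℂ} :
    aeval z (altPoly v) = 0 ↔ ∃ i, x i = z := by
  simp [aeval_altPoly hx, hv, Finset.prod_eq_zero_iff, sub_eq_zero, eq_comm (a := z)]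

theorem realRooted_altPoly_iff (hv : v 0 ≠ 0)
    (hx : altPoly (fun k => (v k : ℂ)) = C (v 0 : ℂ) * ∏ i, (X - C (x i))) :
    RealRooted (altPoly v) ↔ ∀ i, (x i).im = 0 := by
  have hne : altPoly v ≠ 0 := fun h => hv (by rw [← leadingCoeff_altPoly hv, h, leadingCoeff_zero])
  simp [RealRooted, hne, aeval_altPoly_eq_zero_iff hv hx]

theorem isHermitian_hankelMat (v : Fin (n + 1) → ℝ) : (hankelMat v).IsHermitian := by
  refine Matrix.IsHermitian.ext fun i j => ?_
  simp only [hankelMat, Matrix.of_apply, star_trivial, add_comm]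

theorem pow_nu_pos (n : ℕ) {r : ℝ} (hr : r ≠ 0) : 0 < r ^ SimpleRR.nu n :=
  (even_two_mul _).pow_pos hr

theorem posSemidef_hankelMat (hv : v 0 ≠ 0) (h : RealRooted (altPoly v)) :
    (hankelMat v).PosSemidef := by
  obtain ⟨x, hx⟩ := exists_altPoly_ofReal_eq_mul_prod hv
  have hre : ∀ i, x i = ((x i).re : ℂ) := fun i =>
    Complex.ext rfl ((realRooted_altPoly_iff hv hx).1 h i)
  have hx' : altPoly v = C (v 0) * ∏ i, (X - C (x i).re) := by
    refine Polynomial.map_injective Complex.ofRealHom Complex.ofReal_injective ?_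
    simpa [map_altPoly, Polynomial.map_prod, ← hre] using hx
  rw [hankelMat_eq_smul_vandermonde hx', ← Matrix.conjTranspose_eq_transpose_of_trivial]
  exact (Matrix.posSemidef_conjTranspose_mul_self _).smul (pow_nu_pos n hv).le

theorem exists_root_eq_conj (hv : v 0 ≠ 0)
    (hx : altPoly (fun k => (v k : ℂ)) = C (v 0 : ℂ) * ∏ i, (X - C (x i))) (i : Fin n) :
    ∃ j, x j = (starRingEnd ℂ) (x i) := by
  rw [← aeval_altPoly_eq_zero_iff hv hx, aeval_conj,
    (aeval_altPoly_eq_zero_iff hv hx).2 ⟨i, rfl⟩, map_zero]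

theorem exists_interpolant {K : Type*} [Field K] (x : Fin n → K) (φ : K → K) :
    ∃ y : Fin n → K, ∀ i, ∑ a : Fin n, y a * x i ^ a.val = φ (x i) := by
  classical
  set s : Finset K := Finset.univ.image x
  set g : K[X] := Lagrange.interpolate s id φ
  have hinj : Set.InjOn (id : K → K) s := Function.injective_id.injOn
  have hcard : s.card ≤ n := by simpa using Finset.card_image_le (s := Finset.univ) (f := x)
  have hdeg : g.degree < n :=
    (Lagrange.degree_interpolate_lt φ hinj).trans_le (by exact_mod_cast hcard)
  refine ⟨fun a => g.coeff a.val, fun i => ?_⟩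
  rw [Fin.sum_univ_eq_sum_range (fun a => g.coeff a * x i ^ a) n,
    ← Lagrange.eval_interpolate_at_node φ hinj (Finset.mem_image_of_mem x (Finset.mem_univ i))]
  rcases eq_or_ne g 0 with hg | hg
  · simp [g, hg]
  · exact (eval_eq_sum_range' ((natDegree_lt_iff_degree_lt hg).2 hdeg) _).symm

theorem exists_real_interpolant (hx : ∀ i, ∃ j, x j = (starRingEnd ℂ) (x i)) {φ : ℂ → ℂ}
    (hφ : ∀ z, φ ((starRingEnd ℂ) z) = (starRingEnd ℂ) (φ z)) :
    ∃ y : Fin n → ℝ, ∀ i, ∑ a : Fin n, (y a : ℂ) * x i ^ a.val = φ (x i) := by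
  obtain ⟨g, hg⟩ := exists_interpolant x φ
  refine ⟨fun a => (g a).re, fun i => ?_⟩
  have hconj : ∑ a : Fin n, (starRingEnd ℂ) (g a) * x i ^ a.val = φ (x i) := by
    obtain ⟨j, hj⟩ := hx i
    have h := congrArg (starRingEnd ℂ) (hg j)
    rw [hj, hφ, Complex.conj_conj, map_sum] at h
    simpa using h
  have havg : ∀ a : Fin n, (((g a).re : ℝ) : ℂ) * x i ^ a.val =
      (g a * x i ^ a.val + (starRingEnd ℂ) (g a) * x i ^ a.val) / 2 := fun a => by
    rw [← add_mul, Complex.add_conj]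
    push_cast
    ring
  simp only [havg]
  rw [← Finset.sum_div, Finset.sum_add_distrib, hconj, hg]
  ring

-- The quadratic form of `H` takes the value `-c_0^ν ∑ (im x_i)^2` at the coefficient vector of a
-- real polynomial that interpolates `z ↦ i im z` at the roots.
theorem realRooted_of_posSemidef (hv : v 0 ≠ 0) (h : (hankelMat v).PosSemidef) :
    RealRooted (altPoly v) := by
  obtain ⟨x, hx⟩ := exists_altPoly_ofReal_eq_mul_prod hv
  obtain ⟨y, hy⟩ := exists_real_interpolant (exists_root_eq_conj hv hx)
    (φ := fun z => z.im * Complex.I) (by simp)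
  have hform : y ⬝ᵥ (hankelMat v).mulVec y = v 0 ^ SimpleRR.nu n * -∑ i, (x i).im ^ 2 := by
    apply Complex.ofReal_injective
    have hmap : ((y ⬝ᵥ (hankelMat v).mulVec y : ℝ) : ℂ) =
        (fun a => (y a : ℂ)) ⬝ᵥ (hankelMat fun k => (v k : ℂ)).mulVec fun a => (y a : ℂ) := by
      rw [show (hankelMat fun k => (v k : ℂ)) = (hankelMat v).map Complex.ofRealHom from
        (hankelMat_map Complex.ofRealHom v).symm]
      simp [dotProduct, Matrix.mulVec]
    rw [hmap, dotProduct_hankelMat_mulVec hx]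
    simp [hy, mul_pow]
  have hnonneg := h.dotProduct_mulVec_nonneg y
  rw [star_trivial, hform] at hnonneg
  have hsum := neg_nonneg.1 (nonneg_of_mul_nonneg_right hnonneg (pow_nu_pos n hv))
  rw [realRooted_altPoly_iff hv hx]
  intro i
  exact pow_eq_zero_iff two_ne_zero |>.1 <| (Finset.sum_eq_zero_iff_of_nonneg
    fun i _ => sq_nonneg _).1 (hsum.antisymm (Finset.sum_nonneg fun i _ => sq_nonneg _)) i
    (Finset.mem_univ i)

end Hermite

section MinorSum

variable {ι : Type*} [Fintype ι] [DecidableEq ι]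

theorem neg_one_pow_mul_eval_neg_charpoly {R : Type*} [CommRing R] (A : Matrix ι ι R) (s : R) :
    (-1) ^ Fintype.card ι * A.charpoly.eval (-s) =
      ∑ k ∈ Finset.range (Fintype.card ι + 1), minorSum k A * s ^ (Fintype.card ι - k) := by
  nontriviality R
  rw [eval_eq_sum_range, A.charpoly_natDegree_eq_dim, Finset.mul_sum, ← Finset.sum_range_reflect]
  refine Finset.sum_congr rfl fun k hk => ?_
  have hk : k ≤ Fintype.card ι := Nat.lt_succ_iff.1 (Finset.mem_range.1 hk)
  have hsign : (-1 : R) ^ Fintype.card ι = (-1) ^ k * (-1) ^ (Fintype.card ι - k) := by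
    rw [← pow_add, Nat.add_sub_cancel' hk]
  rw [Nat.add_sub_cancel, charpoly_coeff_eq_minorSum A hk, neg_pow s, hsign]
  have hsq : ∀ j, (-1 : R) ^ j * (-1) ^ j = 1 := fun j => by
    rw [← mul_pow, neg_mul_neg, one_mul, one_pow]
  linear_combination (minorSum k A * s ^ (Fintype.card ι - k)) *
    ((-1) ^ k * (-1) ^ k * hsq (Fintype.card ι - k) + hsq k)

theorem posSemidef_iff_minorSum_nonneg {A : Matrix ι ι ℝ} (hA : A.IsHermitian) :
    A.PosSemidef ↔ ∀ k < Fintype.card ι, 0 ≤ minorSum (k + 1) A := by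
  refine ⟨fun h k _ => Finset.sum_nonneg fun S _ => (h.submatrix _).det_nonneg, fun h => ?_⟩
  rw [hA.posSemidef_iff_eigenvalues_nonneg]
  intro i
  by_contra hneg
  have hpos : 0 < -hA.eigenvalues i := neg_pos.2 (not_le.1 hneg)
  have hroot : A.charpoly.eval (-(-hA.eigenvalues i)) = 0 := by
    rw [neg_neg, hA.charpoly_eq, eval_prod]
    exact Finset.prod_eq_zero (Finset.mem_univ i) (by simp)
  have hsum := neg_one_pow_mul_eval_neg_charpoly A (-hA.eigenvalues i)
  rw [hroot, mul_zero, Finset.sum_range_succ'] at hsum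
  refine hsum.not_lt (add_pos_of_nonneg_of_pos (Finset.sum_nonneg fun k hk =>
    mul_nonneg (h k (Finset.mem_range.1 hk)) (pow_nonneg hpos.le _)) ?_)
  simpa [minorSum] using pow_pos hpos _

theorem realRooted_altPoly_iff_minorSum_nonneg {n : ℕ} {v : Fin (n + 1) → ℝ} (hv : v 0 ≠ 0) :
    RealRooted (altPoly v) ↔ ∀ k : Fin n, 0 ≤ minorSum (k.val + 1) (hankelMat v) := by
  have hermite : RealRooted (altPoly v) ↔ (hankelMat v).PosSemidef :=
    ⟨posSemidef_hankelMat hv, realRooted_of_posSemidef hv⟩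
  rw [hermite, posSemidef_iff_minorSum_nonneg (isHermitian_hankelMat v), Fintype.card_fin,
    Fin.forall_iff]

end MinorSum

/-! ### Degenerate parameters -/

theorem dense_eval_ne_zero {p : ℝ[X]} (hp : p ≠ 0) : Dense {γ : ℝ | p.eval γ ≠ 0} := by
  have hcompl : {γ : ℝ | p.eval γ ≠ 0} = (p.rootSet ℝ)ᶜ := by
    ext γ
    simp [mem_rootSet, hp]
  rw [hcompl]
  exact (rootSet_finite p ℝ).countable.dense_compl ℝ

theorem le_of_forall_eval_ne_zero {p : ℝ[X]} (hp : p ≠ 0) {f g : ℝ → ℝ} (hf : Continuous f)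
    (hg : Continuous g) (h : ∀ γ, p.eval γ ≠ 0 → f γ ≤ g γ) (γ : ℝ) : f γ ≤ g γ :=
  le_on_closure (s := {γ | p.eval γ ≠ 0}) h hf.continuousOn hg.continuousOn
    (dense_eval_ne_zero hp γ)

theorem RealRooted.norm_aeval_le {p : ℝ[X]} (hp : RealRooted p) (a b : ℝ) {s : ℝ} (hs₀ : 0 ≤ s)
    (hs₁ : s ≤ 1) : ‖aeval (⟨a, s * b⟩ : ℂ) p‖ ≤ ‖aeval (⟨a, b⟩ : ℂ) p‖ := by
  have hroot : ∀ x ∈ p.aroots ℂ, x.im = 0 := fun x hx =>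
    hp.resolve_left (mem_aroots.1 hx).1 x (mem_aroots.1 hx).2
  have hfactor : ∀ z : ℂ, ‖aeval z p‖ =
      ‖(p.map (algebraMap ℝ ℂ)).leadingCoeff‖ * ((p.aroots ℂ).map fun x => ‖z - x‖).prod :=
    fun z => by
    rw [← eval_map_algebraMap, (IsAlgClosed.splits (p.map (algebraMap ℝ ℂ))).eval_eq_prod_roots,
      norm_mul, ← normHom_apply (Multiset.prod _), map_multiset_prod, Multiset.map_map]
    rfl
  rw [hfactor, hfactor]
  refine mul_le_mul_of_nonneg_left (Multiset.prod_map_le_prod_map₀ _ _ (fun x _ => norm_nonneg _)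
    fun x hx => ?_) (norm_nonneg _)
  rw [Complex.norm_def, Complex.norm_def]
  refine Real.sqrt_le_sqrt ?_
  simp only [Complex.normSq_apply, Complex.sub_re, Complex.sub_im, hroot x hx, sub_zero]
  nlinarith [mul_nonneg (sub_nonneg.2 (mul_le_one₀ hs₁ hs₀ hs₁)) (mul_self_nonneg b)]

theorem continuous_norm_aeval_family {n : ℕ} (c : Fin (n + 1) → ℝ[X]) (z : ℂ) :
    Continuous fun γ => ‖aeval z (family c γ)‖ := by
  simp only [family, map_sum, map_mul, aeval_C, map_pow, aeval_X, Complex.coe_algebraMap]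
  fun_prop

-- By continuity in `γ`, the inequality of `RealRooted.norm_aeval_le` holds for every member of the
-- family, so that a nonreal root `z` forces roots on a whole segment from `z` to the real axis.
theorem realRooted_family_of_eval_ne_zero {n : ℕ} {c : Fin (n + 1) → ℝ[X]} (hc : c 0 ≠ 0)
    (h : ∀ γ, (c 0).eval γ ≠ 0 → RealRooted (family c γ)) (γ : ℝ) : RealRooted (family c γ) := by
  rw [RealRooted, or_iff_not_imp_right]
  intro hne
  push Not at hne
  obtain ⟨z, hz, him⟩ := hne
  have hsegment : ∀ s ∈ Set.Icc (0 : ℝ) 1, aeval (⟨z.re, s * z.im⟩ : ℂ) (family c γ) = 0 := by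
    intro s hs
    have hle := le_of_forall_eval_ne_zero hc (continuous_norm_aeval_family c ⟨z.re, s * z.im⟩)
      (continuous_norm_aeval_family c ⟨z.re, z.im⟩)
      (fun γ hγ => (h γ hγ).norm_aeval_le z.re z.im hs.1 hs.2) γ
    rw [Complex.eta, hz, norm_zero] at hle
    exact norm_le_zero_iff.1 hle
  have hinj : Set.InjOn (fun s : ℝ => (⟨z.re, s * z.im⟩ : ℂ)) (Set.Icc 0 1) :=
    fun s _ t _ hst => mul_right_cancel₀ him (congrArg Complex.im hst)
  refine (Polynomial.map_eq_zero (algebraMap ℝ ℂ)).1 (eq_zero_of_infinite_isRoot _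
    (((Set.Icc_infinite one_pos).image hinj).mono ?_))
  rintro _ ⟨s, hs, rfl⟩
  rw [Set.mem_ofPred_eq, IsRoot.def, eval_map_algebraMap]
  exact hsegment s hs

theorem eval_minorSum_hankelMat {R : Type*} [CommRing R] {n : ℕ} (c : Fin (n + 1) → R[X]) (k : ℕ)
    (γ : R) : (minorSum k (hankelMat c)).eval γ = minorSum k (hankelMat fun k => (c k).eval γ) := by
  rw [← coe_evalRingHom, map_minorSum, hankelMat_map]

theorem forall_realRooted_family_iff {n : ℕ} {c : Fin (n + 1) → ℝ[X]} (hc : c 0 ≠ 0) :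
    (∀ γ, RealRooted (family c γ)) ↔
      ∀ (k : Fin n) (γ : ℝ), 0 ≤ (minorSum (k.val + 1) (hankelMat c)).eval γ := by
  have hfiber : ∀ γ, (c 0).eval γ ≠ 0 → (RealRooted (family c γ) ↔
      ∀ k : Fin n, 0 ≤ (minorSum (k.val + 1) (hankelMat c)).eval γ) := fun γ hγ => by
    simp only [eval_minorSum_hankelMat]
    exact realRooted_altPoly_iff_minorSum_nonneg (v := fun k => (c k).eval γ) hγ
  refine ⟨fun h k => ?_, fun h => ?_⟩
  · exact le_of_forall_eval_ne_zero hc continuous_const (Polynomial.continuous _)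
      fun γ hγ => (hfiber γ hγ).1 (h γ) k
  · exact realRooted_family_of_eval_ne_zero hc fun γ hγ => (hfiber γ hγ).2 fun k => h k γ

theorem hankel_eq_hankelMat {n : ℕ} {c : Fin (n + 1) → ℝ[X]} {γ : ℝ} (hγ : (c 0).eval γ ≠ 0) :
    hankel c γ = hankelMat fun k => (((c k).eval γ : ℝ) : ℂ) := by
  have hγ' : (((c 0).eval γ : ℝ) : ℂ) ≠ 0 := by exact_mod_cast hγ
  obtain ⟨x, hx⟩ := exists_roots_altPoly_eq_map (v := fun k => (((c k).eval γ : ℝ) : ℂ)) hγ'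
  have haroots : (family c γ).aroots ℂ = Finset.univ.val.map x := by
    rw [← hx]
    exact congrArg roots (map_altPoly (algebraMap ℝ ℂ) fun k => (c k).eval γ)
  ext a b
  rw [hankelMat_eq_smul_vandermonde (altPoly_eq_mul_prod hγ' hx), Matrix.smul_apply,
    Matrix.vandermonde_transpose_mul_vandermonde, hankel, Matrix.of_apply, rootMoment, haroots,
    Multiset.map_map]
  rfl

theorem coe_eval_minorSum_hankelMat {n : ℕ} {c : Fin (n + 1) → ℝ[X]} (k : ℕ) {γ : ℝ}
    (hγ : (c 0).eval γ ≠ 0) :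
    (((minorSum k (hankelMat c)).eval γ : ℝ) : ℂ) = sumPrincipalMinors k (hankel c γ) := by
  rw [hankel_eq_hankelMat hγ, eval_minorSum_hankelMat]
  exact (map_minorSum Complex.ofRealHom k _).trans (congrArg _ (hankelMat_map _ _))

/-! ### The algorithm as a whole -/

theorem sum_algebraMap_coeff_mul_pow {R A : Type*} [CommSemiring R] [Semiring A] [Algebra R A]
    {p : R[X]} {d : ℕ} (hp : p.natDegree < d) (s : A) :
    ∑ j : Fin d, algebraMap R A (p.coeff j.val) * s ^ j.val = aeval s p := by
  rw [Fin.sum_univ_eq_sum_range (fun j => algebraMap R A (p.coeff j) * s ^ j) d,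
    aeval_eq_sum_range' hp]
  simp only [Algebra.smul_def]

theorem eq_coeff_of_forall_sum_eq {R K : Type*} [CommRing R] [Field K] [Algebra R K] {N : ℕ} {ζ : K}
    (hζ : IsPrimitiveRoot ζ N) {q : R[X]} (hq : q.natDegree < N) {b : Fin N → K}
    (hb : ∀ i : Fin N, ∑ j : Fin N, b j * (ζ ^ i.val) ^ j.val = aeval (ζ ^ i.val) q) (j : Fin N) :
    b j = algebraMap R K (q.coeff j.val) := by
  have hinj : Function.Injective fun i : Fin N => ζ ^ i.val := fun i i' h =>
    Fin.ext (hζ.pow_inj i.isLt i'.isLt h)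
  have hzero := Matrix.eq_zero_of_forall_index_sum_mul_pow_eq_zero
    (v := fun j => b j - algebraMap R K (q.coeff j.val)) hinj fun i => by
      simp only [sub_mul, Finset.sum_sub_distrib]
      rw [hb, sum_algebraMap_coeff_mul_pow hq, sub_self]
  exact sub_eq_zero.1 (congrFun hzero j)

namespace SimpleRR

section Cost

variable {n d : ℕ}

theorem numPoints_ne_zero (hn : n ≠ 0) : numPoints n d ≠ 0 := by
  have := le_nu n
  exact mul_ne_zero (mul_ne_zero hn (Nat.succ_ne_zero d)) (by omega)

theorem numPoints_le (hn : 1 ≤ n) (hd : 1 ≤ d) : numPoints n d ≤ 8 * n ^ 2 * d := by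
  have hν := nu_le n
  calc n * (d + 1) * (2 * n - 2 + nu n) ≤ n * (2 * d) * (4 * n) :=
        Nat.mul_le_mul (Nat.mul_le_mul_left _ (by omega)) (by omega)
    _ = _ := by ring

theorem sum_primeFactorsList_numPoints_le (hn : 1 ≤ n) :
    (numPoints n d).primeFactorsList.sum ≤ 6 * n + d := by
  have hν := nu_le n
  have hν' := le_nu n
  have hsum_n := sum_primeFactorsList_le (n := n) (by omega)
  have hsum_d := sum_primeFactorsList_le (n := d + 1) (by omega)
  have hsum_ν := sum_primeFactorsList_le (n := 2 * n - 2 + nu n) (by omega)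
  rw [numPoints, sum_primeFactorsList_mul (by positivity) (by omega),
    sum_primeFactorsList_mul (by omega) (by omega)]
  omega

theorem hankelCost_le (hn : 1 ≤ n) (hd : 1 ≤ d) : hankelCost n d ≤ 10 * n * d + 22 * n ^ 2 := by
  have hν : (nu n : ℝ) ≤ 2 * n := by exact_mod_cast nu_le n
  have hn' : (1 : ℝ) ≤ n := by exact_mod_cast hn
  have hd' : (1 : ℝ) ≤ d := by exact_mod_cast hd
  rw [hankelCost, Nat.cast_sub (by omega), Nat.cast_sub (by omega)]
  push_cast
  nlinarith [mul_le_mul hn' hd' zero_le_one (by positivity : (0 : ℝ) ≤ n)]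

theorem natCast_pow_four_le_rpow (hn : 1 ≤ n) {ω : ℝ} (hω : 2 ≤ ω) :
    (n : ℝ) ^ 4 ≤ (n : ℝ) ^ (2 + ω) := by
  rw [← Real.rpow_natCast]
  exact Real.rpow_le_rpow_of_exponent_le (by exact_mod_cast hn) (by push_cast; linarith)

theorem loop_cost_le (hn : 1 ≤ n) (hd : 1 ≤ d) {C ω T l : ℝ} (hω : 2 ≤ ω) (hl : 1 ≤ l)
    (hC : 0 ≤ C) (hT : T ≤ C * (n : ℝ) ^ ω * l) :
    numPoints n d * (hankelCost n d + (T + n * 2)) ≤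
      (8 * C + 192) * (d * (n : ℝ) ^ (2 + ω) + (d : ℝ) ^ 2 * (n : ℝ) ^ 3) * l := by
  have hN : (numPoints n d : ℝ) ≤ 8 * n ^ 2 * d := by exact_mod_cast numPoints_le hn hd
  have hn' : (1 : ℝ) ≤ n := by exact_mod_cast hn
  have hsq : (n : ℝ) ≤ n ^ 2 := le_self_pow₀ hn' two_ne_zero
  have hpow := mul_le_mul_of_nonneg_left (natCast_pow_four_le_rpow hn hω) (Nat.cast_nonneg d)
  have hmul : (n : ℝ) ^ 2 * (n : ℝ) ^ ω = (n : ℝ) ^ (2 + ω) := by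
    rw [Real.rpow_add (by positivity), Real.rpow_two]
  calc _ ≤ numPoints n d * (10 * n * d + 24 * n ^ 2 + C * (n : ℝ) ^ ω * l) := by
        refine mul_le_mul_of_nonneg_left ?_ (Nat.cast_nonneg _)
        linarith [hankelCost_le hn hd]
    _ ≤ 8 * n ^ 2 * d * (10 * n * d + 24 * n ^ 2 + C * (n : ℝ) ^ ω * l) := by gcongr
    _ = 8 * C * (d * (n : ℝ) ^ (2 + ω)) * l + 80 * (d ^ 2 * n ^ 3) + 192 * (d * n ^ 4) := by
        rw [← hmul]
        ring
    _ ≤ 8 * C * (d * (n : ℝ) ^ (2 + ω) + (d : ℝ) ^ 2 * (n : ℝ) ^ 3) * l +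
        192 * (d * (n : ℝ) ^ (2 + ω) + (d : ℝ) ^ 2 * (n : ℝ) ^ 3) * l := by
        have hlead : 0 ≤ (d : ℝ) ^ 2 * n ^ 3 := by positivity
        rw [add_assoc]
        refine add_le_add ?_ (le_trans ?_ (le_mul_of_one_le_right (by positivity) hl))
        · gcongr
          exact le_add_of_nonneg_right hlead
        · linarith
    _ = _ := by ring

theorem interp_cost_le (hn : 1 ≤ n) (hd : 1 ≤ d) {ω : ℝ} (hω : 2 ≤ ω) :
    n * (4 * numPoints n d * (numPoints n d).primeFactorsList.sum + (1 + numPoints n d)) ≤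
      193 * (d * (n : ℝ) ^ (2 + ω) + (d : ℝ) ^ 2 * (n : ℝ) ^ 3) := by
  have hN : (numPoints n d : ℝ) ≤ 8 * n ^ 2 * d := by exact_mod_cast numPoints_le hn hd
  have hS : ((numPoints n d).primeFactorsList.sum : ℝ) ≤ 6 * n + d := by
    exact_mod_cast sum_primeFactorsList_numPoints_le (d := d) hn
  have hn' : (1 : ℝ) ≤ n := by exact_mod_cast hn
  have hd' : (1 : ℝ) ≤ d := by exact_mod_cast hd
  have hpow := mul_le_mul_of_nonneg_left (natCast_pow_four_le_rpow hn hω) (Nat.cast_nonneg d)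
  have hlin : (n : ℝ) ≤ d ^ 2 * n ^ 3 :=
    (le_self_pow₀ hn' three_ne_zero).trans
      (le_mul_of_one_le_left (by positivity) (one_le_pow₀ hd'))
  have hcub : (n : ℝ) ^ 3 * d ≤ d ^ 2 * n ^ 3 := by
    rw [mul_comm]
    gcongr
    exact le_self_pow₀ hd' two_ne_zero
  calc _ ≤ (n : ℝ) * (4 * (8 * n ^ 2 * d) * (6 * n + d) + (1 + 8 * n ^ 2 * d)) := by gcongr
    _ = 192 * (d * n ^ 4) + 32 * (d ^ 2 * n ^ 3) + n + 8 * (n ^ 3 * d) := by ring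
    _ ≤ _ := by
        have : 0 ≤ (d : ℝ) * n ^ 4 ∧ 0 ≤ (d : ℝ) ^ 2 * n ^ 3 := by constructor <;> positivity
        linarith

end Cost

theorem outputs_prog {charpolyR : CharpolyRoutine ℂ} {interpR : InterpRoutine ℂ}
    (hR : ComputesCharpoly charpolyR) (hI : ComputesInterp interpR) {n d : ℕ}
    {c : Fin (n + 1) → ℝ[X]} {h : Fin (n + 1) → Fin (d + 1) → ℕ} {mem : List ℂ}
    (hin : ValidInput d c h mem) :
    Outputs ((prog charpolyR interpR n d h).run mem)
      fun k => minorSum (k.val + 1) (hankelMat c) := by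
  obtain ⟨hdeg, -, hmem⟩ := hin
  -- Nothing is known about the cost of the subroutines, so the cost bounds are void.
  have hrun := achieves_progWith (t := False) (T := 0) (T' := 0)
    (N := numPoints n d) (ζ := rootOfUnity (numPoints n d))
    (fun A h mem hA => ⟨hR n A h mem hA, False.elim⟩)
    (fun v h mem hv => ⟨hI _ v h mem hv, False.elim⟩) hmem
  intro k
  have hlt := natDegree_minorSum_hankelMat_lt_numPoints hdeg k.pos.ne' k.isLt
  refine ⟨hlt, fun j => ?_⟩
  obtain ⟨b, hb, hval⟩ := hrun.post k
  refine (hval j).trans (congrArg some (eq_coeff_of_forall_sum_eq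
    (isPrimitiveRoot_rootOfUnity (Nat.ne_zero_of_lt hlt)) hlt (fun i => (hb i).trans ?_) j))
  have hsample : ∀ (k : Fin (n + 1)) (s : ℂ),
      ∑ j : Fin (d + 1), (((c k).coeff j.val : ℝ) : ℂ) * s ^ j.val = aeval s (c k) := fun k s =>
    sum_algebraMap_coeff_mul_pow (Nat.lt_succ_of_le (hdeg k)) s
  simp only [hsample]
  exact ((map_minorSum (aeval _ : ℝ[X] →ₐ[ℝ] ℂ).toRingHom _ _).trans
    (congrArg _ (hankelMat_map _ c))).symm

theorem natDegree_minorSum_hankelMat_le_three_mul {n d : ℕ} {c : Fin (n + 1) → ℝ[X]}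
    (hc : ∀ k, (c k).natDegree ≤ d) (k : Fin n) :
    (minorSum (k.val + 1) (hankelMat c)).natDegree ≤ 3 * n ^ 2 * d :=
  calc _ ≤ n * (d * nu n) := natDegree_minorSum_hankelMat_le hc k.isLt
    _ ≤ n * (d * (3 * n)) := by
        have := nu_le n
        gcongr
        omega
    _ = _ := by ring

theorem cost_prog_le {ω : ℝ} (hω : 2 ≤ ω) (F : FastMul ℂ ω) :
    ∃ (C : ℝ) (κ : ℕ), ∀ n d : ℕ, 1 ≤ n → 1 ≤ d →
      ∀ (c : Fin (n + 1) → ℝ[X]) (h : Fin (n + 1) → Fin (d + 1) → ℕ) (mem : List ℂ),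
        ValidInput d c h mem →
        (((prog F.charpolyRoutine interpRoutine n d h).run mem).cost : ℝ) ≤
          C * ((d : ℝ) * (n : ℝ) ^ (2 + ω) + (d : ℝ) ^ 2 * (n : ℝ) ^ 3) *
            Real.log ((n : ℝ) * (d : ℝ) + 2) ^ κ := by
  obtain ⟨C, hC, hcharpoly⟩ := F.exists_charpolyRoutine_cost_le
  refine ⟨8 * C + 385, 3, fun n d hn hd c h mem hin => ?_⟩
  have hn' : (1 : ℝ) ≤ n := by exact_mod_cast hn
  have hd' : (1 : ℝ) ≤ d := by exact_mod_cast hd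
  have hN : numPoints n d ≠ 0 := numPoints_ne_zero (by omega)
  have := NeZero.mk hN
  have hrun := achieves_progWith (t := True)
    (N := numPoints n d) (ζ := rootOfUnity (numPoints n d))
    (fun A h mem hA => F.achieves_charpolyRoutine hA)
    (fun v h mem hv => (achieves_interpRoutine hN hv).mono le_rfl fun f m _ hf =>
      ⟨_, interp_eq (isPrimitiveRoot_rootOfUnity hN) v, hf⟩) hin.2.2
  have hlog : 1 ≤ Real.log ((n : ℝ) + 2) := one_le_log_add_two hn'
  have hlog_le : Real.log ((n : ℝ) + 2) ≤ Real.log ((n : ℝ) * d + 2) :=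
    Real.log_le_log (by positivity) (by nlinarith)
  set l := Real.log ((n : ℝ) * d + 2) ^ 3
  have hl : 1 ≤ l := one_le_pow₀ (hlog.trans hlog_le)
  have hlog_pow : Real.log ((n : ℝ) + 2) ^ 3 ≤ l :=
    pow_le_pow_left₀ (zero_le_one.trans hlog) hlog_le 3
  calc _ ≤ _ := hrun.cost_le trivial
    _ ≤ (8 * C + 192) * (d * (n : ℝ) ^ (2 + ω) + (d : ℝ) ^ 2 * (n : ℝ) ^ 3) * l +
        193 * (d * (n : ℝ) ^ (2 + ω) + (d : ℝ) ^ 2 * (n : ℝ) ^ 3) * l := by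
        refine add_le_add (loop_cost_le hn hd hω hl hC ((hcharpoly n hn).trans
          (mul_le_mul_of_nonneg_left hlog_pow (by positivity))))
          ((interp_cost_le hn hd hω).trans (le_mul_of_one_le_right (by positivity) hl))
    _ = _ := by ring

end SimpleRR

theorem mainTheorem4 :
    -- Correctness, whatever correct subroutines are used.
    (∀ (charpolyR : SimpleRR.CharpolyRoutine ℂ) (interpR : SimpleRR.InterpRoutine ℂ),
      SimpleRR.ComputesCharpoly charpolyR → SimpleRR.ComputesInterp interpR →
      ∀ (n d : ℕ) (c : Fin (n + 1) → Polynomial ℝ) (h : Fin (n + 1) → Fin (d + 1) → ℕ)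
        (mem : List ℂ), SimpleRR.ValidInput d c h mem →
        ∃ q : Fin n → Polynomial ℝ,
          SimpleRR.Outputs ((SimpleRR.prog charpolyR interpR n d h).run mem) q ∧
          (∀ k, (q k).natDegree ≤ 3 * n ^ 2 * d) ∧
          (∀ (k : Fin n) (γ : ℝ), (c 0).eval γ ≠ 0 →
            (((q k).eval γ : ℝ) : ℂ) = sumPrincipalMinors (k.val + 1) (hankel c γ)) ∧
          ((∀ γ : ℝ, RealRooted (family c γ)) ↔ ∀ (k : Fin n) (γ : ℝ), 0 ≤ (q k).eval γ)) ∧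
    -- Running time, for suitable correct subroutines.
    (∀ ω : ℝ, IsMatMulExponent ω →
      ∃ (charpolyR : SimpleRR.CharpolyRoutine ℂ) (interpR : SimpleRR.InterpRoutine ℂ),
        SimpleRR.ComputesCharpoly charpolyR ∧ SimpleRR.ComputesInterp interpR ∧
        ∃ (C : ℝ) (κ : ℕ), ∀ (n d : ℕ), 1 ≤ n → 1 ≤ d →
          ∀ (c : Fin (n + 1) → Polynomial ℝ) (h : Fin (n + 1) → Fin (d + 1) → ℕ) (mem : List ℂ),
            SimpleRR.ValidInput d c h mem →
            (((SimpleRR.prog charpolyR interpR n d h).run mem).cost : ℝ) ≤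
              C * ((d : ℝ) * (n : ℝ) ^ (2 + ω) + (d : ℝ) ^ 2 * (n : ℝ) ^ 3) *
                Real.log ((n : ℝ) * (d : ℝ) + 2) ^ κ) := by
  constructor
  · intro charpolyR interpR hR hI n d c h mem hin
    exact ⟨fun k => minorSum (k.val + 1) (hankelMat c), SimpleRR.outputs_prog hR hI hin,
      SimpleRR.natDegree_minorSum_hankelMat_le_three_mul hin.1,
      fun k γ hγ => coe_eval_minorSum_hankelMat (k.val + 1) hγ,
      forall_realRooted_family_iff hin.2.1⟩
  · intro ω hω
    obtain ⟨F⟩ := hω.nonempty_fastMul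
    exact ⟨F.charpolyRoutine, interpRoutine, F.computesCharpoly_charpolyRoutine,
      computesInterp_interpRoutine, SimpleRR.cost_prog_le hω.two_le F⟩
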